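/- **Setting.** Let $R=R_V\cup R_E$ be finite sets of vertex types and edge types; a vertex type $v$ has $N_e(v)$ lines of type $e$ attached to it, and for $e'\in R_E$ we put $N_e(e')=2\delta_{e,e'}$. A Feynman graph with residue $r\in R$ is a finite graph, with self-loops and multiple lines allowed, with vertices typed by $R_V$ and unoriented lines typed by $R_E$, such that a vertex of type $v$ has exactly $N_e(v)$ half-lines of type $e$ attached to it, and such that for every $e$ the external lines of type $e$ are labelled bijectively by $1,\dots,N_e(r)$. (If several elements of $R$ have the same external lines, the residue is part of the data.) Isomorphisms act on vertices and half-lines, preserve types, residue and incidence, and fix the labels of the external lines; $\mathrm{Sym}(\Gamma)$ is the order of the automorphism group. A graph is 1PI if it is connected, not a tree, and not disconnected by the removal of any single line. Graphs are taken up to isomorphism. An automorphism of a disjoint union $\gamma$ of 1PI graphs, each with its own labelled external lines, is a permutation of the components together with isomorphisms from the components to their images; $\mathrm{Sym}(\gamma)$ is the number of these, and the loop number of $\gamma$ is the sum of those of its components. For $L=0$ the only graph $\Gamma^r_0$ is the empty graph $\emptyset$, which is the unit $1$ below, with $\mathrm{Sym}(\emptyset)=1$. Let $k$ be a field of characteristic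 $0$ and let $H$ be the free commutative $k$-algebra generated by all 1PI graphs. The coproduct $\Delta:H\to H\otimes H$ is the algebra map given on a 1PI graph $\Gamma$ by $$\Delta(\Gamma)=\Gamma\otimes 1+1\otimes\Gamma+\sum_{\emptyset\ne\gamma\subsetneq\Gamma}\gamma\otimes\Gamma/\gamma ,$$ where $\gamma$ runs over the nonempty proper subgraphs that are disjoint unions of 1PI graphs with residue in $R$ (with a choice of the residue of each component, where it is not unique). In $\Gamma/\gamma$ each component of $\gamma$ is replaced by a vertex or a line according to its residue; a term for which $\Gamma/\gamma$ is not a 1PI Feynman graph is omitted (this happens only if joining lines leaves a closed line without vertices). The left factor $\gamma$ is the product over its components of the average, over all type-preserving labellings of the external lines of the component, of the resulting labelled graph. Let $m_{\Gamma,r'}$ be the number of vertices or internal lines of $\Gamma$ of type $r'$, and $n_{\gamma,r'}$ the number of components of $\gamma$ with residue $r'$. For $\Gamma\neq\emptyset$ the number of insertion places is $$(\Gamma|\gamma)=\prod_{v\in R_V} n_{\gamma,v}!\binom{m_{\Gamma,v}}{n_{\gamma,v}}\prod_{e\in R_E} n_{\gamma,e}!\binom{m_{\Gamma,e}+n_{\gamma,e}-1}{n_{\gamma,e}},$$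 where $\binom{-1}{0}=1$. For the empty graph $\Gamma=\Gamma^r_0=\emptyset$, $(\emptyset|\gamma)=1$ if $\gamma$ is empty or is a single 1PI graph with residue $r$, and $(\emptyset|\gamma)=0$ otherwise. **Proposition.** For every $r\in R$ and $L\ge 0$, $$\sum_{\Gamma^r_L}\frac{1}{\mathrm{Sym}(\Gamma)}\,\Delta(\Gamma)=\sum_{K=0}^{L}\ \sum_{\gamma_K,\ \Gamma^r_{L-K}}\frac{(\Gamma|\gamma)}{\mathrm{Sym}(\gamma)\,\mathrm{Sym}(\Gamma)}\ \gamma\otimes\Gamma ,$$ where $\Gamma^r_{L}$ runs over the 1PI graphs with residue $r$ and loop number $L$ (the empty graph if $L=0$), and $\gamma_K$ over the disjoint unions of 1PI graphs with total loop number $K$, including the empty one for $K=0$. In general this is an identity of formal sums: for every pair of monomials $\mu,\nu$ in the generators only finitely many terms on either side have a nonzero coefficient at $\mu\otimes\nu$, and the coefficients agree. If every vertex type has valence at least $3$, all the sums are finite and the identity holds in $H\otimes H$. -/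

import Mathlib

open scoped TensorProduct

namespace Feynman

/-- The building blocks of the graphs: finite sets of vertex types and of edge types; the vertex
type `v` has `val v e` lines of type `e` attached to it. -/
structure Theory where
  VType : Type
  EType : Type
  [fintypeV : Fintype VType]
  [fintypeE : Fintype EType]
  val : VType → EType → ℕ

attribute [instance] Theory.fintypeV Theory.fintypeE

namespace Theory

/-- The set `R = R_V ∪ R_E`. -/
abbrev Residue (T : Theory) : Type := T.VType ⊕ T.EType

open Classical in
/-- `T.N r e` is the number of lines of type `e` attached to `r`; an edge type `e'` counts as
having two lines of type `e'`. -/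
noncomputable def N (T : Theory) : T.Residue → T.EType → ℕ
  | .inl v, e => T.val v e
  | .inr e', e => if e' = e then 2 else 0

/-- Labels of external lines: `(e, 0), (e, 1), …` are labels for external lines of type `e`. -/
abbrev Label (T : Theory) : Type := T.EType × ℕ

/-- The labels of the external lines of a graph with residue `r`. -/
def LabelsOf (T : Theory) (r : T.Residue) : Type := {a : T.Label // a.2 < T.N r a.1}

end Theory

/-- Raw data of a Feynman graph: vertices `V`, half-lines `H` (the ends of lines which sit at a
vertex), the vertex `att h` at which a half-line sits, the types, and the relation `line h x`
saying that the line which starts with the half-line `h` has `x` as its other end.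
This other end is either another half-line (for an internal line) or a label (for an external
line). Lines have no orientation. -/
structure PreGraph (T : Theory) where
  V : Type
  H : Type
  [finV : Finite V]
  [finH : Finite H]
  res : T.Residue
  att : H → V
  vtype : V → T.VType
  htype : H → T.EType
  line : H → H ⊕ T.Label → Prop

attribute [instance] PreGraph.finV PreGraph.finH

namespace PreGraph

variable {T : Theory}

/-- `G` is a Feynman graph with residue `G.res`: every vertex has the lines prescribed by its type,
every half-line belongs to exactly one line, lines have two ends of the same type, and the external
lines are in type-preserving bijection with the labels belonging to the residue. -/
structure IsFeynman (G : PreGraph T) : Prop where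
  valence : ∀ v e, Nat.card {h : G.H // G.att h = v ∧ G.htype h = e} = T.val (G.vtype v) e
  line_unique : ∀ h, ∃! x, G.line h x
  line_symm : ∀ h h', G.line h (.inl h') → G.line h' (.inl h)
  line_ne : ∀ h h', G.line h (.inl h') → h ≠ h'
  line_type : ∀ h h', G.line h (.inl h') → G.htype h = G.htype h'
  label_type : ∀ h a, G.line h (.inr a) → a.2 < T.N G.res a.1 ∧ G.htype h = a.1
  label_unique : ∀ a : T.Label, a.2 < T.N G.res a.1 → ∃! h, G.line h (.inr a)

/-- The internal lines, as unordered pairs of half-lines. -/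
def lines (G : PreGraph T) : Set (Sym2 G.H) :=
  {p | ∃ h h', p = s(h, h') ∧ G.line h (.inl h')}

/-- The internal lines of type `e`. -/
def linesOfType (G : PreGraph T) (e : T.EType) : Set (Sym2 G.H) :=
  {p | ∃ h h', p = s(h, h') ∧ G.line h (.inl h') ∧ G.htype h = e}

/-- The graph is connected after removal of the internal lines in `D`. -/
def ConnectedWithout (G : PreGraph T) (D : Set (Sym2 G.H)) : Prop :=
  Nonempty G.V ∧ ∀ v w : G.V, Relation.ReflTransGen
    (fun v w => ∃ h h', G.line h (.inl h') ∧ s(h, h') ∉ D ∧ G.att h = v ∧ G.att h' = w) v w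

/-- The loop number `I - V + 1` of a connected graph. -/
noncomputable def loops (G : PreGraph T) : ℕ := G.lines.ncard + 1 - Nat.card G.V

/-- One-particle irreducible Feynman graphs: connected, not a tree, and not disconnected by the
removal of a single line. -/
structure IsOnePI (G : PreGraph T) : Prop where
  isFeynman : G.IsFeynman
  connected : G.ConnectedWithout ∅
  not_tree : G.loops ≠ 0
  bridgeless : ∀ p ∈ G.lines, G.ConnectedWithout {p}

/-- Isomorphisms, which are the identity on the labels of the external lines and preserve types
(and the residue). -/
@[ext]
structure Iso (G G' : PreGraph T) where
  onV : G.V ≃ G'.V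
  onH : G.H ≃ G'.H
  res : G.res = G'.res
  att : ∀ h, G'.att (onH h) = onV (G.att h)
  vtype : ∀ v, G'.vtype (onV v) = G.vtype v
  htype : ∀ h, G'.htype (onH h) = G.htype h
  line : ∀ h h', G'.line (onH h) (.inl (onH h')) ↔ G.line h (.inl h')
  label : ∀ h a, G'.line (onH h) (.inr a) ↔ G.line h (.inr a)

/-- The identity. -/
def Iso.refl (G : PreGraph T) : Iso G G where
  onV := Equiv.refl _
  onH := Equiv.refl _
  res := rfl
  att _ := rfl
  vtype _ := rfl
  htype _ := rfl
  line _ _ := Iff.rfl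
  label _ _ := Iff.rfl

/-- The inverse. -/
def Iso.symm {G G' : PreGraph T} (f : Iso G G') : Iso G' G where
  onV := f.onV.symm
  onH := f.onH.symm
  res := f.res.symm
  att h := by
    rw [Equiv.eq_symm_apply, ← f.att, Equiv.apply_symm_apply]
  vtype v := by rw [← f.vtype, Equiv.apply_symm_apply]
  htype h := by rw [← f.htype, Equiv.apply_symm_apply]
  line h h' := by rw [← f.line, Equiv.apply_symm_apply, Equiv.apply_symm_apply]
  label h a := by rw [← f.label, Equiv.apply_symm_apply]

/-- The composition. -/
def Iso.trans {G G' G'' : PreGraph T} (f : Iso G G') (g : Iso G' G'') : Iso G G'' where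
  onV := f.onV.trans g.onV
  onH := f.onH.trans g.onH
  res := f.res.trans g.res
  att h := by simp [g.att, f.att]
  vtype v := by simp [g.vtype, f.vtype]
  htype h := by simp [g.htype, f.htype]
  line h h' := by simp [g.line, f.line]
  label h a := by simp [g.label, f.label]

/-! ### Subgraphs and contraction -/

/-- The vertices touched by a set of half-lines. -/
def verts (G : PreGraph T) (S : Set G.H) : Set G.V := G.att '' S

/-- The external half-lines of the subgraph whose internal lines are made of the half-lines `S`. -/
def legs (G : PreGraph T) (S : Set G.H) : Set G.H := {h | h ∉ S ∧ G.att h ∈ G.verts S}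

/-- The type-preserving labellings of the external lines of the subgraph `S`, for the residue
`r`. -/
def Labelling (G : PreGraph T) (S : Set G.H) (r : T.Residue) : Type :=
  {l : {h // h ∈ G.legs S} ≃ T.LabelsOf r // ∀ h, (l h).1.1 = G.htype h.1}

/-- The subgraph with internal lines made of the half-lines `S` and with external lines labelled
by `l`, as a graph with residue `r`. -/
def sub (G : PreGraph T) (S : Set G.H) (r : T.Residue) (l : G.Labelling S r) : PreGraph T where
  V := {v : G.V // v ∈ G.verts S}
  H := {h : G.H // G.att h ∈ G.verts S}
  res := r
  att h := ⟨G.att h.1, h.2⟩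
  vtype v := G.vtype v.1
  htype h := G.htype h.1
  line h x :=
    match x with
    | .inl h' => h.1 ∈ S ∧ h'.1 ∈ S ∧ G.line h.1 (.inl h'.1)
    | .inr a => ∃ hl : h.1 ∈ G.legs S, (l.1 ⟨h.1, hl⟩).1 = a

/-- A candidate for a connected component of a subgraph: the half-lines of its internal lines and
its residue. (The residue is determined by the half-lines if distinct elements of `R` have
distinct external lines.) -/
abbrev Piece (G : PreGraph T) : Type := Set G.H × T.Residue

/-- The piece `c` is a 1PI subgraph of `G` with residue `c.2`. -/
def IsOnePIPiece (G : PreGraph T) (c : G.Piece) : Prop :=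
  ∃ l : G.Labelling c.1 c.2, (G.sub c.1 c.2 l).IsOnePI

/-- `s` is a nonempty proper subgraph of `G` which is a disjoint union of 1PI graphs with residue
in `R`, given as the set of its connected components. -/
structure IsProperSub (G : PreGraph T) (s : Finset G.Piece) : Prop where
  nonempty : s.Nonempty
  onePI : ∀ c ∈ s, G.IsOnePIPiece c
  disjoint : ∀ c ∈ s, ∀ c' ∈ s, c ≠ c' → Disjoint (G.verts c.1) (G.verts c'.1)
  proper : ∃ h h', G.line h (.inl h') ∧ ∀ c ∈ s, h ∉ c.1

/-- `G.Leads s h x`: starting from the half-line `h` and following lines, while passing straight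
through the components of `s` whose residue is an edge type (entering at one of the two external
half-lines and leaving at the other one), one gets to `x`. -/
inductive Leads (G : PreGraph T) (s : Finset G.Piece) : G.H → G.H ⊕ T.Label → Prop
  | direct {h x} : G.line h x → Leads G s h x
  | through {h h₁ h₂ x c e} : G.line h (.inl h₁) → c ∈ s → c.2 = .inr e →
      h₁ ∈ G.legs c.1 → h₂ ∈ G.legs c.1 → h₁ ≠ h₂ → Leads G s h₂ x → Leads G s h x

open Classical in
/-- The contracted graph `G / s`. A component of `s` whose residue is a vertex type is replaced by
one vertex of this type; a component whose residue is an edge type is removed and its two external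
lines are joined to one line. -/
noncomputable def contract (G : PreGraph T) (s : Finset G.Piece) : PreGraph T where
  V := {v : G.V // ∀ c ∈ s, v ∉ G.verts c.1} ⊕ {c : G.Piece // c ∈ s ∧ c.2.isLeft}
  H := {h : G.H // (∀ c ∈ s, h ∉ c.1) ∧ ∀ c ∈ s, c.2.isRight → G.att h ∉ G.verts c.1}
  res := G.res
  att h :=
    if hc : ∃ c : {c : G.Piece // c ∈ s ∧ c.2.isLeft}, G.att h.1 ∈ G.verts c.1.1 then
      .inr hc.choose
    else
      .inl ⟨G.att h.1, fun c hcs hv => by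
        rcases hr : c.2 with v | e
        · exact hc ⟨⟨c, hcs, by simp [hr]⟩, hv⟩
        · exact h.2.2 c hcs (by simp [hr]) hv⟩
  vtype x :=
    match x with
    | .inl v => G.vtype v.1
    | .inr c => c.1.2.getLeft c.2.2
  htype h := G.htype h.1
  line h x := G.Leads s h.1 (x.map Subtype.val id)

end PreGraph

/-- Isomorphism of 1PI graphs. -/
instance onePISetoid (T : Theory) : Setoid {G : PreGraph T // G.IsOnePI} where
  r G G' := Nonempty (G.1.Iso G'.1)
  iseqv :=
    { refl := fun G => ⟨PreGraph.Iso.refl G.1⟩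
      symm := fun ⟨f⟩ => ⟨f.symm⟩
      trans := fun ⟨f⟩ ⟨g⟩ => ⟨f.trans g⟩ }

/-- The 1PI graphs up to isomorphism fixing the labels of the external lines. -/
def OnePI (T : Theory) : Type 1 := Quotient (onePISetoid T)

namespace OnePI

variable {T : Theory}

/-- A graph in the isomorphism class. -/
noncomputable def graph (Γ : OnePI T) : PreGraph T := (Quotient.out Γ).1

/-- The residue. -/
noncomputable def res (Γ : OnePI T) : T.Residue := Γ.graph.res

/-- The loop number. -/
noncomputable def loops (Γ : OnePI T) : ℕ := Γ.graph.loops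

/-- The symmetry factor, the order of the automorphism group. -/
noncomputable def symFactor (Γ : OnePI T) : ℕ := Nat.card (Γ.graph.Iso Γ.graph)

/-- `m_{Γ,r}`: the number of vertices or internal lines of type `r`. -/
noncomputable def mult (Γ : OnePI T) : T.Residue → ℕ
  | .inl v => Nat.card {x : Γ.graph.V // Γ.graph.vtype x = v}
  | .inr e => (Γ.graph.linesOfType e).ncard

end OnePI

/-! ### Disjoint unions of 1PI graphs -/

section Unions

variable {T : Theory}

open Classical in
/-- The symmetry factor of a disjoint union `γ` of 1PI graphs. An automorphism of `γ` is a
permutation of the connected components together with label-preserving isomorphisms from each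
component to its image. -/
noncomputable def unionSymFactor (γ : Multiset (OnePI T)) : ℕ :=
  Nat.card (Σ π : Equiv.Perm γ.ToType, ∀ i : γ.ToType, (i.1.graph).Iso ((π i).1.graph))

/-- The loop number of a disjoint union. -/
noncomputable def unionLoops (γ : Multiset (OnePI T)) : ℕ := (γ.map OnePI.loops).sum

open Classical in
/-- `n_{γ,r}`: the number of connected components of `γ` with residue `r`. -/
noncomputable def unionMult (γ : Multiset (OnePI T)) (r : T.Residue) : ℕ :=
  γ.countP (fun c => c.res = r)

/-- The disjoint unions of 1PI graphs with loop number `K`. -/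
def unionsAt (T : Theory) (K : ℕ) : Set (Multiset (OnePI T)) := {γ | unionLoops γ = K}

/-- The graphs `Γ^r_L`: the 1PI graphs with residue `r` and loop number `L`, and, for `L = 0`, the
empty graph `none`. -/
def graphsAt (T : Theory) (r : T.Residue) (L : ℕ) : Set (Option (OnePI T)) :=
  {x | (x = none ∧ L = 0) ∨ ∃ Γ : OnePI T, x = some Γ ∧ Γ.res = r ∧ Γ.loops = L}

/-- The symmetry factor of a 1PI graph or the empty graph. -/
noncomputable def symFactor : Option (OnePI T) → ℕ
  | none => 1
  | some Γ => Γ.symFactor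

open Classical in
/-- `(Γ|γ)`: the number of insertion places for `γ` in the graph `Γ` with residue `r`. For the empty
graph it is `1` if `γ` is empty or a 1PI graph with residue `r`, and `0` otherwise. -/
noncomputable def ins (r : T.Residue) : Option (OnePI T) → Multiset (OnePI T) → ℕ
  | none, γ => if γ = 0 ∨ ∃ c : OnePI T, γ = {c} ∧ c.res = r then 1 else 0
  | some Γ, γ =>
      (∏ v : T.VType, (unionMult γ (.inl v)).factorial *
        (Γ.mult (.inl v)).choose (unionMult γ (.inl v))) *
      ∏ e : T.EType, (unionMult γ (.inr e)).factorial *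
        (Γ.mult (.inr e) + unionMult γ (.inr e) - 1).choose (unionMult γ (.inr e))

end Unions

/-! ### The algebra of graphs and its coproduct -/

section Algebra

variable (k : Type*) [Field k] {T : Theory}

/-- The free commutative algebra generated by the 1PI graphs. -/
abbrev GraphAlg (T : Theory) : Type _ := MvPolynomial (OnePI T) k

open Classical in
/-- The generator given by a 1PI graph. -/
noncomputable def gen (G : PreGraph T) : GraphAlg k T :=
  if hG : G.IsOnePI then MvPolynomial.X (Quotient.mk (onePISetoid T) ⟨G, hG⟩) else 0

/-- The element of the algebra given by a 1PI subgraph: since the external lines of a subgraph carry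
no labels, one takes the average over all the labellings. -/
noncomputable def pieceElt (G : PreGraph T) (c : G.Piece) : GraphAlg k T :=
  (Nat.card (G.Labelling c.1 c.2) : k)⁻¹ • ∑ᶠ l : G.Labelling c.1 c.2, gen k (G.sub c.1 c.2 l)

/-- `Δ(Γ) = Γ ⊗ 1 + 1 ⊗ Γ + ∑_{γ ⊊ Γ} γ ⊗ Γ/γ`. -/
noncomputable def coproductGen (Γ : OnePI T) : GraphAlg k T ⊗[k] GraphAlg k T :=
  MvPolynomial.X Γ ⊗ₜ 1 + 1 ⊗ₜ MvPolynomial.X Γ +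
    ∑ᶠ s ∈ {s : Finset Γ.graph.Piece | Γ.graph.IsProperSub s},
      (∏ c ∈ s, pieceElt k Γ.graph c) ⊗ₜ[k] gen k (Γ.graph.contract s)

/-- The coproduct, as an algebra map. -/
noncomputable def coproduct (T : Theory) :
    GraphAlg k T →ₐ[k] GraphAlg k T ⊗[k] GraphAlg k T :=
  MvPolynomial.aeval (coproductGen k)

/-- A 1PI graph or the empty graph as an element of the algebra. -/
noncomputable def graphElt : Option (OnePI T) → GraphAlg k T
  | none => 1
  | some Γ => MvPolynomial.X Γ

/-- A disjoint union of 1PI graphs as an element of the algebra. -/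
noncomputable def unionElt (γ : Multiset (OnePI T)) : GraphAlg k T :=
  (γ.map MvPolynomial.X).prod

/-- The coefficient of a tensor at `μ ⊗ ν`, for monomials `μ` and `ν` in the 1PI graphs. -/
noncomputable def tensorCoeff (μ ν : OnePI T →₀ ℕ) :
    GraphAlg k T ⊗[k] GraphAlg k T →ₗ[k] k :=
  ((MvPolynomial.basisMonomials (OnePI T) k).tensorProduct
    (MvPolynomial.basisMonomials (OnePI T) k)).coord (μ, ν)

end Algebra

end Feynman

open Feynman

/-!
The identity is proved coefficient by coefficient, at `μ ⊗ ν` for monomials `μ` and `ν`; let `γ`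
be the disjoint union given by `μ`. Both sides vanish unless `ν` is `1` or a single 1PI graph `Γ`.
For `ν = 1` only the terms `Γ' ⊗ 1` and the empty graph contribute. For `ν = Γ` and `γ = ∅` only
the term `1 ⊗ Γ` contributes. The remaining case, `ν = Γ` and `γ ≠ ∅`, is a double count of the
ways in which a graph can be composed of `Γ` and of the components `γ₁, …, γₙ` of `γ`.

* A subgraph of `Γ'` contributes to the coefficient of `Δ(Γ')` at `γ ⊗ Γ` if its components can be
  labelled and matched with the `γᵢ`, and its contraction is isomorphic to `Γ`. After
  multiplication by `Sym(γ) Sym(Γ) ∏ᵢ pᵢ`, with `pᵢ` the number of type-preserving permutations of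
  the external lines of `γᵢ`, the coefficient is the number of subgraphs with chosen labellings,
  matching and isomorphisms (`SubDec`, `subCoeff_mul`). The product of the `pᵢ` is the denominator
  of the average over the labellings.

* Such data amount to embeddings of the vertices and half-lines of the `γᵢ` and of `Γ` into `Γ'`
  which are compatible with the lines, where a vertex of `Γ` may also be sent to the component
  which replaces it (`Frame`, `Frame.card_subDec`). In turn these amount to a
  gluing and an isomorphism from the glued graph to `Γ'` (`Gluing`, `Frame.card_isDec`). A gluing
  consists of an injective choice of vertices of `Γ` for the components whose residue is a vertex
  type, an identification of their external half-lines with the half-lines at these vertices, and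
  a distribution of the other components over the lines of `Γ`. The last item is an involution of
  the ends of all lines outside of the components, which becomes the involution of `Γ` when one
  passes straight through the components, and which has no closed lines (`IsExtension`). A closed
  line, or a component inserted into an external line, would contradict that `Γ'` is 1PI.

* A glued graph is 1PI, with loop number the sum of the loop numbers (`Gluing.glue_isOnePI`,
  `Gluing.glue_loops`). For the first claim, 1PI graphs are described by the condition that every
  cut contains two lines.

Every gluing results in exactly one class `Γ'`, and there are `Sym(Γ')` isomorphisms to `Γ'`. So
the sum of the coefficients over all `Γ'`, weighted by `1 / Sym(Γ')`, is the number of gluings,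
divided by `Sym(γ) Sym(Γ) ∏ᵢ pᵢ`. The number of gluings is `(Γ|γ) ∏ᵢ pᵢ` (`Setup.card_gluing`): at
a vertex there are `pᵢ` identifications, and inserting the components of type `e` into the lines
one after the other, there are `2 m, 2 (m + 1), …` possibilities, where the `2` is `pᵢ` and where
every insertion creates one more line (`card_extension`).

If all vertices have valence at least three, then the numbers of vertices and half-lines of a 1PI
graph are bounded in terms of its loop number and residue, so that all the sums are finite; since
a tensor is determined by its coefficients, the identity holds in the tensor product.
-/

namespace Feynman

/-! ### Half-lines, lines and cuts -/

section Involution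

/-- The orbits of a fixed-point-free involution have two elements each. -/
theorem ncard_image_sym2_mul_two {X : Type*} [Finite X] (m : X → X) (hm : ∀ x, m (m x) = x)
    (P : Set X) (hP : ∀ x ∈ P, m x ∈ P ∧ m x ≠ x) :
    ((fun x => s(x, m x)) '' P).ncard * 2 = P.ncard := by
  classical
  have := Fintype.ofFinite X
  rw [Set.ncard_eq_toFinset_card' P, Set.ncard_eq_toFinset_card']
  rw [Finset.card_eq_sum_card_fiberwise (f := fun x => s(x, m x))
    (t := ((fun x => s(x, m x)) '' P).toFinset)]
  · rw [Finset.sum_const_nat (m := 2)]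
    intro p hp
    obtain ⟨x, hx, rfl⟩ := by simpa using hp
    have : ({a ∈ P.toFinset | s(a, m a) = s(x, m x)} : Finset X) = {x, m x} := by
      ext a
      simp only [Finset.mem_filter, Set.mem_toFinset, Sym2.eq_iff, Finset.mem_insert,
        Finset.mem_singleton]
      constructor
      · rintro ⟨-, h | h⟩ <;> tauto
      · rintro (rfl | rfl)
        · exact ⟨hx, Or.inl ⟨rfl, rfl⟩⟩
        · exact ⟨(hP x hx).1, Or.inr ⟨rfl, hm x⟩⟩
    rw [this, Finset.card_pair (hP x hx).2.symm]
  · intro x hx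
    simp only [Finset.mem_coe, Set.mem_toFinset, Set.mem_image] at *
    exact ⟨x, hx, rfl⟩

end Involution

namespace PreGraph

variable {T : Theory}

/-- The half-line `h` belongs to an internal line. -/
def IsInt (G : PreGraph T) (h : G.H) : Prop := ∃ h', G.line h (.inl h')

open Classical in
/-- The other half of the line of an internal half-line; an external half-line is its own mate. -/
noncomputable def mate (G : PreGraph T) (h : G.H) : G.H :=
  if hh : ∃ h', G.line h (.inl h') then hh.choose else h

namespace IsFeynman

variable {G : PreGraph T} (hG : G.IsFeynman)
include hG

theorem line_right_unique {h : G.H} {x y : G.H ⊕ T.Label} (hx : G.line h x) (hy : G.line h y) :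
    x = y := (hG.line_unique h).unique hx hy

theorem exists_label {h : G.H} (hh : ¬ G.IsInt h) : ∃ a, G.line h (.inr a) := by
  obtain ⟨x | a, hx, -⟩ := hG.line_unique h
  · exact absurd ⟨x, hx⟩ hh
  · exact ⟨a, hx⟩

theorem not_isInt {h : G.H} {a : T.Label} (hh : G.line h (.inr a)) : ¬ G.IsInt h := by
  rintro ⟨h', h''⟩
  cases hG.line_right_unique hh h''

omit hG in
theorem line_mate {h : G.H} (hh : G.IsInt h) : G.line h (.inl (G.mate h)) := by
  rw [mate, dif_pos (show ∃ h', G.line h (.inl h') from hh)]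
  exact Exists.choose_spec hh

theorem mate_eq {h h' : G.H} (hh : G.line h (.inl h')) : G.mate h = h' := by
  have := hG.line_right_unique hh (line_mate ⟨h', hh⟩)
  simpa using this.symm

omit hG in
theorem mate_of_not {h : G.H} (hh : ¬ G.IsInt h) : G.mate h = h := dif_neg hh

theorem isInt_mate {h : G.H} (hh : G.IsInt h) : G.IsInt (G.mate h) :=
  ⟨h, hG.line_symm _ _ (line_mate hh)⟩

theorem mate_mate (h : G.H) : G.mate (G.mate h) = h := by
  by_cases hh : G.IsInt h
  · exact hG.mate_eq (hG.line_symm _ _ (line_mate hh))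
  · rw [mate_of_not hh, mate_of_not hh]

theorem mate_ne {h : G.H} (hh : G.IsInt h) : G.mate h ≠ h :=
  (hG.line_ne _ _ (line_mate hh)).symm

theorem mate_eq_self {h : G.H} : G.mate h = h ↔ ¬ G.IsInt h :=
  ⟨fun e hh => hG.mate_ne hh e, mate_of_not⟩

theorem htype_mate (h : G.H) : G.htype (G.mate h) = G.htype h := by
  by_cases hh : G.IsInt h
  · exact (hG.line_type _ _ (line_mate hh)).symm
  · rw [mate_of_not hh]

theorem lines_ncard : G.lines.ncard * 2 = Nat.card {h // G.IsInt h} := by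
  have : G.lines = (fun h => s(h, G.mate h)) '' {h | G.IsInt h} := by
    ext p
    constructor
    · rintro ⟨h, h', rfl, hl⟩
      exact ⟨h, ⟨h', hl⟩, by simp only [hG.mate_eq hl]⟩
    · rintro ⟨h, hh, rfl⟩
      exact ⟨h, _, rfl, line_mate hh⟩
  rw [this, ncard_image_sym2_mul_two G.mate hG.mate_mate {h | G.IsInt h}
    fun h (hh : G.IsInt h) => ⟨hG.isInt_mate hh, hG.mate_ne hh⟩]
  rfl

theorem linesOfType_ncard (e : T.EType) :
    (G.linesOfType e).ncard * 2 = Nat.card {h // G.IsInt h ∧ G.htype h = e} := by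
  have : G.linesOfType e = (fun h => s(h, G.mate h)) '' {h | G.IsInt h ∧ G.htype h = e} := by
    ext p
    constructor
    · rintro ⟨h, h', rfl, hl, ht⟩
      exact ⟨h, ⟨⟨h', hl⟩, ht⟩, by simp only [hG.mate_eq hl]⟩
    · rintro ⟨h, ⟨hh, ht⟩, rfl⟩
      exact ⟨h, _, rfl, line_mate hh, ht⟩
  rw [this, ncard_image_sym2_mul_two G.mate hG.mate_mate {h | G.IsInt h ∧ G.htype h = e}
    fun h (hh : G.IsInt h ∧ G.htype h = e) =>
      ⟨⟨hG.isInt_mate hh.1, by rw [hG.htype_mate]; exact hh.2⟩, hG.mate_ne hh.1⟩]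
  rfl

end IsFeynman

/-- Connectedness in terms of cuts. -/
theorem connectedWithout_iff (G : PreGraph T) (D : Set (Sym2 G.H)) :
    G.ConnectedWithout D ↔ Nonempty G.V ∧ ∀ U : Set G.V, U.Nonempty → Uᶜ.Nonempty →
      ∃ h h', G.line h (.inl h') ∧ s(h, h') ∉ D ∧ G.att h ∈ U ∧ G.att h' ∉ U := by
  refine and_congr_right fun _ => ⟨fun hc U hU hU' => ?_, fun hc v w => ?_⟩
  · obtain ⟨v, hv⟩ := hU
    obtain ⟨w, hw⟩ := hU'
    by_contra! hno
    refine hw ?_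
    induction hc v w with
    | refl => exact hv
    | tail _ hs ih =>
      obtain ⟨h, h', hl, hD, rfl, rfl⟩ := hs
      by_contra hcon
      by_cases h1 : G.att h ∈ U
      · exact hcon (hno h h' hl hD h1)
      · exact h1 (ih h1)
  · by_contra hvw
    obtain ⟨h, h', hl, hD, h1, h2⟩ := hc {w | Relation.ReflTransGen
      (fun v w => ∃ h h', G.line h (.inl h') ∧ s(h, h') ∉ D ∧ G.att h = v ∧ G.att h' = w) v w}
      ⟨v, .refl⟩ ⟨w, hvw⟩
    exact h2 (Relation.ReflTransGen.tail h1 ⟨h, h', hl, hD, rfl, rfl⟩)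

/-- Every cut contains at least two lines. -/
def CutCond (G : PreGraph T) : Prop :=
  ∀ U : Set G.V, U.Nonempty → Uᶜ.Nonempty → ∀ p : Sym2 G.H,
    ∃ h h', G.line h (.inl h') ∧ s(h, h') ≠ p ∧ G.att h ∈ U ∧ G.att h' ∉ U

/-- Bridgelessness and connectedness together say that no cut consists of at most one line. -/
theorem isOnePI_iff (G : PreGraph T) :
    G.IsOnePI ↔ G.IsFeynman ∧ Nonempty G.V ∧ G.CutCond ∧ G.loops ≠ 0 := by
  constructor
  · intro h
    refine ⟨h.isFeynman, h.connected.1, fun U hU hU' p => ?_, h.not_tree⟩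
    by_cases hp : p ∈ G.lines
    · exact ((G.connectedWithout_iff _).1 (h.bridgeless p hp)).2 U hU hU'
    · obtain ⟨a, b, hl, -, h1, h2⟩ := ((G.connectedWithout_iff _).1 h.connected).2 U hU hU'
      refine ⟨a, b, hl, ?_, h1, h2⟩
      rintro rfl
      exact hp ⟨a, b, rfl, hl⟩
  · rintro ⟨h1, h2, h3, h4⟩
    refine ⟨h1, (G.connectedWithout_iff _).2 ⟨h2, fun U hU hU' => ?_⟩, h4, fun p _ =>
      (G.connectedWithout_iff _).2 ⟨h2, fun U hU hU' => ?_⟩⟩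
    · by_cases hH : Nonempty G.H
      · obtain ⟨a, b, hl, -, h⟩ := h3 U hU hU' s(hH.some, hH.some)
        exact ⟨a, b, hl, by simp, h⟩
      · obtain ⟨u, hu⟩ := hU
        obtain ⟨w, hw⟩ := hU'
        -- without half-lines there are no lines, and the loop number of several vertices is zero
        exfalso
        apply h4
        have hl : G.lines = ∅ := by
          ext p
          simp only [Set.mem_empty_iff_false, iff_false]
          rintro ⟨h, -⟩
          exact hH ⟨h⟩
        have : 2 ≤ Nat.card G.V := by
          have : Nontrivial G.V := ⟨u, w, by rintro rfl; exact hw hu⟩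
          exact Finite.one_lt_card
        rw [loops, hl, Set.ncard_empty]
        omega
    · exact h3 U hU hU' p

namespace IsOnePI

variable {G : PreGraph T} (hG : G.IsOnePI)
include hG

theorem cutCond : G.CutCond := ((isOnePI_iff G).1 hG).2.2.1

theorem nonempty : Nonempty G.V := hG.connected.1

theorem exists_isInt : ∃ h, G.IsInt h := by
  by_contra! hno
  apply hG.not_tree
  have hl : G.lines = ∅ := by
    ext p
    simp only [Set.mem_empty_iff_false, iff_false]
    rintro ⟨h, h', -, hl⟩
    exact hno h ⟨h', hl⟩
  have := hG.nonempty
  have : 0 < Nat.card G.V := Nat.card_pos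
  rw [loops, hl, Set.ncard_empty]
  omega

theorem exists_isInt_att (v : G.V) : ∃ h, G.IsInt h ∧ G.att h = v := by
  by_cases hv : ({v}ᶜ : Set G.V).Nonempty
  · have ⟨p, _⟩ := hG.exists_isInt
    obtain ⟨h, h', hl, -, ha, -⟩ := hG.cutCond {v} ⟨v, rfl⟩ hv s(p, p)
    exact ⟨h, ⟨h', hl⟩, ha⟩
  · obtain ⟨h, hh⟩ := hG.exists_isInt
    refine ⟨h, hh, ?_⟩
    by_contra hc
    exact hv ⟨_, hc⟩

theorem card_V_le : Nat.card G.V ≤ G.lines.ncard := by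
  have := hG.not_tree
  rw [loops] at this
  omega

theorem loops_eq : G.loops + Nat.card G.V = G.lines.ncard + 1 := by
  have := hG.card_V_le
  rw [loops]
  omega

end IsOnePI

/-! ### Isomorphisms -/

namespace Iso

variable {G G' : PreGraph T} (f : Iso G G')
include f

theorem isInt_iff (h : G.H) : G'.IsInt (f.onH h) ↔ G.IsInt h := by
  constructor
  · rintro ⟨h', hh⟩
    exact ⟨f.onH.symm h', by rwa [← f.line, Equiv.apply_symm_apply]⟩
  · rintro ⟨h', hh⟩
    exact ⟨f.onH h', (f.line _ _).2 hh⟩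

theorem isFeynman (hG : G.IsFeynman) : G'.IsFeynman where
  valence v e := by
    obtain ⟨v, rfl⟩ := f.onV.surjective v
    rw [f.vtype, ← hG.valence]
    refine (Nat.card_congr (f.onH.subtypeEquiv fun h => ?_)).symm
    rw [f.att, f.htype, f.onV.apply_eq_iff_eq]
  line_unique h := by
    obtain ⟨h, rfl⟩ := f.onH.surjective h
    obtain ⟨x, hx, hu⟩ := hG.line_unique h
    rcases x with x | a
    · refine ⟨.inl (f.onH x), (f.line _ _).2 hx, ?_⟩
      rintro (y | b) hy
      · obtain ⟨y, rfl⟩ := f.onH.surjective y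
        have := hu _ ((f.line _ _).1 hy)
        simpa using this
      · have := hu _ ((f.label _ _).1 hy)
        cases this
    · refine ⟨.inr a, (f.label _ _).2 hx, ?_⟩
      rintro (y | b) hy
      · obtain ⟨y, rfl⟩ := f.onH.surjective y
        have := hu _ ((f.line _ _).1 hy)
        cases this
      · have := hu _ ((f.label _ _).1 hy)
        simpa using this
  line_symm h h' hl := by
    obtain ⟨h, rfl⟩ := f.onH.surjective h
    obtain ⟨h', rfl⟩ := f.onH.surjective h'
    rw [f.line] at *
    exact hG.line_symm _ _ hl
  line_ne h h' hl := by
    obtain ⟨h, rfl⟩ := f.onH.surjective h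
    obtain ⟨h', rfl⟩ := f.onH.surjective h'
    rw [f.line] at *
    exact f.onH.injective.ne (hG.line_ne _ _ hl)
  line_type h h' hl := by
    obtain ⟨h, rfl⟩ := f.onH.surjective h
    obtain ⟨h', rfl⟩ := f.onH.surjective h'
    rw [f.line] at *
    rw [f.htype, f.htype]
    exact hG.line_type _ _ hl
  label_type h a hl := by
    obtain ⟨h, rfl⟩ := f.onH.surjective h
    rw [f.label] at hl
    rw [f.htype, ← f.res]
    exact hG.label_type _ _ hl
  label_unique a ha := by
    rw [← f.res] at ha
    obtain ⟨h, hh, hu⟩ := hG.label_unique a ha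
    refine ⟨f.onH h, (f.label _ _).2 hh, fun y hy => ?_⟩
    obtain ⟨y, rfl⟩ := f.onH.surjective y
    rw [hu y ((f.label _ _).1 hy)]

theorem loops_eq (hG : G.IsFeynman) : G'.loops = G.loops := by
  have h1 := hG.lines_ncard
  have h2 := (f.isFeynman hG).lines_ncard
  rw [Nat.card_congr (f.onH.subtypeEquiv fun h => (f.isInt_iff h).symm)] at h1
  rw [loops, loops, Nat.card_congr f.onV]
  omega

theorem isOnePI (hG : G.IsOnePI) : G'.IsOnePI := by
  rw [isOnePI_iff] at hG ⊢
  obtain ⟨h1, h2, h3, h4⟩ := hG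
  refine ⟨f.isFeynman h1, h2.map f.onV, fun U hU hU' p => ?_, by rwa [f.loops_eq h1]⟩
  obtain ⟨h, h', hl, hp, ha, ha'⟩ := h3 (f.onV ⁻¹' U) (hU.preimage f.onV.surjective)
    (hU'.preimage f.onV.surjective) (p.map f.onH.symm)
  refine ⟨f.onH h, f.onH h', (f.line _ _).2 hl, ?_, by rwa [f.att], by rwa [f.att]⟩
  rintro rfl
  simp at hp

omit f

/-- Isomorphisms into isomorphic graphs. -/
def congrRight {G'' : PreGraph T} (g : Iso G' G'') : Iso G G' ≃ Iso G G'' where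
  toFun f := f.trans g
  invFun f := f.trans g.symm
  left_inv f := by ext <;> simp [trans, symm]
  right_inv f := by ext <;> simp [trans, symm]

/-- Inversion as a bijection. -/
def symmEquiv : Iso G G' ≃ Iso G' G where
  toFun f := f.symm
  invFun f := f.symm
  left_inv f := by ext <;> simp [symm]
  right_inv f := by ext <;> simp [symm]

instance : Finite (Iso G G') :=
  Finite.of_injective (β := (G.V ≃ G'.V) × (G.H ≃ G'.H)) (fun f => (f.onV, f.onH))
    fun f g h => by
      simp only [Prod.mk.injEq] at h
      exact Iso.ext h.1 h.2

end Iso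

end PreGraph

namespace OnePI

variable {T : Theory}

theorem isOnePI (Γ : OnePI T) : Γ.graph.IsOnePI := (Quotient.out Γ).2

/-- The isomorphism class of a 1PI graph. -/
def mk (G : PreGraph T) (hG : G.IsOnePI) : OnePI T := Quotient.mk (onePISetoid T) ⟨G, hG⟩

theorem mk_eq_mk {G G' : PreGraph T} {hG : G.IsOnePI} {hG' : G'.IsOnePI} :
    mk G hG = mk G' hG' ↔ Nonempty (G.Iso G') :=
  Quotient.eq (r := onePISetoid T)

theorem mk_graph (Γ : OnePI T) : mk Γ.graph Γ.isOnePI = Γ := Quotient.out_eq Γ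

theorem eq_mk_iff {Γ : OnePI T} {G : PreGraph T} {hG : G.IsOnePI} :
    Γ = mk G hG ↔ Nonempty (Γ.graph.Iso G) := by
  conv_lhs => rw [← mk_graph Γ]
  exact mk_eq_mk

theorem symFactor_pos (Γ : OnePI T) : 0 < Γ.symFactor := by
  have : Nonempty (Γ.graph.Iso Γ.graph) := ⟨.refl _⟩
  exact Nat.card_pos

/-- The isomorphisms to a graph isomorphic to a representative are as many as its
automorphisms. -/
theorem card_iso {Γ : OnePI T} {G : PreGraph T} (f : Γ.graph.Iso G) :
    Nat.card (Γ.graph.Iso G) = Γ.symFactor :=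
  (Nat.card_congr (PreGraph.Iso.congrRight f)).symm

end OnePI

end Feynman

namespace Feynman

/-! ### Inserting two-ended pieces into the lines of a matching -/

section Matching

variable {A J J' E : Type*}

/-- The end `a` of the path which starts at `x`, follows the lines of the matching `lam`, and
passes straight through the pieces `j : J`, whose two ends are `(j, false)` and `(j, true)`. -/
inductive Follow (lam : A ⊕ J × Bool → A ⊕ J × Bool) : A ⊕ J × Bool → A → Prop
  | direct {x a} : lam x = .inl a → Follow lam x a
  | through {x a j b} : lam x = .inr (j, b) → Follow lam (.inr (j, !b)) a → Follow lam x a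

theorem Follow.unique {lam : A ⊕ J × Bool → A ⊕ J × Bool} {x : A ⊕ J × Bool} {a a' : A}
    (h : Follow lam x a) (h' : Follow lam x a') : a = a' := by
  induction h with
  | direct h =>
    cases h' with
    | direct h' => simpa [h] using h'
    | through h' _ => rw [h] at h'; cases h'
  | through h _ ih =>
    cases h' with
    | direct h' => rw [h] at h'; cases h'
    | through h' hf =>
      rw [h] at h'
      simp only [Sum.inr.injEq, Prod.mk.injEq] at h'
      obtain ⟨rfl, rfl⟩ := h'
      exact ih hf

/-- The types of the ends. -/
def endType (tA : A → E) (tJ : J → E) : A ⊕ J × Bool → E := Sum.elim tA fun y => tJ y.1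

/-- `lam` arises from the matching `ι` of `A` by inserting the pieces `j : J` into its lines,
respecting types. A matching is encoded as an involution; its fixed points are the unmatched
elements of `A`. The condition `reach` excludes closed lines. -/
structure IsExtension (ι : A → A) (tA : A → E) (tJ : J → E)
    (lam : A ⊕ J × Bool → A ⊕ J × Bool) : Prop where
  invol : ∀ x, lam (lam x) = x
  type : ∀ x, endType tA tJ (lam x) = endType tA tJ x
  fix : ∀ a, lam (.inl a) = .inl a ↔ ι a = a
  fixJ : ∀ y, lam (.inr y) ≠ .inr y
  follow : ∀ a, Follow lam (.inl a) (ι a)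
  reach : ∀ x, ∃ a, Follow lam x a

/-- The inclusion of the ends which do not belong to the piece `none`. -/
def optEmb : A ⊕ J × Bool → A ⊕ Option J × Bool := Sum.map id (Prod.map some id)

theorem optEmb_injective : Function.Injective (optEmb : A ⊕ J × Bool → _) :=
  Function.Injective.sumMap Function.injective_id
    ((Option.some_injective _).prodMap Function.injective_id)

theorem optEmb_ne_none (x : A ⊕ J × Bool) (b : Bool) : optEmb x ≠ .inr (none, b) := by
  rcases x with a | ⟨j, b'⟩ <;> simp [optEmb]

theorem optEmb_cases (w : A ⊕ Option J × Bool) :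
    (∃ x : A ⊕ J × Bool, w = optEmb x) ∨ ∃ b, w = .inr (none, b) := by
  rcases w with a | ⟨_ | j, b⟩
  · exact .inl ⟨.inl a, rfl⟩
  · exact .inr ⟨b, rfl⟩
  · exact .inl ⟨.inr (j, b), rfl⟩

/-- Passing through the piece `none`. -/
def skipNone (lam : A ⊕ Option J × Bool → A ⊕ Option J × Bool) :
    A ⊕ Option J × Bool → A ⊕ Option J × Bool
  | .inl a => .inl a
  | .inr (some j, b) => .inr (some j, b)
  | .inr (none, b) => lam (.inr (none, !b))

@[simp] theorem skipNone_optEmb (lam : A ⊕ Option J × Bool → A ⊕ Option J × Bool)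
    (x : A ⊕ J × Bool) : skipNone lam (optEmb x) = optEmb x := by
  rcases x with a | ⟨j, b⟩ <;> rfl

@[simp] theorem skipNone_none (lam : A ⊕ Option J × Bool → A ⊕ Option J × Bool) (b : Bool) :
    skipNone lam (.inr (none, b)) = lam (.inr (none, !b)) := rfl

/-- `lam'` is obtained from `lam` by joining the two lines at the piece `none`. -/
def IsSmoothing (lam : A ⊕ Option J × Bool → A ⊕ Option J × Bool)
    (lam' : A ⊕ J × Bool → A ⊕ J × Bool) : Prop :=
  ∀ y, optEmb (lam' y) = skipNone lam (lam (optEmb y))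

/-- Smoothing does not change the ends of the paths. -/
theorem IsSmoothing.follow_iff {lam : A ⊕ Option J × Bool → A ⊕ Option J × Bool}
    {lam' : A ⊕ J × Bool → A ⊕ J × Bool} (hS : IsSmoothing lam lam') {y : A ⊕ J × Bool} {a : A} :
    Follow lam' y a ↔ Follow lam (optEmb y) a := by
  constructor
  · intro h
    induction h with
    | @direct y a h =>
      have h1 := hS y
      rw [h] at h1
      rcases optEmb_cases (lam (optEmb y)) with ⟨z, hz⟩ | ⟨b, hb⟩
      · rw [hz, skipNone_optEmb] at h1
        exact .direct (hz.trans h1.symm)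
      · rw [hb, skipNone_none] at h1
        exact .through hb (.direct h1.symm)
    | @through y a j b h _ ih =>
      have h1 := hS y
      rw [h] at h1
      rcases optEmb_cases (lam (optEmb y)) with ⟨z, hz⟩ | ⟨b, hb⟩
      · rw [hz, skipNone_optEmb] at h1
        exact .through (hz.trans h1.symm) ih
      · rw [hb, skipNone_none] at h1
        exact .through hb (.through h1.symm ih)
  · intro h
    suffices H : ∀ w a, Follow lam w a → ∀ y, skipNone lam (lam w) = optEmb (lam' y) →
        Follow lam' y a from H _ _ h y (hS y).symm
    clear h
    intro w a h
    induction h with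
    | @direct w a h =>
      intro y hy
      rw [h] at hy
      exact .direct (optEmb_injective hy.symm)
    | @through w a j b h _ ih =>
      intro y hy
      rw [h] at hy
      cases j with
      | none =>
        rw [skipNone_none] at hy
        exact ih y (by rw [hy, skipNone_optEmb])
      | some j =>
        exact .through (optEmb_injective hy.symm) (ih (.inr (j, !b)) (hS (.inr (j, !b))).symm)

/-- The insertion of the piece `none` into a line of `lam` at the end `x` of this line, such that
`x` becomes joined to `(none, false)`. -/
noncomputable def insertNone (lam : A ⊕ J × Bool → A ⊕ J × Bool) (x : A ⊕ J × Bool) :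
    A ⊕ Option J × Bool → A ⊕ Option J × Bool :=
  open Classical in
  let f : A ⊕ J × Bool → A ⊕ Option J × Bool := fun y =>
    if y = x then .inr (none, false) else if y = lam x then .inr (none, true) else optEmb (lam y)
  fun w => match w with
    | .inl a => f (.inl a)
    | .inr (some j, b) => f (.inr (j, b))
    | .inr (none, false) => optEmb x
    | .inr (none, true) => optEmb (lam x)

section insertNone

variable (lam : A ⊕ J × Bool → A ⊕ J × Bool) (x : A ⊕ J × Bool)

open Classical in
theorem insertNone_optEmb (y : A ⊕ J × Bool) : insertNone lam x (optEmb y) =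
    if y = x then .inr (none, false) else if y = lam x then .inr (none, true)
      else optEmb (lam y) := by
  rcases y with a | ⟨j, b⟩ <;> rfl

theorem insertNone_false : insertNone lam x (.inr (none, false)) = optEmb x := rfl

theorem insertNone_true : insertNone lam x (.inr (none, true)) = optEmb (lam x) := rfl

end insertNone

theorem endType_optEmb (tA : A → E) (tJ : Option J → E) (x : A ⊕ J × Bool) :
    endType tA tJ (optEmb x) = endType tA (fun j => tJ (some j)) x := by
  rcases x with a | ⟨j, b⟩ <;> rfl

variable {ι : A → A} {tA : A → E}

/-- The ends at which a piece of type `e` may be inserted. -/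
def InsertEnd (ι : A → A) (tA : A → E) (tJ : J → E) (e : E) : Type _ :=
  {x : A ⊕ J × Bool // endType tA tJ x = e ∧ ∀ a, x = .inl a → ι a ≠ a}

theorem isSmoothing_insertNone {tJ : J → E} {lam : A ⊕ J × Bool → A ⊕ J × Bool}
    (hl : IsExtension ι tA tJ lam) {x : A ⊕ J × Bool} (hx : lam x ≠ x) :
    IsSmoothing (insertNone lam x) lam := by
  intro y
  rw [insertNone_optEmb]
  split_ifs with h1 h2
  · subst h1
    rw [skipNone_none, Bool.not_false, insertNone_true]
  · subst h2
    rw [skipNone_none, Bool.not_true, insertNone_false, hl.invol]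
  · rw [skipNone_optEmb]

theorem isExtension_insertNone {tJ : Option J → E} {lam : A ⊕ J × Bool → A ⊕ J × Bool}
    (hl : IsExtension ι tA (fun j => tJ (some j)) lam)
    {x : A ⊕ J × Bool} (ht : endType tA (fun j => tJ (some j)) x = tJ none) (hx : lam x ≠ x) :
    IsExtension ι tA tJ (insertNone lam x) := by
  have hS := isSmoothing_insertNone hl hx
  have hfix : ∀ y, insertNone lam x (optEmb y) = optEmb y ↔ lam y = y := by
    intro y
    rw [insertNone_optEmb]
    split_ifs with h1 h2
    · subst h1
      exact iff_of_false (optEmb_ne_none _ _).symm hx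
    · subst h2
      rw [hl.invol]
      exact iff_of_false (optEmb_ne_none _ _).symm hx.symm
    · exact optEmb_injective.eq_iff
  refine ⟨fun w => ?_, fun w => ?_, fun a => (hfix (.inl a)).trans (hl.fix a), ?_, fun a =>
    hS.follow_iff.1 (hl.follow a), fun w => ?_⟩
  · rcases optEmb_cases w with ⟨y, rfl⟩ | ⟨_ | _, rfl⟩
    · rw [insertNone_optEmb]
      split_ifs with h1 h2
      · rw [insertNone_false, h1]
      · rw [insertNone_true, h2]
      · rw [insertNone_optEmb, if_neg, if_neg, hl.invol]
        · exact fun h => h1 (by rw [← hl.invol y, h, hl.invol])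
        · exact fun h => h2 (by rw [← h, hl.invol])
    · rw [insertNone_false, insertNone_optEmb, if_pos rfl]
    · rw [insertNone_true, insertNone_optEmb, if_neg hx, if_pos rfl]
  · rcases optEmb_cases w with ⟨y, rfl⟩ | ⟨_ | _, rfl⟩
    · rw [insertNone_optEmb]
      split_ifs with h1 h2
      · rw [endType_optEmb, h1, ht]
        rfl
      · rw [endType_optEmb, h2, hl.type, ht]
        rfl
      · rw [endType_optEmb, endType_optEmb, hl.type]
    · rw [insertNone_false, endType_optEmb, ht]
      rfl
    · rw [insertNone_true, endType_optEmb, hl.type, ht]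
      rfl
  · rintro ⟨_ | j, b⟩
    · cases b
      · rw [insertNone_false]
        exact optEmb_ne_none _ _
      · rw [insertNone_true]
        exact optEmb_ne_none _ _
    · exact fun h => hl.fixJ (j, b) ((hfix (.inr (j, b))).1 h)
  · have key : ∀ z : A ⊕ J × Bool, ∀ w, insertNone lam x w = optEmb z →
        ∃ a, Follow (insertNone lam x) w a := by
      rintro (a | ⟨j, b⟩) w hw
      · exact ⟨a, .direct hw⟩
      · obtain ⟨a, ha⟩ := hl.reach (.inr (j, !b))
        exact ⟨a, .through hw (hS.follow_iff.1 ha)⟩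
    rcases optEmb_cases w with ⟨y, rfl⟩ | ⟨_ | _, rfl⟩
    · obtain ⟨a, ha⟩ := hl.reach y
      exact ⟨a, hS.follow_iff.1 ha⟩
    · exact key _ _ (insertNone_false _ _)
    · exact key _ _ (insertNone_true _ _)

/-- Every extension by the pieces `Option J` arises from an extension by the pieces `J` by
insertion of the last piece. -/
theorem IsExtension.exists_insertNone {tJ : Option J → E}
    {lam : A ⊕ Option J × Bool → A ⊕ Option J × Bool} (hl : IsExtension ι tA tJ lam) :
    ∃ lam' x, IsExtension ι tA (fun j => tJ (some j)) lam' ∧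
      endType tA (fun j => tJ (some j)) x = tJ none ∧ lam' x ≠ x ∧ insertNone lam' x = lam := by
  -- a line joining the two ends of the last piece would be a closed line
  have hopen : ∀ b, ∃ z : A ⊕ J × Bool, lam (.inr (none, b)) = optEmb z := by
    intro b
    rcases optEmb_cases (lam (.inr (none, b))) with h | ⟨b', hb'⟩
    · exact h
    · exfalso
      have hb : b' = !b := by
        have : b' ≠ b := fun h => hl.fixJ (none, b) (by rw [hb', h])
        revert this; cases b <;> cases b' <;> simp
      subst hb
      obtain ⟨a, ha⟩ := hl.reach (.inr (none, b))
      have H : ∀ w a, Follow lam w a → w ≠ .inr (none, b) := by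
        intro w a h
        induction h with
        | direct h => rintro rfl; rw [hb'] at h; cases h
        | through h _ ih =>
          rintro rfl
          rw [hb'] at h
          simp only [Sum.inr.injEq, Prod.mk.injEq] at h
          obtain ⟨rfl, rfl⟩ := h
          exact ih (by simp)
      exact H _ _ ha rfl
  have hex : ∀ y : A ⊕ J × Bool, ∃ z, optEmb z = skipNone lam (lam (optEmb y)) := by
    intro y
    rcases optEmb_cases (lam (optEmb y)) with ⟨z, hz⟩ | ⟨b, hb⟩
    · exact ⟨z, by rw [hz, skipNone_optEmb]⟩
    · obtain ⟨z, hz⟩ := hopen (!b)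
      exact ⟨z, by rw [hb, skipNone_none, hz]⟩
  choose lam' hS using hex
  have hS : IsSmoothing lam lam' := hS
  obtain ⟨x, hx⟩ := hopen false
  have hfix : ∀ y, lam' y = y ↔ lam (optEmb y) = optEmb y := by
    intro y
    have h1 := hS y
    rcases optEmb_cases (lam (optEmb y)) with ⟨z, hz⟩ | ⟨b, hb⟩
    · rw [hz, skipNone_optEmb] at h1
      rw [hz, ← h1, optEmb_injective.eq_iff]
    · rw [hb, skipNone_none] at h1
      refine iff_of_false (fun h => ?_) (by rw [hb]; exact (optEmb_ne_none _ _).symm)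
      rw [h] at h1
      rw [h1, hl.invol] at hb
      simp at hb
  have hE : IsExtension ι tA (fun j => tJ (some j)) lam' := by
    refine ⟨fun y => optEmb_injective ?_, fun y => ?_, fun a => (hfix _).trans (hl.fix a), ?_,
      fun a => hS.follow_iff.2 (hl.follow a), fun y => ?_⟩
    · rw [hS, hS]
      rcases optEmb_cases (lam (optEmb y)) with ⟨z, hz⟩ | ⟨b, hb⟩
      · rw [hz, skipNone_optEmb, ← hz, hl.invol, skipNone_optEmb]
      · rw [hb, skipNone_none, hl.invol, skipNone_none, Bool.not_not, ← hb, hl.invol]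
    · rw [← endType_optEmb, ← endType_optEmb, hS, ← hl.type (optEmb y)]
      rcases optEmb_cases (lam (optEmb y)) with ⟨z, hz⟩ | ⟨b, hb⟩
      · rw [hz, skipNone_optEmb]
      · rw [hb, skipNone_none, hl.type]
        rfl
    · rintro ⟨j, b⟩ h
      exact hl.fixJ _ ((hfix _).1 h)
    · obtain ⟨a, ha⟩ := hl.reach (optEmb y)
      exact ⟨a, hS.follow_iff.2 ha⟩
  have hx' : lam (optEmb x) = .inr (none, false) := by rw [← hx, hl.invol]
  refine ⟨lam', x, hE, ?_, fun h => ?_, ?_⟩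
  · rw [← endType_optEmb, ← hx, hl.type]
    rfl
  · rw [hfix, hx'] at h
    exact optEmb_ne_none _ _ h.symm
  · have ht : lam (.inr (none, true)) = optEmb (lam' x) := by
      rw [hS, hx', skipNone_none, Bool.not_false]
    funext w
    rcases optEmb_cases w with ⟨y, rfl⟩ | ⟨_ | _, rfl⟩
    · rw [insertNone_optEmb]
      split_ifs with h1 h2
      · rw [h1, hx']
      · rw [h2, ← ht, hl.invol]
      · rw [hS]
        rcases optEmb_cases (lam (optEmb y)) with ⟨z, hz⟩ | ⟨_ | _, hb⟩
        · rw [hz, skipNone_optEmb]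
        · refine absurd (optEmb_injective ?_) h1
          rw [← hx, ← hb, hl.invol]
        · refine absurd (optEmb_injective ?_) h2
          rw [← ht, ← hb, hl.invol]
    · rw [insertNone_false, hx]
    · rw [insertNone_true, ht]

theorem IsExtension.apply_ne {tJ : J → E} {lam : A ⊕ J × Bool → A ⊕ J × Bool}
    (hl : IsExtension ι tA tJ lam) {x : A ⊕ J × Bool} :
    lam x ≠ x ↔ ∀ a, x = .inl a → ι a ≠ a := by
  rcases x with a | y
  · simp [hl.fix]
  · simp [hl.fixJ]

/-- The extensions by one more piece: this piece is inserted at an arbitrary end of type `e`. -/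
theorem card_extension_option (ι : A → A) (tA : A → E) (tJ : Option J → E) :
    Nat.card {lam // IsExtension ι tA tJ lam} =
      Nat.card {lam // IsExtension ι tA (fun j => tJ (some j)) lam} *
        Nat.card (InsertEnd ι tA (fun j => tJ (some j)) (tJ none)) := by
  rw [← Nat.card_prod]
  symm
  refine Nat.card_eq_of_bijective (fun p => ⟨insertNone p.1.1 p.2.1,
    isExtension_insertNone p.1.2 p.2.2.1 (p.1.2.apply_ne.2 p.2.2.2)⟩) ⟨?_, ?_⟩
  · rintro ⟨⟨l, hl⟩, ⟨x, hx⟩⟩ ⟨⟨l', hl'⟩, ⟨x', hx'⟩⟩ h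
    have h : insertNone l x = insertNone l' x' := congrArg Subtype.val h
    obtain rfl : x = x' := by
      have := congrFun h (.inr (none, false))
      rw [insertNone_false, insertNone_false] at this
      exact optEmb_injective this
    obtain rfl : l = l' := by
      funext y
      apply optEmb_injective
      rw [isSmoothing_insertNone hl (hl.apply_ne.2 hx.2) y,
        isSmoothing_insertNone hl' (hl'.apply_ne.2 hx'.2) y, h]
    rfl
  · rintro ⟨l, hl⟩
    obtain ⟨l', x, h1, h2, h3, rfl⟩ := hl.exists_insertNone
    exact ⟨⟨⟨l', h1⟩, ⟨x, h2, h1.apply_ne.1 h3⟩⟩, rfl⟩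

/-- A line of type `e` has two ends, and each inserted piece of type `e` has two of them, too. -/
theorem card_insertEnd [Finite A] [Finite J] (ι : A → A) (tA : A → E) (tJ : J → E) (e : E) :
    Nat.card (InsertEnd ι tA tJ e) =
      Nat.card {a // ι a ≠ a ∧ tA a = e} + Nat.card {j // tJ j = e} * 2 := by
  have e1 : InsertEnd ι tA tJ e ≃ {a // ι a ≠ a ∧ tA a = e} ⊕ {j // tJ j = e} × Bool :=
    { toFun := fun x => match x with
        | ⟨.inl a, h⟩ => .inl ⟨a, h.2 a rfl, h.1⟩
        | ⟨.inr (j, b), h⟩ => .inr (⟨j, h.1⟩, b)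
      invFun := fun x => match x with
        | .inl a => ⟨.inl a.1, a.2.2, by rintro _ ⟨⟩; exact a.2.1⟩
        | .inr (j, b) => ⟨.inr (j.1, b), j.2, by rintro _ ⟨⟩⟩
      left_inv := by rintro ⟨a | ⟨j, b⟩, h⟩ <;> rfl
      right_inv := by rintro (a | ⟨j, b⟩) <;> rfl }
  rw [Nat.card_congr e1, Nat.card_sum, Nat.card_prod, Nat.card_eq_fintype_card (α := Bool),
    Fintype.card_bool]

/-- Renaming the pieces. -/
theorem card_extension_congr (ι : A → A) (tA : A → E) (tJ : J' → E) (f : J ≃ J') :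
    Nat.card {lam // IsExtension ι tA tJ lam} =
      Nat.card {lam // IsExtension ι tA (fun j => tJ (f j)) lam} := by
  let F : A ⊕ J × Bool ≃ A ⊕ J' × Bool :=
    Equiv.sumCongr (Equiv.refl A) (Equiv.prodCongr f (Equiv.refl Bool))
  have hF : ∀ x, endType tA tJ (F x) = endType tA (fun j => tJ (f j)) x := by
    rintro (a | ⟨j, b⟩) <;> rfl
  have h1 : ∀ lam x a, Follow lam x a → Follow (fun y => F (lam (F.symm y))) (F x) a := by
    intro lam x a h
    induction h with
    | direct h => exact .direct (by simp only [Equiv.symm_apply_apply, h]; rfl)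
    | @through x a j b h _ ih =>
      exact .through (j := f j) (b := b) (by simp only [Equiv.symm_apply_apply, h]; rfl) ih
  have h2 : ∀ lam x a, Follow lam x a → Follow (fun y => F.symm (lam (F y))) (F.symm x) a := by
    intro lam x a h
    induction h with
    | direct h => exact .direct (by simp only [Equiv.apply_symm_apply, h]; rfl)
    | @through x a j b h _ ih =>
      exact .through (j := f.symm j) (b := b) (by simp only [Equiv.apply_symm_apply, h]; rfl) ih
  have hF' : ∀ x, endType tA (fun j => tJ (f j)) (F.symm x) = endType tA tJ x := by
    intro x
    rw [← hF, Equiv.apply_symm_apply]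
  refine Nat.card_congr
    { toFun := fun l => ⟨fun y => F.symm (l.1 (F y)), ?_⟩
      invFun := fun l => ⟨fun y => F (l.1 (F.symm y)), ?_⟩
      left_inv := fun l => by simp
      right_inv := fun l => by simp }
  · obtain ⟨l, hl⟩ := l
    refine ⟨fun x => by simp [hl.invol], fun x => by rw [hF', hl.type, hF], fun a => ?_,
      fun y h => hl.fixJ (f y.1, y.2) ?_, fun a => h2 l _ _ (hl.follow a), fun x => ?_⟩
    · rw [← hl.fix, Equiv.symm_apply_eq]
      rfl
    · rwa [Equiv.symm_apply_eq] at h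
    · obtain ⟨a, ha⟩ := hl.reach (F x)
      exact ⟨a, by simpa using h2 l _ _ ha⟩
  · obtain ⟨l, hl⟩ := l
    refine ⟨fun x => by simp [hl.invol], fun x => by rw [hF, hl.type, hF'], fun a => ?_,
      fun y h => hl.fixJ (f.symm y.1, y.2) ?_, fun a => h1 l _ _ (hl.follow a), fun x => ?_⟩
    · rw [← hl.fix, ← Equiv.eq_symm_apply]
      rfl
    · rwa [← Equiv.eq_symm_apply] at h
    · obtain ⟨a, ha⟩ := hl.reach (F.symm x)
      exact ⟨a, by simpa using h1 l _ _ ha⟩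

/-- The number of extensions of a matching with `m e` lines of type `e` by `n e` pieces of
type `e`: a piece has two orientations, and every inserted piece increases the number of lines
by one. -/
theorem card_extension [Fintype E] [Finite A] (ι : A → A) (hι : ∀ a, ι (ι a) = a) (tA : A → E)
    (htype : ∀ a, tA (ι a) = tA a)
    (m : E → ℕ) (hm : ∀ e, m e * 2 = Nat.card {a // ι a ≠ a ∧ tA a = e})
    (J : Type) [Finite J] (tJ : J → E) :
    Nat.card {lam // IsExtension ι tA tJ lam} =
      ∏ e, 2 ^ Nat.card {j // tJ j = e} * (m e).ascFactorial (Nat.card {j // tJ j = e}) := by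
  classical
  induction J using Finite.induction_empty_option with
  | of_equiv f ih =>
    rw [card_extension_congr ι tA tJ f, ih]
    refine Finset.prod_congr rfl fun e _ => ?_
    rw [Nat.card_congr (f.subtypeEquiv (p := fun j => tJ (f j) = e) (q := fun j => tJ j = e)
      fun j => Iff.rfl)]
  | h_empty =>
    have h1 : ∀ e, Nat.card {j // tJ j = e} = 0 := fun e => Nat.card_eq_zero.2 (.inl inferInstance)
    simp only [h1, pow_zero, Nat.ascFactorial_zero, mul_one, Finset.prod_const_one]
    rw [Nat.card_eq_one_iff_unique]
    have huniq : ∀ lam, IsExtension ι tA tJ lam → ∀ a, lam (.inl a) = .inl (ι a) := by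
      intro lam hl a
      cases hl.follow a with
      | direct h => exact h
      | @through _ _ j _ _ _ => exact j.elim
    refine ⟨⟨fun l l' => ?_⟩, ⟨⟨fun x => x.elim (fun a => .inl (ι a)) fun y => y.1.elim, ?_⟩⟩⟩
    · ext x
      rcases x with a | ⟨j, b⟩
      · rw [huniq _ l.2, huniq _ l'.2]
      · exact j.elim
    · refine ⟨?_, ?_, fun a => by simp, fun y => y.1.elim, fun a => .direct rfl, ?_⟩
      · rintro (a | ⟨j, b⟩)
        · simp [hι]
        · exact j.elim
      · rintro (a | ⟨j, b⟩)
        · simp [endType, htype]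
        · exact j.elim
      · rintro (a | ⟨j, b⟩)
        · exact ⟨_, .direct rfl⟩
        · exact j.elim
  | @h_option J _ ih =>
    rw [card_extension_option, ih, card_insertEnd, ← hm, ← add_mul]
    have hcard : ∀ e, Nat.card {j : Option J // tJ j = e} =
        Nat.card {j : J // tJ (some j) = e} + if e = tJ none then 1 else 0 := by
      intro e
      rw [Nat.card_eq_fintype_card, Nat.card_eq_fintype_card, Fintype.card_subtype,
        Fintype.card_subtype, Finset.card_filter, Finset.card_filter, Fintype.sum_option, add_comm]
      simp only [eq_comm]
    have h2 : ∀ e, 2 ^ Nat.card {j : Option J // tJ j = e} *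
        (m e).ascFactorial (Nat.card {j : Option J // tJ j = e}) =
        (2 ^ Nat.card {j : J // tJ (some j) = e} *
        (m e).ascFactorial (Nat.card {j : J // tJ (some j) = e})) *
        if e = tJ none then (m e + Nat.card {j : J // tJ (some j) = e}) * 2 else 1 := by
      intro e
      rw [hcard]
      split_ifs with he
      · rw [pow_succ, Nat.ascFactorial_succ]
        ring
      · simp
    rw [Finset.prod_congr rfl fun e _ => h2 e, Finset.prod_mul_distrib (g := fun e => ite _ _ _),
      Finset.prod_ite_eq' Finset.univ (tJ none), if_pos (Finset.mem_univ _)]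

end Matching

end Feynman

namespace Feynman

section Crossing

variable {A J E : Type*} {ι : A → A} {tA : A → E} {tJ : J → E} {lam : A ⊕ J × Bool → A ⊕ J × Bool}

/-- A path from one side of a cut to the other one crosses the cut along a line, if the cut does not
cut through the inserted pieces. -/
theorem Follow.exists_crossing {side : A ⊕ J × Bool → Prop}
    (hside : ∀ j b, side (.inr (j, b)) → side (.inr (j, !b))) {x : A ⊕ J × Bool} {a : A}
    (hf : Follow lam x a) (hx : side x) (ha : ¬ side (.inl a)) :
    ∃ z, side z ∧ ¬ side (lam z) ∧ Follow lam z a := by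
  induction hf with
  | @direct x a h => exact ⟨x, hx, by rwa [h], .direct h⟩
  | @through x a j b h hf ih =>
    by_cases hs : side (.inr (j, b))
    · exact ih (hside _ _ hs) ha
    · exact ⟨x, hx, by rwa [h], .through h hf⟩

theorem even_ncard_of_involution {X : Type*} [Finite X] (m : X → X) (hm : ∀ x, m (m x) = x)
    (P : Set X) (hP : ∀ x ∈ P, m x ∈ P ∧ m x ≠ x) : Even P.ncard := by
  rw [← ncard_image_sym2_mul_two m hm P hP]
  exact even_two.mul_left _

/-- A cut which does not cut through the inserted pieces has two different crossings if it has two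
crossings before the insertion, or if it separates some of the pieces from everything else: in the
first case the two crossings belong to different lines, in the second case their number is
positive and even. -/
theorem IsExtension.two_crossings [Finite A] [Finite J] (hl : IsExtension ι tA tJ lam)
    {side : A ⊕ J × Bool → Prop} (hside : ∀ j b, side (.inr (j, b)) → side (.inr (j, !b)))
    (H : (∃ a₁ a₂, a₁ ≠ a₂ ∧ (side (.inl a₁) ∧ ¬ side (.inl (ι a₁))) ∧
        side (.inl a₂) ∧ ¬ side (.inl (ι a₂))) ∨
      ((∀ a, ¬ side (.inl a)) ∧ ∃ y, side (.inr y))) (hι : ∀ a, ι (ι a) = a) :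
    ∃ z₁ z₂, z₁ ≠ z₂ ∧ (side z₁ ∧ ¬ side (lam z₁)) ∧ side z₂ ∧ ¬ side (lam z₂) := by
  rcases H with ⟨a₁, a₂, hne, ⟨h1, h1'⟩, h2, h2'⟩ | ⟨hA, ⟨y, hy⟩⟩
  · obtain ⟨z₁, hz, hz', hf⟩ := (hl.follow a₁).exists_crossing hside h1 h1'
    obtain ⟨z₂, gz, gz', gf⟩ := (hl.follow a₂).exists_crossing hside h2 h2'
    refine ⟨z₁, z₂, ?_, ⟨hz, hz'⟩, gz, gz'⟩
    rintro rfl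
    exact hne (by rw [← hι a₁, hf.unique gf, hι])
  · obtain ⟨a, ha⟩ := hl.reach (.inr y)
    obtain ⟨z₁, hz, hz', -⟩ := ha.exists_crossing hside hy (hA a)
    by_contra! hno
    have huniq : ∀ z, side z → z ≠ z₁ → side (lam z) := by
      exact fun z h1 h2 => hno z₁ z h2.symm ⟨hz, hz'⟩ h1
    have e1 : Even {x | side x}.ncard := by
      refine even_ncard_of_involution (Sum.map id (Prod.map id not)) ?_ _ ?_
      · rintro (a | ⟨j, b⟩) <;> simp
      · rintro (a | ⟨j, b⟩) hx
        · exact absurd hx (hA a)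
        · exact ⟨hside j b hx, by simp⟩
    have e2 : Even ({x | side x} \ {z₁}).ncard := by
      refine even_ncard_of_involution lam hl.invol _ ?_
      rintro x ⟨hx, hne⟩
      refine ⟨⟨huniq x hx hne, fun h => hz' ?_⟩, ?_⟩
      · rw [← h, hl.invol]
        exact hx
      · rcases x with a | y
        · exact absurd hx (hA a)
        · exact hl.fixJ y
    have e3 := Set.ncard_sdiff_singleton_add_one (s := {x | side x}) (a := z₁) hz
    rw [← e3] at e1
    exact (Nat.even_add_one.1 e1) e2

end Crossing

/-! ### Gluing -/

variable {T : Theory}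

/-- A 1PI graph `Γ` together with a finite family of 1PI graphs `A i` which are to be inserted
into it. The external half-lines of those `A i` whose residue is an edge type are numbered by
`Bool`. -/
structure Setup (T : Theory) where
  Γ : PreGraph T
  hΓ : Γ.IsOnePI
  I : Type
  [fin : Fintype I]
  A : I → PreGraph T
  hA : ∀ i, (A i).IsOnePI
  leg : ∀ i : {i // (A i).res.isRight}, Bool → (A i.1).H
  leg_injective : ∀ i, Function.Injective (leg i)
  exists_leg_iff : ∀ i h, (∃ b, leg i b = h) ↔ ¬ (A i.1).IsInt h

attribute [instance] Setup.fin

namespace Setup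

variable (S : Setup T)

/-- The pieces which are inserted at vertices. -/
abbrev IV : Type := {i // (S.A i).res.isLeft}

/-- The pieces which are inserted into lines. -/
abbrev IE : Type := {i // (S.A i).res.isRight}

/-- The type of the vertices at which a piece is inserted. -/
def vt (i : S.IV) : T.VType := (S.A i.1).res.getLeft i.2

/-- The type of the lines into which a piece is inserted. -/
def et (i : S.IE) : T.EType := (S.A i.1).res.getRight i.2

theorem res_IV (i : S.IV) : (S.A i.1).res = .inl (S.vt i) := (Sum.inl_getLeft _ _).symm

theorem res_IE (i : S.IE) : (S.A i.1).res = .inr (S.et i) := (Sum.inr_getRight _ _).symm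

theorem fey (i : S.I) : (S.A i).IsFeynman := (S.hA i).isFeynman

/-- The ends of the lines which are cut or created by the insertion. -/
abbrev K : Type := S.Γ.H ⊕ S.IE × Bool

theorem leg_not_isInt (i : S.IE) (b : Bool) : ¬ (S.A i.1).IsInt (S.leg i b) :=
  (S.exists_leg_iff i _).1 ⟨b, rfl⟩

theorem htype_leg (i : S.IE) (b : Bool) : (S.A i.1).htype (S.leg i b) = S.et i := by
  obtain ⟨a, ha⟩ := (S.fey i.1).exists_label (S.leg_not_isInt i b)
  have := (S.fey i.1).label_type _ _ ha
  rw [this.2]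
  have h := this.1
  rw [S.res_IE, Theory.N] at h
  by_contra hc
  rw [if_neg (Ne.symm hc)] at h
  omega

end Setup

/-- The choices made for an insertion: the vertices `p i` to be replaced, the identification `Q i`
of the external half-lines of `A i` with the half-lines at this vertex, and the lines `lam` after
the insertion of the other pieces. -/
structure Gluing (S : Setup T) where
  p : S.IV → S.Γ.V
  p_injective : Function.Injective p
  p_type : ∀ i, S.Γ.vtype (p i) = S.vt i
  Q : ∀ i : S.IV, {h // ¬ (S.A i.1).IsInt h} ≃ {h // S.Γ.att h = p i}
  Q_type : ∀ i h, S.Γ.htype (Q i h).1 = (S.A i.1).htype h.1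
  lam : S.K → S.K
  ext : IsExtension S.Γ.mate S.Γ.htype S.et lam

namespace Gluing

open PreGraph

variable {S : Setup T} (d : Gluing S)

/-- The vertices of the graph which results from the insertion. -/
abbrev GV : Type := {v : S.Γ.V // ∀ i, d.p i ≠ v} ⊕ Σ i, (S.A i).V

/-- The half-lines of the graph which results from the insertion. -/
abbrev GH : Type := {h : S.Γ.H // ∀ i, d.p i ≠ S.Γ.att h} ⊕ Σ i, (S.A i).H

open Classical in
/-- The ends of lines outside of the inserted pieces as half-lines of the resulting graph. -/
noncomputable def kap : S.K → d.GH
  | .inl h =>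
    if hp : ∃ i, d.p i = S.Γ.att h then
      .inr ⟨hp.choose.1, ((d.Q hp.choose).symm ⟨h, hp.choose_spec.symm⟩).1⟩
    else .inl ⟨h, fun i hi => hp ⟨i, hi⟩⟩
  | .inr (i, b) => .inr ⟨i.1, S.leg i b⟩

theorem kap_Q (i : S.IV) (x : {h // ¬ (S.A i.1).IsInt h}) :
    d.kap (.inl (d.Q i x).1) = .inr ⟨i.1, x.1⟩ := by
  have hp : ∃ j, d.p j = S.Γ.att (d.Q i x).1 := ⟨i, (d.Q i x).2.symm⟩
  rw [kap, dif_pos hp]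
  have : ∀ j (hj : d.p j = S.Γ.att (d.Q i x).1),
      (⟨j.1, ((d.Q j).symm ⟨(d.Q i x).1, hj.symm⟩).1⟩ : Σ i, (S.A i).H) = ⟨i.1, x.1⟩ := by
    intro j hj
    obtain rfl : j = i := d.p_injective (hj.trans (d.Q i x).2)
    simp
  rw [this _ hp.choose_spec]

theorem kap_out (h : S.Γ.H) (hh : ∀ i, d.p i ≠ S.Γ.att h) : d.kap (.inl h) = .inl ⟨h, hh⟩ := by
  rw [kap, dif_neg (by push Not; exact hh)]

theorem kap_inr (i : S.IE) (b : Bool) : d.kap (.inr (i, b)) = .inr ⟨i.1, S.leg i b⟩ := rfl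

theorem cases_H (h : S.Γ.H) :
    (∃ i x, h = (d.Q i x).1) ∨ ∀ i, d.p i ≠ S.Γ.att h := by
  by_cases hp : ∃ i, d.p i = S.Γ.att h
  · obtain ⟨i, hi⟩ := hp
    exact .inl ⟨i, (d.Q i).symm ⟨h, hi.symm⟩, by simp⟩
  · exact .inr fun i hi => hp ⟨i, hi⟩

/-- Every end of a line outside of the pieces is a half-line of `Γ` at a vertex which is kept, or
corresponds to an external half-line of a piece. -/
theorem cases_K (x : S.K) :
    (∃ h hh, x = .inl h ∧ d.kap x = .inl ⟨h, hh⟩) ∨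
    ∃ i h, ¬ (S.A i).IsInt h ∧ d.kap x = .inr ⟨i, h⟩ := by
  rcases x with h | ⟨i, b⟩
  · rcases d.cases_H h with ⟨i, x, rfl⟩ | hh
    · exact .inr ⟨_, _, x.2, d.kap_Q i x⟩
    · exact .inl ⟨h, hh, rfl, d.kap_out h hh⟩
  · exact .inr ⟨_, _, S.leg_not_isInt i b, rfl⟩

theorem kap_injective : Function.Injective d.kap := by
  intro x y h
  rcases x with x | ⟨i, b⟩ <;> rcases y with y | ⟨j, c⟩
  · rcases d.cases_H x with ⟨i, x, rfl⟩ | hx <;> rcases d.cases_H y with ⟨j, y, rfl⟩ | hy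
    · rw [kap_Q, kap_Q] at h
      obtain ⟨i, hi⟩ := i
      obtain ⟨j, hj⟩ := j
      obtain ⟨x, hx⟩ := x
      obtain ⟨y, hy⟩ := y
      cases h
      rfl
    · rw [kap_Q, kap_out _ _ hy] at h
      cases h
    · rw [kap_Q, kap_out _ _ hx] at h
      cases h
    · rw [kap_out _ _ hx, kap_out _ _ hy] at h
      cases h
      rfl
  · rcases d.cases_H x with ⟨i, x, rfl⟩ | hx
    · rw [kap_Q, kap_inr] at h
      have : i.1 = j.1 := congrArg Sigma.fst (Sum.inr_injective h)
      have h1 := S.res_IV i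
      rw [this, S.res_IE j] at h1
      cases h1
    · rw [kap_out _ _ hx] at h
      cases h
  · rcases d.cases_H y with ⟨j, y, rfl⟩ | hy
    · rw [kap_Q, kap_inr] at h
      have : i.1 = j.1 := congrArg Sigma.fst (Sum.inr_injective h)
      have h1 := S.res_IV j
      rw [← this, S.res_IE i] at h1
      cases h1
    · rw [kap_out _ _ hy] at h
      cases h
  · rw [kap_inr, kap_inr] at h
    obtain ⟨i, hi⟩ := i
    obtain ⟨j, hj⟩ := j
    obtain ⟨rfl, h⟩ := Sigma.mk.inj_iff.1 (Sum.inr_injective h)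
    obtain rfl := S.leg_injective _ (eq_of_heq h)
    rfl

theorem exists_kap_ext (i : S.I) (h : (S.A i).H) (hh : ¬ (S.A i).IsInt h) :
    ∃ x, d.kap x = .inr ⟨i, h⟩ := by
  rcases hr : (S.A i).res with v | e
  · have hi : (S.A i).res.isLeft := by simp [hr]
    exact ⟨_, d.kap_Q ⟨i, hi⟩ ⟨h, hh⟩⟩
  · have hi : (S.A i).res.isRight := by simp [hr]
    obtain ⟨b, rfl⟩ := (S.exists_leg_iff ⟨i, hi⟩ h).2 hh
    exact ⟨_, d.kap_inr ⟨i, hi⟩ b⟩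

theorem kap_ne_int (x : S.K) (i : S.I) (h : (S.A i).H) (hh : (S.A i).IsInt h) :
    d.kap x ≠ .inr ⟨i, h⟩ := by
  intro hx
  rcases d.cases_K x with ⟨h', hh', -, h1⟩ | ⟨j, h', hh', h1⟩
  · rw [h1] at hx
    cases hx
  · rw [h1] at hx
    cases hx
    exact hh' hh

/-- Every half-line is internal to one of the pieces or an end of a line outside of them. -/
theorem cases_GH (X : d.GH) :
    (∃ i h, (S.A i).IsInt h ∧ X = .inr ⟨i, h⟩) ∨ ∃ x, d.kap x = X := by
  rcases X with ⟨h, hh⟩ | ⟨i, h⟩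
  · exact .inr ⟨.inl h, d.kap_out h hh⟩
  · by_cases hi : (S.A i).IsInt h
    · exact .inl ⟨i, h, hi, rfl⟩
    · exact .inr (d.exists_kap_ext i h hi)

/-- The graph which results from the insertion. -/
noncomputable def glue : PreGraph T where
  V := d.GV
  H := d.GH
  res := S.Γ.res
  att := Sum.map (fun h => ⟨S.Γ.att h.1, h.2⟩) (Sigma.map id fun i => (S.A i).att)
  vtype := Sum.elim (fun v => S.Γ.vtype v.1) fun x => (S.A x.1).vtype x.2
  htype := Sum.elim (fun h => S.Γ.htype h.1) fun x => (S.A x.1).htype x.2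
  line X x := match x with
    | .inl Y => (∃ i h h', X = .inr ⟨i, h⟩ ∧ Y = .inr ⟨i, h'⟩ ∧ (S.A i).line h (.inl h')) ∨
        ∃ x y, d.kap x = X ∧ d.kap y = Y ∧ d.lam x = y ∧ x ≠ y
    | .inr a => ∃ h, d.kap (.inl h) = X ∧ S.Γ.line h (.inr a)

@[simp] theorem glue_att_inr (i : S.I) (h : (S.A i).H) :
    d.glue.att (.inr ⟨i, h⟩) = .inr ⟨i, (S.A i).att h⟩ := rfl

@[simp] theorem glue_att_inl (h) : d.glue.att (.inl h) = .inl ⟨S.Γ.att h.1, h.2⟩ := rfl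

theorem glue_line_inr (i : S.I) (h : (S.A i).H) (hh : (S.A i).IsInt h) (x) :
    d.glue.line (.inr ⟨i, h⟩) x ↔ ∃ h', x = .inl (.inr ⟨i, h'⟩) ∧ (S.A i).line h (.inl h') := by
  constructor
  · rcases x with Y | a
    · rintro (⟨j, h1, h2, h3, rfl, h4⟩ | ⟨x, y, h1, -⟩)
      · cases h3
        exact ⟨_, rfl, h4⟩
      · exact absurd h1 (d.kap_ne_int x i h hh)
    · rintro ⟨x, h1, -⟩
      exact absurd h1 (d.kap_ne_int _ i h hh)
  · rintro ⟨h', rfl, hl⟩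
    exact .inl ⟨i, h, h', rfl, rfl, hl⟩

theorem glue_line_kap_inl (x y : S.K) :
    d.glue.line (d.kap x) (.inl (d.kap y)) ↔ d.lam x = y ∧ x ≠ y := by
  constructor
  · rintro (⟨i, h, h', h1, h2, h3⟩ | ⟨x', y', h1, h2, h3⟩)
    · exact absurd h1 (d.kap_ne_int x i h ⟨_, h3⟩)
    · rwa [← d.kap_injective h1, ← d.kap_injective h2]
  · exact fun h => .inr ⟨x, y, rfl, rfl, h⟩

theorem glue_line_kap (x : S.K) (z) :
    d.glue.line (d.kap x) z ↔ (d.lam x ≠ x ∧ z = .inl (d.kap (d.lam x))) ∨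
      ∃ h a, x = .inl h ∧ z = .inr a ∧ S.Γ.line h (.inr a) := by
  rcases z with Y | a
  · rcases d.cases_GH Y with ⟨i, h, hh, rfl⟩ | ⟨y, rfl⟩
    · constructor
      · rintro (⟨i, h, h', h1, h2, h3⟩ | ⟨x', y', h1, h2, h3⟩)
        · exact absurd h1 (d.kap_ne_int x i h ⟨_, h3⟩)
        · exact absurd h2 (d.kap_ne_int _ i h hh)
      · rintro (⟨-, h1⟩ | ⟨_, _, _, h1, _⟩)
        · exact absurd (Sum.inl_injective h1).symm (d.kap_ne_int _ i h hh)
        · cases h1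
    · rw [glue_line_kap_inl]
      constructor
      · rintro ⟨rfl, h⟩
        exact .inl ⟨h.symm, rfl⟩
      · rintro (⟨h, h1⟩ | ⟨_, _, _, h1, _⟩)
        · rw [d.kap_injective (Sum.inl_injective h1)]
          exact ⟨rfl, h.symm⟩
        · cases h1
  · constructor
    · rintro ⟨h, h1, h2⟩
      exact .inr ⟨h, a, (d.kap_injective h1).symm, rfl, h2⟩
    · rintro (⟨-, h1⟩ | ⟨h, a', rfl, h1, h2⟩)
      · cases h1
      · cases h1
        exact ⟨h, rfl, h2⟩

theorem glue_line_kap_inl_iff (x : S.K) (Y : d.GH) :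
    d.glue.line (d.kap x) (.inl Y) ↔ d.lam x ≠ x ∧ Y = d.kap (d.lam x) := by
  refine (d.glue_line_kap x (.inl Y)).trans ⟨?_, fun h => .inl ⟨h.1, by rw [h.2]⟩⟩
  rintro (⟨h, h1⟩ | ⟨_, _, _, h1, _⟩)
  · exact ⟨h, Sum.inl_injective h1⟩
  · cases h1

theorem glue_htype_kap (x : S.K) : d.glue.htype (d.kap x) = endType S.Γ.htype S.et x := by
  rcases x with h | ⟨i, b⟩
  · rcases d.cases_H h with ⟨i, x, rfl⟩ | hh
    · rw [kap_Q]
      exact (d.Q_type i x).symm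
    · rw [kap_out _ _ hh]
      rfl
  · exact S.htype_leg i b

/-- The half-lines of `Γ` at a kept vertex, and those of a piece, keep their places. -/
theorem glue_valence (v e) :
    Nat.card {h : d.glue.H // d.glue.att h = v ∧ d.glue.htype h = e} =
      T.val (d.glue.vtype v) e := by
  rcases v with ⟨v, hv⟩ | ⟨i, v⟩
  · refine Eq.trans (Eq.symm ?_) (S.hΓ.isFeynman.valence v e)
    refine Nat.card_eq_of_bijective (fun h => ⟨.inl ⟨h.1, by rw [h.2.1]; exact hv⟩, ?_, h.2.2⟩)
      ⟨?_, ?_⟩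
    · simp only [glue_att_inl, h.2.1]
      rfl
    · rintro ⟨h, _⟩ ⟨h', _⟩ hh
      cases hh
      rfl
    · rintro ⟨⟨h, hh⟩ | ⟨j, h⟩, h1, h2⟩
      · cases h1
        exact ⟨⟨h, rfl, h2⟩, rfl⟩
      · cases h1
  · refine Eq.trans (Eq.symm ?_) ((S.fey i).valence v e)
    refine Nat.card_eq_of_bijective (fun h => ⟨.inr ⟨i, h.1⟩, ?_, h.2.2⟩) ⟨?_, ?_⟩
    · simp only [glue_att_inr, h.2.1]
      rfl
    · rintro ⟨h, _⟩ ⟨h', _⟩ hh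
      cases hh
      rfl
    · rintro ⟨⟨h, hh⟩ | ⟨j, h⟩, h1, h2⟩
      · cases h1
      · cases h1
        exact ⟨⟨h, rfl, h2⟩, rfl⟩

theorem lam_ne_inl {h : S.Γ.H} : d.lam (.inl h) ≠ .inl h ↔ S.Γ.IsInt h := by
  rw [Ne, d.ext.fix, S.hΓ.isFeynman.mate_eq_self, not_not]

theorem glue_isFeynman : d.glue.IsFeynman where
  valence := d.glue_valence
  line_unique X := by
    rcases d.cases_GH X with ⟨i, h, hh, rfl⟩ | ⟨x, rfl⟩
    · have hm := IsFeynman.line_mate hh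
      refine ⟨.inl (.inr ⟨i, (S.A i).mate h⟩), (d.glue_line_inr i h hh _).2 ⟨_, rfl, hm⟩, ?_⟩
      intro y hy
      obtain ⟨h', rfl, hl⟩ := (d.glue_line_inr i h hh y).1 hy
      rw [(S.fey i).mate_eq hl]
    · by_cases hx : d.lam x = x
      · have : ∃ h, x = .inl h ∧ ¬ S.Γ.IsInt h := by
          rcases x with h | y
          · refine ⟨h, rfl, fun hh => d.lam_ne_inl.2 hh hx⟩
          · exact absurd hx (d.ext.fixJ y)
        obtain ⟨h, rfl, hh⟩ := this
        obtain ⟨a, ha⟩ := S.hΓ.isFeynman.exists_label hh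
        refine ⟨.inr a, (d.glue_line_kap _ _).2 (.inr ⟨h, a, rfl, rfl, ha⟩), fun y hy => ?_⟩
        rcases (d.glue_line_kap _ _).1 hy with ⟨h1, -⟩ | ⟨h', a', h1, rfl, h2⟩
        · exact absurd hx h1
        · cases h1
          cases S.hΓ.isFeynman.line_right_unique h2 ha
          rfl
      · refine ⟨_, (d.glue_line_kap _ _).2 (.inl ⟨hx, rfl⟩), fun y hy => ?_⟩
        rcases (d.glue_line_kap _ _).1 hy with ⟨-, h1⟩ | ⟨h', a', rfl, rfl, h2⟩
        · exact h1
        · exact absurd (d.lam_ne_inl.1 hx) (S.hΓ.isFeynman.not_isInt h2)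
  line_symm X Y hl := by
    rcases hl with ⟨i, h, h', rfl, rfl, hl⟩ | ⟨x, y, rfl, rfl, rfl, hne⟩
    · exact .inl ⟨i, _, _, rfl, rfl, (S.fey i).line_symm _ _ hl⟩
    · exact .inr ⟨_, _, rfl, rfl, d.ext.invol x, hne.symm⟩
  line_ne X Y hl := by
    rcases hl with ⟨i, h, h', rfl, rfl, hl⟩ | ⟨x, y, rfl, rfl, rfl, hne⟩
    · intro hh
      cases hh
      exact (S.fey i).line_ne _ _ hl rfl
    · exact d.kap_injective.ne hne
  line_type X Y hl := by
    rcases hl with ⟨i, h, h', rfl, rfl, hl⟩ | ⟨x, y, rfl, rfl, rfl, hne⟩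
    · exact (S.fey i).line_type _ _ hl
    · rw [glue_htype_kap, glue_htype_kap, d.ext.type]
  label_type X a hl := by
    obtain ⟨h, rfl, hl⟩ := hl
    rw [glue_htype_kap]
    exact S.hΓ.isFeynman.label_type _ _ hl
  label_unique a ha := by
    obtain ⟨h, hh, hu⟩ := S.hΓ.isFeynman.label_unique a ha
    refine ⟨d.kap (.inl h), ⟨h, rfl, hh⟩, ?_⟩
    rintro _ ⟨h', rfl, hl⟩
    rw [hu h' hl]

/-- A vertex set of the resulting graph which does not cut through the pieces, as a vertex set
of `Γ`. -/
def projV (U : Set d.GV) : Set S.Γ.V :=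
  {v | (∃ hv, (.inl ⟨v, hv⟩ : d.GV) ∈ U) ∨ ∃ i, d.p i = v ∧ ∃ w, (.inr ⟨i.1, w⟩ : d.GV) ∈ U}

theorem att_kap_inl_mem {U : Set d.GV}
    (hU : ∀ i v w, (.inr ⟨i, v⟩ : d.GV) ∈ U → (.inr ⟨i, w⟩ : d.GV) ∈ U) (h : S.Γ.H) :
    d.glue.att (d.kap (.inl h)) ∈ U ↔ S.Γ.att h ∈ d.projV U := by
  rcases d.cases_H h with ⟨i, x, rfl⟩ | hh
  · rw [kap_Q, glue_att_inr]
    constructor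
    · exact fun hm => .inr ⟨i, (d.Q i x).2.symm, _, hm⟩
    · rintro (⟨hv, -⟩ | ⟨j, hj, w, hw⟩)
      · exact absurd (d.Q i x).2.symm (hv i)
      · obtain rfl : j = i := d.p_injective (hj.trans (d.Q i x).2)
        exact hU _ _ _ hw
  · rw [kap_out _ _ hh, glue_att_inl]
    constructor
    · exact fun hm => .inl ⟨hh, hm⟩
    · rintro (⟨hv, hm⟩ | ⟨j, hj, -⟩)
      · exact hm
      · exact absurd hj (hh j)

/-- The cut condition for a cut which does not cut through the pieces: it comes from a cut of `Γ`,
or it separates some of the pieces from all the vertices of `Γ`. -/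
theorem glue_cut_aux {U : Set d.GV}
    (hU : ∀ i v w, (.inr ⟨i, v⟩ : d.GV) ∈ U → (.inr ⟨i, w⟩ : d.GV) ∈ U)
    (H : ((d.projV U).Nonempty ∧ (d.projV U)ᶜ.Nonempty) ∨ (d.projV U = ∅ ∧ U.Nonempty))
    (p : Sym2 d.GH) :
    ∃ h h', d.glue.line h (.inl h') ∧ s(h, h') ≠ p ∧ d.glue.att h ∈ U ∧ d.glue.att h' ∉ U := by
  have hside : ∀ (i : S.IE) b, d.glue.att (d.kap (.inr (i, b))) ∈ U →
      d.glue.att (d.kap (.inr (i, !b))) ∈ U := fun i b h => hU _ _ _ h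
  obtain ⟨z₁, z₂, hne, ⟨h1, h1'⟩, h2, h2'⟩ := d.ext.two_crossings
    (side := fun x => d.glue.att (d.kap x) ∈ U) hside (by
      simp only [d.att_kap_inl_mem hU]
      rcases H with ⟨hn, hn'⟩ | ⟨hem, v | ⟨i, v⟩, hv⟩
      · obtain ⟨q, -⟩ := S.hΓ.exists_isInt
        obtain ⟨a₁, b₁, hl, -, ha, hb⟩ := S.hΓ.cutCond _ hn hn' s(q, q)
        obtain ⟨a₂, b₂, hl', hq, ha', hb'⟩ := S.hΓ.cutCond _ hn hn' s(a₁, b₁)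
        have e1 := S.hΓ.isFeynman.mate_eq hl
        have e2 := S.hΓ.isFeynman.mate_eq hl'
        subst e1 e2
        refine .inl ⟨a₁, a₂, ?_, ⟨ha, hb⟩, ha', hb'⟩
        rintro rfl
        exact hq rfl
      · have : v.1 ∈ d.projV U := .inl ⟨v.2, hv⟩
        rw [hem] at this
        exact this.elim
      · refine .inr ⟨by simp [hem], ?_⟩
        rcases hr : (S.A i).res with t | e
        · have hi : (S.A i).res.isLeft := by simp [hr]
          have : d.p ⟨i, hi⟩ ∈ d.projV U := .inr ⟨_, rfl, v, hv⟩
          rw [hem] at this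
          exact this.elim
        · have hi : (S.A i).res.isRight := by simp [hr]
          exact ⟨(⟨i, hi⟩, true), hU _ _ _ hv⟩) S.hΓ.isFeynman.mate_mate
  have key : ∀ z, d.glue.att (d.kap z) ∈ U → d.glue.att (d.kap (d.lam z)) ∉ U →
      d.glue.line (d.kap z) (.inl (d.kap (d.lam z))) := by
    intro z hz hz'
    rw [glue_line_kap_inl]
    refine ⟨rfl, fun h => ?_⟩
    rw [← h] at hz'
    exact hz' hz
  by_cases hp : s(d.kap z₁, d.kap (d.lam z₁)) = p
  · refine ⟨_, _, key z₂ h2 h2', ?_, h2, h2'⟩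
    rintro rfl
    rcases Sym2.eq_iff.1 hp with ⟨h, -⟩ | ⟨h, -⟩
    · exact hne (d.kap_injective h)
    · rw [← h] at h2'
      exact h2' h1
  · exact ⟨_, _, key z₁ h1 h1', hp, h1, h1'⟩

/-- A cut of the resulting graph cuts through one of the pieces, where two lines are found by the
cut condition for this piece, or it does not cut through any piece. -/
theorem glue_cutCond : d.glue.CutCond := by
  intro U hU hU' p
  by_cases hcut : ∃ i v w, (.inr ⟨i, v⟩ : d.GV) ∈ U ∧ (.inr ⟨i, w⟩ : d.GV) ∉ U
  · obtain ⟨i, v, w, hv, hw⟩ := hcut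
    let j : (S.A i).H → d.GH := fun h => .inr ⟨i, h⟩
    obtain ⟨q, -⟩ := (S.hA i).exists_isInt
    have hq : ∃ q : Sym2 (S.A i).H, ∀ h h', s(h, h') ≠ q → s(j h, j h') ≠ p := by
      by_cases hp : ∃ q, Sym2.map j q = p
      · obtain ⟨q, rfl⟩ := hp
        refine ⟨q, fun h h' hn hh => hn ?_⟩
        have hj : Function.Injective j := fun a b hab => by cases hab; rfl
        exact Sym2.map.injective hj hh
      · exact ⟨s(q, q), fun h h' _ hh => hp ⟨s(h, h'), hh⟩⟩
    obtain ⟨q, hq⟩ := hq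
    obtain ⟨h, h', hl, hn, ha, ha'⟩ := (S.hA i).cutCond {v | (.inr ⟨i, v⟩ : d.GV) ∈ U}
      ⟨v, hv⟩ ⟨w, hw⟩ q
    exact ⟨j h, j h', .inl ⟨i, h, h', rfl, rfl, hl⟩, hq _ _ hn, ha, ha'⟩
  · push Not at hcut
    by_cases hn : (d.projV U).Nonempty
    · by_cases hn' : (d.projV U)ᶜ.Nonempty
      · exact d.glue_cut_aux hcut (.inl ⟨hn, hn'⟩) p
      · have hc : ∀ i v w, (.inr ⟨i, v⟩ : d.GV) ∈ Uᶜ → (.inr ⟨i, w⟩ : d.GV) ∈ Uᶜ :=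
          fun i v w h1 h2 => h1 (hcut i w v h2)
        have hem : d.projV Uᶜ = ∅ := by
          ext v
          simp only [Set.mem_empty_iff_false, iff_false]
          intro hv
          refine hn' ⟨v, fun hv' => ?_⟩
          rcases hv with ⟨h1, h2⟩ | ⟨i, rfl, w, h2⟩
          · rcases hv' with ⟨h3, h4⟩ | ⟨i, rfl, w, h4⟩
            · exact h2 h4
            · exact h1 i rfl
          · rcases hv' with ⟨h3, h4⟩ | ⟨j, hj, w', h4⟩
            · exact h3 i rfl
            · obtain rfl := d.p_injective hj
              exact h2 (hcut _ _ _ h4)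
        obtain ⟨h, h', hl, hp, ha, ha'⟩ := d.glue_cut_aux hc (.inr ⟨hem, hU'⟩) p
        exact ⟨h', h, d.glue_isFeynman.line_symm _ _ hl, by rwa [Sym2.eq_swap],
          not_not.1 ha', ha⟩
    · exact d.glue_cut_aux hcut (.inr ⟨Set.not_nonempty_iff_eq_empty.1 hn, hU⟩) p

theorem glue_isInt_inr (i : S.I) (h : (S.A i).H) (hh : (S.A i).IsInt h) :
    d.glue.IsInt (.inr ⟨i, h⟩) := by
  obtain ⟨h', hl⟩ := hh
  exact ⟨_, .inl ⟨i, h, h', rfl, rfl, hl⟩⟩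

theorem glue_isInt_kap (x : S.K) : d.glue.IsInt (d.kap x) ↔ d.lam x ≠ x := by
  constructor
  · rintro ⟨Y, hY⟩
    rcases (d.glue_line_kap _ _).1 hY with ⟨h, -⟩ | ⟨_, _, _, h, _⟩
    · exact h
    · cases h
  · exact fun h => ⟨_, (d.glue_line_kap _ _).2 (.inl ⟨h, rfl⟩)⟩

theorem card_lam_ne : Nat.card {x // d.lam x ≠ x} =
    Nat.card {h // S.Γ.IsInt h} + Nat.card S.IE * 2 := by
  have e : {h // S.Γ.IsInt h} ⊕ S.IE × Bool ≃ {x // d.lam x ≠ x} :=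
    Equiv.ofBijective
      (fun y => match y with
        | .inl h => ⟨.inl h.1, d.lam_ne_inl.2 h.2⟩
        | .inr y => ⟨.inr y, d.ext.fixJ y⟩)
      ⟨by rintro (⟨h, _⟩ | y) (⟨h', _⟩ | y') hh <;> cases hh <;> rfl, by
        rintro ⟨h | y, hh⟩
        · exact ⟨.inl ⟨h, d.lam_ne_inl.1 hh⟩, rfl⟩
        · exact ⟨.inr y, rfl⟩⟩
  rw [← Nat.card_congr e, Nat.card_sum, Nat.card_prod, Nat.card_eq_fintype_card (α := Bool),
    Fintype.card_bool]

theorem card_glue_isInt : Nat.card {h // d.glue.IsInt h} =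
    Nat.card {h // S.Γ.IsInt h} + Nat.card S.IE * 2 + ∑ i, Nat.card {h // (S.A i).IsInt h} := by
  have e : {x // d.lam x ≠ x} ⊕ (Σ i, {h // (S.A i).IsInt h}) ≃ {h // d.glue.IsInt h} :=
    Equiv.ofBijective
      (fun y => match y with
        | .inl x => ⟨d.kap x.1, (d.glue_isInt_kap _).2 x.2⟩
        | .inr y => ⟨.inr ⟨y.1, y.2.1⟩, d.glue_isInt_inr _ _ y.2.2⟩)
      ⟨by
        rintro (⟨x, hx⟩ | ⟨i, h, hh⟩) (⟨x', hx'⟩ | ⟨i', h', hh'⟩) he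
        · obtain rfl := d.kap_injective (congrArg Subtype.val he)
          rfl
        · exact absurd (congrArg Subtype.val he) (d.kap_ne_int _ _ _ hh')
        · exact absurd (congrArg Subtype.val he).symm (d.kap_ne_int _ _ _ hh)
        · cases congrArg Subtype.val he
          rfl, by
        rintro ⟨X, hX⟩
        rcases d.cases_GH X with ⟨i, h, hh, rfl⟩ | ⟨x, rfl⟩
        · exact ⟨.inr ⟨i, h, hh⟩, rfl⟩
        · exact ⟨.inl ⟨x, (d.glue_isInt_kap _).1 hX⟩, rfl⟩⟩
  rw [← Nat.card_congr e, Nat.card_sum, card_lam_ne, Nat.card_sigma]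

theorem card_glue_V : Nat.card d.glue.V + Nat.card S.IV =
    Nat.card S.Γ.V + ∑ i, Nat.card (S.A i).V := by
  have h1 : Nat.card d.glue.V = Nat.card {v : S.Γ.V // ∀ i, d.p i ≠ v} +
      ∑ i, Nat.card (S.A i).V := by
    rw [← Nat.card_sigma, ← Nat.card_sum]
    rfl
  have e : {v : S.Γ.V // ∀ i, d.p i ≠ v} ⊕ S.IV ≃ S.Γ.V :=
    Equiv.ofBijective (Sum.elim Subtype.val d.p)
      ⟨by
        rintro (⟨v, hv⟩ | i) (⟨v', hv'⟩ | i') he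
        · cases he
          rfl
        · exact absurd he.symm (hv i')
        · exact absurd he (hv' i)
        · rw [d.p_injective he], by
        intro v
        by_cases hv : ∃ i, d.p i = v
        · obtain ⟨i, rfl⟩ := hv
          exact ⟨.inr i, rfl⟩
        · exact ⟨.inl ⟨v, fun i hi => hv ⟨i, hi⟩⟩, rfl⟩⟩
  rw [h1, ← Nat.card_congr e, Nat.card_sum]
  omega

theorem _root_.Feynman.Setup.card_IV_add_card_IE (S : Setup T) :
    Nat.card S.IV + Nat.card S.IE = Nat.card S.I := by
  classical
  rw [← Nat.card_sum]
  refine Nat.card_congr (Equiv.trans (Equiv.sumCongr (Equiv.refl _)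
    (Equiv.subtypeEquivRight fun i => ?_)) (Equiv.sumCompl fun i => (S.A i).res.isLeft = true))
  cases (S.A i).res <;> simp

/-- The loop numbers add up. -/
theorem glue_loops : d.glue.loops = S.Γ.loops + ∑ i, (S.A i).loops := by
  have h1 := d.card_glue_isInt
  have h2 := d.card_glue_V
  have h3 := S.card_IV_add_card_IE
  have h4 := S.hΓ.loops_eq
  have h5 : ∑ i, (S.A i).loops + ∑ i, Nat.card (S.A i).V =
      ∑ i, (S.A i).lines.ncard + Nat.card S.I := by
    rw [← Finset.sum_add_distrib, Finset.sum_congr rfl fun i _ => (S.hA i).loops_eq,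
      Finset.sum_add_distrib]
    simp
  simp only [← d.glue_isFeynman.lines_ncard, ← S.hΓ.isFeynman.lines_ncard,
    ← (S.fey _).lines_ncard, ← Finset.sum_mul] at h1
  have h6 : S.Γ.loops ≠ 0 := S.hΓ.not_tree
  rw [loops]
  omega

/-- Inserting 1PI graphs into a 1PI graph gives a 1PI graph. -/
theorem glue_isOnePI : d.glue.IsOnePI := by
  rw [isOnePI_iff]
  refine ⟨d.glue_isFeynman, ?_, d.glue_cutCond, ?_⟩
  · -- `Γ` has a vertex; if it is replaced, then by a piece, which is nonempty
    obtain ⟨v⟩ := S.hΓ.nonempty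
    by_cases hv : ∃ i, d.p i = v
    · obtain ⟨i, -⟩ := hv
      obtain ⟨w⟩ := (S.hA i.1).nonempty
      exact ⟨.inr ⟨i.1, w⟩⟩
    · exact ⟨.inl ⟨v, fun i hi => hv ⟨i, hi⟩⟩⟩
  · rw [glue_loops]
    have := S.hΓ.not_tree
    omega

end Gluing

end Feynman

namespace Feynman

/-! ### Counting the insertions -/

section TypedEquiv

variable {X Y X' Y' E : Type*}

/-- The type-preserving bijections. -/
abbrev TypedEquiv (tX : X → E) (tY : Y → E) : Type _ := {f : X ≃ Y // ∀ x, tY (f x) = tX x}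

variable {tX : X → E} {tY : Y → E} {tX' : X' → E} {tY' : Y' → E}

/-- The number of type-preserving bijections depends only on the typed sets up to isomorphism. -/
theorem TypedEquiv.card_congr (f : TypedEquiv tX tX') (g : TypedEquiv tY tY') :
    Nat.card (TypedEquiv tX tY) = Nat.card (TypedEquiv tX' tY') := by
  refine Nat.card_congr ((Equiv.equivCongr f.1 g.1).subtypeEquiv fun h => ?_)
  constructor
  · intro hh x
    obtain ⟨x, rfl⟩ := f.1.surjective x
    simp [g.2, f.2, hh]
  · intro hh x
    have := hh (f.1 x)
    simpa [g.2, f.2] using this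

theorem nonempty_typedEquiv [Finite X] [Finite Y]
    (h : ∀ e, Nat.card {x // tX x = e} = Nat.card {y // tY y = e}) :
    Nonempty (TypedEquiv tX tY) := by
  have f := fun e => (Finite.card_eq.1 (h e)).some
  refine ⟨(Equiv.sigmaFiberEquiv tX).symm.trans ((Equiv.sigmaCongrRight f).trans
    (Equiv.sigmaFiberEquiv tY)), fun x => ?_⟩
  exact (f (tX x) ⟨x, rfl⟩).2

/-- The type-preserving injections are chosen type by type. -/
theorem card_typed_injective [Finite X] [Finite Y] [Fintype E] :
    Nat.card {f : X → Y // Function.Injective f ∧ ∀ x, tY (f x) = tX x} =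
      ∏ e, (Nat.card {y // tY y = e}).descFactorial (Nat.card {x // tX x = e}) := by
  classical
  have := Fintype.ofFinite X
  have := Fintype.ofFinite Y
  have e1 : {f : X → Y // Function.Injective f ∧ ∀ x, tY (f x) = tX x} ≃
      ∀ e, {x // tX x = e} ↪ {y // tY y = e} :=
    { toFun := fun f e => ⟨fun x => ⟨f.1 x.1, (f.2.2 _).trans x.2⟩, fun x x' h =>
        Subtype.ext (f.2.1 (congrArg Subtype.val h))⟩
      invFun := fun g => ⟨fun x => (g (tX x) ⟨x, rfl⟩).1, by
        intro x x' h
        have key : ∀ e (hx : tX x = e) e' (hx' : tX x' = e'),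
            (g e ⟨x, hx⟩).1 = (g e' ⟨x', hx'⟩).1 → x = x' := by
          intro e hx e' hx' h
          obtain rfl : e = e' := by
            rw [← (g e ⟨x, hx⟩).2, h, (g e' ⟨x', hx'⟩).2]
          exact congrArg Subtype.val ((g e).injective (Subtype.ext h))
        exact key _ rfl _ rfl h, fun x => (g (tX x) ⟨x, rfl⟩).2⟩
      left_inv := fun f => rfl
      right_inv := fun g => by
        funext e
        ext ⟨x, rfl⟩
        rfl }
  rw [Nat.card_congr e1, Nat.card_pi]
  refine Finset.prod_congr rfl fun e _ => ?_
  rw [Nat.card_eq_fintype_card, Fintype.card_embedding_eq, Nat.card_eq_fintype_card,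
    Nat.card_eq_fintype_card]

end TypedEquiv

variable {T : Theory}

namespace Theory

/-- The type of a label. -/
def labelType (r : T.Residue) (a : T.LabelsOf r) : T.EType := a.1.1

/-- The labels of a given type are numbered by `0, …, N r e - 1`. -/
def labelFiber (r : T.Residue) (e : T.EType) : {a // T.labelType r a = e} ≃ Fin (T.N r e) where
  toFun a := ⟨a.1.1.2, by
    have := a.1.2
    rwa [show a.1.1.1 = e from a.2] at this⟩
  invFun n := ⟨⟨(e, n), n.2⟩, rfl⟩
  left_inv := by
    rintro ⟨⟨⟨e, n⟩, h⟩, rfl⟩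
    rfl
  right_inv n := rfl

theorem card_labelType (r : T.Residue) (e : T.EType) :
    Nat.card {a // T.labelType r a = e} = T.N r e := by
  rw [Nat.card_congr (labelFiber r e), Nat.card_fin]

instance (r : T.Residue) : Finite (T.LabelsOf r) := by
  have : ∀ e, Finite {a // T.labelType r a = e} := fun e => Finite.of_equiv _ (labelFiber r e).symm
  exact Finite.of_equiv _ (Equiv.sigmaFiberEquiv (T.labelType r))

/-- The number of type-preserving permutations of the external lines belonging to `r`. -/
noncomputable def permCount (T : Theory) (r : T.Residue) : ℕ :=
  Nat.card (TypedEquiv (T.labelType r) (T.labelType r))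

theorem permCount_pos (r : T.Residue) : 0 < T.permCount r := by
  have : Nonempty (TypedEquiv (T.labelType r) (T.labelType r)) := ⟨⟨Equiv.refl _, fun _ => rfl⟩⟩
  exact Nat.card_pos

open Classical in
theorem type_of_label_inr {e : T.EType} (a : T.LabelsOf (.inr e)) : T.labelType _ a = e := by
  have h : a.1.2 < (if e = a.1.1 then 2 else 0) := a.2
  by_contra hc
  rw [if_neg fun h => hc h.symm] at h
  omega

/-- The two external lines at an edge-type residue have the same type, so they may be exchanged. -/
theorem permCount_inr (e : T.EType) : T.permCount (.inr e) = 2 := by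
  have e1 : T.LabelsOf (.inr e) ≃ Fin 2 :=
    (Equiv.subtypeUnivEquiv fun a => type_of_label_inr a).symm.trans
      ((labelFiber _ e).trans (finCongr (by simp [N])))
  have e2 : TypedEquiv (T.labelType (.inr e)) (T.labelType (.inr e)) ≃
      Equiv.Perm (T.LabelsOf (.inr e)) :=
    Equiv.subtypeUnivEquiv fun f a => by rw [type_of_label_inr, type_of_label_inr]
  rw [permCount, Nat.card_congr e2, Nat.card_perm, Nat.card_congr e1, Nat.card_fin]
  rfl

end Theory

namespace PreGraph

variable {G : PreGraph T}

/-- The labelling of the external half-lines of a Feynman graph. -/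
theorem IsFeynman.nonempty_labelling (hG : G.IsFeynman) :
    ∃ f : TypedEquiv (fun h : {h // ¬ G.IsInt h} => G.htype h.1) (T.labelType G.res),
      ∀ h a, G.line h.1 (.inr a) ↔ (f.1 h).1 = a := by
  have hex : ∀ h : {h // ¬ G.IsInt h}, ∃ a : T.LabelsOf G.res, G.line h.1 (.inr a.1) := by
    rintro ⟨h, hh⟩
    obtain ⟨a, ha⟩ := hG.exists_label hh
    exact ⟨⟨a, (hG.label_type _ _ ha).1⟩, ha⟩
  choose f hf using hex
  have hb : Function.Bijective f := by
    constructor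
    · intro h h' he
      have h1 := hf h
      rw [he] at h1
      exact Subtype.ext ((hG.label_unique _ (f h').2).unique h1 (hf h'))
    · intro a
      obtain ⟨h, hh, -⟩ := hG.label_unique _ a.2
      refine ⟨⟨h, hG.not_isInt hh⟩, ?_⟩
      have := hG.line_right_unique (hf ⟨h, hG.not_isInt hh⟩) hh
      exact Subtype.ext (Sum.inr_injective this)
  refine ⟨⟨Equiv.ofBijective f hb, fun h => (hG.label_type _ _ (hf h)).2.symm⟩, fun h a => ?_⟩
  constructor
  · intro ha
    exact Sum.inr_injective (hG.line_right_unique (hf h) ha)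
  · rintro rfl
    exact hf h

theorem card_labelling {S : Set G.H} {r : T.Residue} (l : G.Labelling S r) :
    Nat.card (G.Labelling S r) = T.permCount r :=
  TypedEquiv.card_congr (tX := fun h : {h // h ∈ G.legs S} => G.htype h.1)
    (tY := T.labelType r) ⟨l.1, l.2⟩ ⟨Equiv.refl _, fun _ => rfl⟩

instance {S : Set G.H} {r : T.Residue} : Finite (G.Labelling S r) :=
  inferInstanceAs (Finite {l : {h // h ∈ G.legs S} ≃ T.LabelsOf r //
    ∀ h, (l h).1.1 = G.htype h.1})

end PreGraph

open PreGraph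

namespace Setup

variable (S : Setup T)

/-- There are as many identifications of the external half-lines of a piece with the half-lines at a
vertex as there are type-preserving permutations of the external lines. -/
theorem card_identification (i : S.IV) (v : S.Γ.V) (hv : S.Γ.vtype v = S.vt i) :
    Nat.card (TypedEquiv (fun h : {h // ¬ (S.A i.1).IsInt h} => (S.A i.1).htype h.1)
      (fun h : {h // S.Γ.att h = v} => S.Γ.htype h.1)) = T.permCount (S.A i.1).res := by
  obtain ⟨f, -⟩ := (S.fey i.1).nonempty_labelling
  obtain ⟨g⟩ : Nonempty (TypedEquiv (fun h : {h // S.Γ.att h = v} => S.Γ.htype h.1)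
      (T.labelType (S.A i.1).res)) := by
    refine nonempty_typedEquiv fun e => ?_
    rw [Theory.card_labelType, S.res_IV, Theory.N, ← hv, ← S.hΓ.isFeynman.valence]
    exact Nat.card_congr (Equiv.subtypeSubtypeEquivSubtypeInter (fun h => S.Γ.att h = v)
      fun h => S.Γ.htype h = e)
  exact TypedEquiv.card_congr f g

/-- The number of pieces with residue `r`. -/
noncomputable def num (r : T.Residue) : ℕ := Nat.card {i // (S.A i).res = r}

theorem card_vt (v : T.VType) : Nat.card {i // S.vt i = v} = S.num (.inl v) := by
  refine Nat.card_congr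
    { toFun := fun i => ⟨i.1.1, by rw [S.res_IV, i.2]⟩
      invFun := fun i => ⟨⟨i.1, by simp [i.2]⟩, ?_⟩
      left_inv := fun i => rfl
      right_inv := fun i => rfl }
  exact (Sum.inl_injective (i.2.symm.trans (S.res_IV ⟨i.1, by simp [i.2]⟩))).symm

theorem card_et (e : T.EType) : Nat.card {i // S.et i = e} = S.num (.inr e) := by
  refine Nat.card_congr
    { toFun := fun i => ⟨i.1.1, by rw [S.res_IE, i.2]⟩
      invFun := fun i => ⟨⟨i.1, by simp [i.2]⟩, ?_⟩
      left_inv := fun i => rfl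
      right_inv := fun i => rfl }
  exact (Sum.inr_injective (i.2.symm.trans (S.res_IE ⟨i.1, by simp [i.2]⟩))).symm

theorem prod_permCount : ∏ i, T.permCount (S.A i).res =
    (∏ i : S.IV, T.permCount (S.A i.1).res) * ∏ e, 2 ^ S.num (.inr e) := by
  classical
  have h1 : ∏ e, 2 ^ S.num (.inr e) = 2 ^ Nat.card S.IE := by
    rw [Finset.prod_pow_eq_pow_sum]
    simp only [← S.card_et]
    rw [← Nat.card_sigma, Nat.card_congr (Equiv.sigmaFiberEquiv S.et)]
  have h2 : ∏ i : {i // ¬ (S.A i).res.isLeft = true}, T.permCount (S.A i.1).res =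
      2 ^ Nat.card S.IE := by
    rw [Finset.prod_congr rfl (g := fun _ => 2), Finset.prod_const, Finset.card_univ,
      ← Nat.card_eq_fintype_card]
    · congr 1
      refine Nat.card_congr (Equiv.subtypeEquivRight fun i => ?_)
      cases (S.A i).res <;> simp
    · rintro ⟨i, hi⟩ -
      have : (S.A i).res.isRight := by
        revert hi
        cases (S.A i).res <;> simp
      have := S.res_IE ⟨i, this⟩
      simp only at this
      rw [this, Theory.permCount_inr]
  rw [h1, ← h2]
  exact (Fintype.prod_subtype_mul_prod_subtype (fun i => (S.A i).res.isLeft = true) _).symm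

/-- The gluing data consist of independent choices at the vertices and on the lines. -/
def gluingEquiv : Gluing S ≃
    (Σ p : {p : S.IV → S.Γ.V // Function.Injective p ∧ ∀ i, S.Γ.vtype (p i) = S.vt i},
      ∀ i : S.IV, TypedEquiv (fun h : {h // ¬ (S.A i.1).IsInt h} => (S.A i.1).htype h.1)
        (fun h : {h // S.Γ.att h = p.1 i} => S.Γ.htype h.1)) ×
    {lam // IsExtension S.Γ.mate S.Γ.htype S.et lam} where
  toFun d := (⟨⟨d.p, d.p_injective, d.p_type⟩, fun i => ⟨d.Q i, d.Q_type i⟩⟩, ⟨d.lam, d.ext⟩)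
  invFun x := ⟨x.1.1.1, x.1.1.2.1, x.1.1.2.2, fun i => (x.1.2 i).1, fun i => (x.1.2 i).2,
    x.2.1, x.2.2⟩
  left_inv _ := rfl
  right_inv _ := rfl

instance : Finite (Gluing S) := Finite.of_equiv _ S.gluingEquiv.symm

/-- The number of gluings is the number of insertion places, times the number of ways to label the
external lines of the pieces. -/
theorem card_gluing : Nat.card (Gluing S) =
    ((∏ v, (S.num (.inl v)).factorial *
      (Nat.card {x // S.Γ.vtype x = v}).choose (S.num (.inl v))) *
    ∏ e, (S.num (.inr e)).factorial *
      ((S.Γ.linesOfType e).ncard + S.num (.inr e) - 1).choose (S.num (.inr e))) *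
    ∏ i, T.permCount (S.A i).res := by
  classical
  have := Fintype.ofFinite {p : S.IV → S.Γ.V //
    Function.Injective p ∧ ∀ i, S.Γ.vtype (p i) = S.vt i}
  have hfey := S.hΓ.isFeynman
  rw [Nat.card_congr S.gluingEquiv, Nat.card_prod, Nat.card_sigma]
  rw [card_extension S.Γ.mate hfey.mate_mate S.Γ.htype hfey.htype_mate
    (fun e => (S.Γ.linesOfType e).ncard)]
  swap
  · intro e
    rw [hfey.linesOfType_ncard]
    refine Nat.card_congr (Equiv.subtypeEquivRight fun h => ?_)
    rw [Ne, hfey.mate_eq_self, not_not]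
  rw [Finset.sum_congr rfl (g := fun _ => ∏ i : S.IV, T.permCount (S.A i.1).res)]
  swap
  · intro p _
    rw [Nat.card_pi]
    exact Finset.prod_congr rfl fun i _ => S.card_identification i _ (p.2.2 i)
  rw [Finset.sum_const, Finset.card_univ, ← Nat.card_eq_fintype_card, card_typed_injective]
  simp only [S.card_vt, S.card_et, Nat.descFactorial_eq_factorial_mul_choose,
    Nat.ascFactorial_eq_factorial_mul_choose', Finset.prod_mul_distrib, S.prod_permCount,
    smul_eq_mul]
  ring

end Setup

end Feynman

namespace Feynman

/-! ### Decompositions of a graph -/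

section Loops

variable {A J : Type*} {lam : A ⊕ J × Bool → A ⊕ J × Bool}

/-- The ends of pieces which lie on closed lines are closed under passing through a piece and under
following a line. -/
theorem not_reach_closed [Finite J] (hinv : ∀ x, lam (lam x) = x) :
    (∀ j b, (¬ ∃ a, Follow lam (.inr (j, b)) a) → ¬ ∃ a, Follow lam (.inr (j, !b)) a) ∧
    ∀ y, (¬ ∃ a, Follow lam (.inr y) a) →
      ∃ z, lam (.inr y) = .inr z ∧ ¬ ∃ a, Follow lam (.inr z) a := by
  let N : Set (J × Bool) := {y | ¬ ∃ a, Follow lam (.inr y) a}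
  let other : J × Bool → J × Bool := fun y => (y.1, !y.2)
  have hoo : ∀ y, other (other y) = y := fun y => by simp [other]
  have hstep : ∀ y ∈ N, ∃ z, lam (.inr y) = .inr z ∧ other z ∈ N := by
    intro y hy
    rcases h : lam (.inr y) with a | ⟨j, b⟩
    · exact absurd ⟨a, .direct h⟩ hy
    · exact ⟨(j, b), rfl, fun ⟨a, ha⟩ => hy ⟨a, .through h ha⟩⟩
  choose τ hτ hτN using hstep
  -- following a line and passing through the next piece permutes the finite set `N`
  let t : N → N := fun y => ⟨other (τ y.1 y.2), hτN y.1 y.2⟩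
  have ht : Function.Injective t := by
    intro y y' h
    have h1 : τ y.1 y.2 = τ y'.1 y'.2 := by
      have := congrArg other (congrArg Subtype.val h)
      simpa only [t, hoo] using this
    have h2 : lam (.inr y.1) = lam (.inr y'.1) := by rw [hτ y.1 y.2, hτ y'.1 y'.2, h1]
    have h3 := congrArg lam h2
    rw [hinv, hinv] at h3
    exact Subtype.ext (Sum.inr_injective h3)
  have hback : ∀ y ∈ N, ∃ z ∈ N, lam (.inr (other y)) = .inr z := by
    intro y hy
    obtain ⟨z, hz⟩ := (Finite.injective_iff_surjective.1 ht) ⟨y, hy⟩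
    refine ⟨z.1, z.2, ?_⟩
    have h1 : other (τ z.1 z.2) = y := congrArg Subtype.val hz
    rw [← h1, hoo, ← hτ, hinv]
  have hother : ∀ y ∈ N, other y ∈ N := by
    have H : ∀ w a, Follow lam w a → ∀ y ∈ N, w ≠ .inr (other y) := by
      intro w a hf
      induction hf with
      | direct h =>
        rintro y hy rfl
        obtain ⟨z, -, hz'⟩ := hback y hy
        rw [h] at hz'
        cases hz'
      | through h _ ih =>
        rintro y hy rfl
        obtain ⟨z, hz, hz'⟩ := hback y hy
        rw [h] at hz'
        cases hz'
        exact ih _ hz rfl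
    exact fun y hy ⟨a, ha⟩ => H _ a ha y hy rfl
  refine ⟨fun j b h => hother (j, b) h, fun y hy => ⟨τ y hy, hτ y hy, ?_⟩⟩
  have := hother _ (hτN y hy)
  rwa [hoo] at this

end Loops

variable {T : Theory}

open PreGraph

/-- Maps which describe how a graph `G` is composed of the pieces `A i` and of the rest of `Γ`.
A vertex `v` of `Γ` is sent to the component which replaces it, or else to itself. -/
@[ext]
structure Frame (S : Setup T) (G : PreGraph T) where
  φV : ∀ i, (S.A i).V → G.V
  φH : ∀ i, (S.A i).H → G.H
  ψV : S.Γ.V → G.V ⊕ S.I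
  ψH : S.Γ.H → G.H

namespace Frame

variable {S : Setup T} {G : PreGraph T}

/-- The images of the pieces in `G`. -/
def piece (F : Frame S G) (i : S.I) : G.Piece := (F.φH i '' {h | (S.A i).IsInt h}, (S.A i).res)

open Classical in
/-- The subgraph formed by the images of the pieces. -/
noncomputable def subs (F : Frame S G) : Finset G.Piece := Finset.univ.image F.piece

/-- The ends of the lines outside of the pieces. -/
def out (F : Frame S G) : S.K → G.H
  | .inl h => F.ψH h
  | .inr (i, b) => F.φH i (S.leg i b)

/-- The pieces are embedded as disjoint subgraphs, and the rest of `G` matches `Γ`. -/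
structure IsFrame (F : Frame S G) : Prop where
  φV_inj : ∀ i, Function.Injective (F.φV i)
  φH_inj : ∀ i, Function.Injective (F.φH i)
  disj : ∀ i j v w, F.φV i v = F.φV j w → i = j
  att : ∀ i h, G.att (F.φH i h) = F.φV i ((S.A i).att h)
  star : ∀ i g v, G.att g = F.φV i v → ∃ h, F.φH i h = g
  vtype : ∀ i v, G.vtype (F.φV i v) = (S.A i).vtype v
  htype : ∀ i h, G.htype (F.φH i h) = (S.A i).htype h
  line : ∀ i h h', (S.A i).line h (.inl h') → G.line (F.φH i h) (.inl (F.φH i h'))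
  ψV_inj : Function.Injective F.ψV
  ψV_inl : ∀ w, (∃ v, F.ψV v = .inl w) ↔ ∀ i v, F.φV i v ≠ w
  ψV_inr : ∀ i, (∃ v, F.ψV v = .inr i) ↔ (S.A i).res.isLeft
  ψH_inj : Function.Injective F.ψH
  ψH_range : ∀ g, (∃ h, F.ψH h = g) ↔ (∀ i h, (S.A i).IsInt h → F.φH i h ≠ g) ∧
    ∀ i, (S.A i).res.isRight → ∀ v, F.φV i v ≠ G.att g
  attψ_inl : ∀ h w, F.ψV (S.Γ.att h) = .inl w → G.att (F.ψH h) = w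
  attψ_inr : ∀ h i, F.ψV (S.Γ.att h) = .inr i → ∃ v, F.φV i v = G.att (F.ψH h)
  vtypeψ_inl : ∀ v w, F.ψV v = .inl w → G.vtype w = S.Γ.vtype v
  vtypeψ_inr : ∀ v i, F.ψV v = .inr i → (S.A i).res = .inl (S.Γ.vtype v)
  htypeψ : ∀ h, G.htype (F.ψH h) = S.Γ.htype h
  res : G.res = S.Γ.res

/-- The contraction of the pieces gives `Γ`. -/
structure IsDec (F : Frame S G) : Prop extends IsFrame F where
  lineψ : ∀ h h', S.Γ.line h (.inl h') ↔ G.Leads F.subs (F.ψH h) (.inl (F.ψH h'))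
  labelψ : ∀ h a, S.Γ.line h (.inr a) ↔ G.Leads F.subs (F.ψH h) (.inr a)

namespace IsFrame

variable {F : Frame S G} (hF : F.IsFrame)
include hF

theorem φH_eq {i j : S.I} {h : (S.A i).H} {h' : (S.A j).H} (he : F.φH i h = F.φH j h') :
    i = j := by
  have := congrArg G.att he
  rw [hF.att, hF.att] at this
  exact hF.disj _ _ _ _ this

theorem verts_piece (i : S.I) : G.verts (F.piece i).1 = Set.range (F.φV i) := by
  ext w
  constructor
  · rintro ⟨_, ⟨h, -, rfl⟩, rfl⟩
    exact ⟨_, (hF.att i h).symm⟩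
  · rintro ⟨v, rfl⟩
    obtain ⟨h, hh, rfl⟩ := (S.hA i).exists_isInt_att v
    exact ⟨_, ⟨h, hh, rfl⟩, hF.att i h⟩

theorem mem_legs {i : S.I} {g : G.H} :
    g ∈ G.legs (F.piece i).1 ↔ ∃ h, ¬ (S.A i).IsInt h ∧ F.φH i h = g := by
  rw [legs, Set.mem_ofPred_eq, hF.verts_piece]
  constructor
  · rintro ⟨h1, v, hv⟩
    obtain ⟨h, rfl⟩ := hF.star i g v hv.symm
    exact ⟨h, fun hh => h1 ⟨h, hh, rfl⟩, rfl⟩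
  · rintro ⟨h, hh, rfl⟩
    refine ⟨?_, _, (hF.att i h).symm⟩
    rintro ⟨h', hh', he⟩
    exact hh (hF.φH_inj i he ▸ hh')

theorem piece_injective : Function.Injective F.piece := by
  intro i j hij
  obtain ⟨v⟩ := (S.hA i).nonempty
  have : F.φV i v ∈ G.verts (F.piece i).1 := by
    rw [hF.verts_piece]
    exact ⟨v, rfl⟩
  rw [hij, hF.verts_piece] at this
  obtain ⟨w, hw⟩ := this
  exact (hF.disj _ _ _ _ hw).symm

omit hF in
theorem mem_subs {c : G.Piece} : c ∈ F.subs ↔ ∃ i, F.piece i = c := by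
  simp [subs]

/-- The two legs of an edge-type piece. -/
theorem exists_legs {c : G.Piece} (hc : c ∈ F.subs) {e : T.EType} (he : c.2 = .inr e) {g g' : G.H}
    (hg : g ∈ G.legs c.1) (hg' : g' ∈ G.legs c.1) (hne : g ≠ g') :
    ∃ i b, F.out (.inr (i, b)) = g ∧ F.out (.inr (i, !b)) = g' := by
  obtain ⟨i, rfl⟩ := mem_subs.1 hc
  obtain ⟨h, hh, rfl⟩ := hF.mem_legs.1 hg
  obtain ⟨h', hh', rfl⟩ := hF.mem_legs.1 hg'
  have hi : (S.A i).res.isRight := by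
    have he : (S.A i).res = .inr e := he
    simp [he]
  obtain ⟨b, rfl⟩ := (S.exists_leg_iff ⟨i, hi⟩ h).2 hh
  obtain ⟨b', rfl⟩ := (S.exists_leg_iff ⟨i, hi⟩ h').2 hh'
  refine ⟨⟨i, hi⟩, b, rfl, ?_⟩
  have : b' = !b := by
    have : b' ≠ b := by rintro rfl; exact hne rfl
    revert this
    cases b <;> cases b' <;> simp
  rw [this]
  rfl

theorem out_mem_legs (i : S.IE) (b : Bool) :
    F.out (.inr (i, b)) ∈ G.legs (F.piece i.1).1 :=
  hF.mem_legs.2 ⟨_, S.leg_not_isInt i b, rfl⟩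

theorem out_injective : Function.Injective F.out := by
  have key : ∀ h i b, F.out (.inl h) ≠ F.out (.inr (i, b)) := by
    intro h i b he
    exact ((hF.ψH_range _).1 ⟨h, rfl⟩).2 i.1 i.2 _
      (((congrArg G.att he).trans (hF.att _ _)).symm)
  rintro (h | ⟨i, b⟩) (h' | ⟨i', b'⟩) he
  · rw [hF.ψH_inj he]
  · exact absurd he (key _ _ _)
  · exact absurd he.symm (key _ _ _)
  · have hii := hF.φH_eq he
    obtain ⟨i, hi⟩ := i
    obtain ⟨i', hi'⟩ := i'
    obtain rfl : i = i' := hii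
    rw [S.leg_injective _ (hF.φH_inj _ he)]

/-- Every half-line is internal to a piece, or an end of a line outside of the pieces. -/
theorem cases_H (g : G.H) :
    (∃ i h, (S.A i).IsInt h ∧ F.φH i h = g) ∨ ∃ x, F.out x = g := by
  by_cases h1 : ∃ i h, (S.A i).IsInt h ∧ F.φH i h = g
  · exact .inl h1
  · right
    by_cases h2 : ∃ i, (S.A i).res.isRight ∧ ∃ v, F.φV i v = G.att g
    · obtain ⟨i, hi, v, hv⟩ := h2
      obtain ⟨h, rfl⟩ := hF.star i g v hv.symm
      obtain ⟨b, rfl⟩ := (S.exists_leg_iff ⟨i, hi⟩ h).2 fun hh => h1 ⟨i, h, hh, rfl⟩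
      exact ⟨.inr (⟨i, hi⟩, b), rfl⟩
    · obtain ⟨h, rfl⟩ := (hF.ψH_range g).2
        ⟨fun i h hh he => h1 ⟨i, h, hh, he⟩, fun i hi v hv => h2 ⟨i, hi, v, hv⟩⟩
      exact ⟨.inl h, rfl⟩

theorem out_ne_int (x : S.K) (i : S.I) (h : (S.A i).H) (hh : (S.A i).IsInt h) :
    F.φH i h ≠ F.out x := by
  rcases x with h' | ⟨j, b⟩
  · exact ((hF.ψH_range _).1 ⟨h', rfl⟩).1 i h hh
  · intro he
    obtain rfl := hF.φH_eq he
    exact S.leg_not_isInt j b (hF.φH_inj _ he ▸ hh)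

/-- The lines outside of the pieces are given by the matching `lam`. -/
theorem leads_inl {lam : S.K → S.K}
    (hline : ∀ x g, G.line (F.out x) (.inl g) ↔ lam x ≠ x ∧ g = F.out (lam x))
    (hfix : ∀ y, lam (.inr y) ≠ .inr y) (x : S.K) (h : S.Γ.H) :
    G.Leads F.subs (F.out x) (.inl (F.ψH h)) ↔ Follow lam x h ∧ lam x ≠ x := by
  constructor
  · intro hL
    generalize hg : F.out x = g at hL
    generalize hz : (.inl (F.ψH h) : G.H ⊕ T.Label) = z at hL
    induction hL generalizing x with
    | direct hl =>
      subst hg hz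
      obtain ⟨h1, h2⟩ := (hline _ _).1 hl
      exact ⟨.direct (hF.out_injective (a₁ := .inl h) h2).symm, h1⟩
    | through hl hc he h1 h2 hne _ ih =>
      subst hg
      obtain ⟨i, b, rfl, hb⟩ := hF.exists_legs hc he h1 h2 hne
      obtain ⟨h3, h4⟩ := (hline _ _).1 hl
      exact ⟨.through (hF.out_injective h4).symm (ih _ hb hz).1, h3⟩
  · rintro ⟨hf, hx⟩
    induction hf with
    | direct h1 => exact .direct ((hline _ _).2 ⟨hx, by rw [h1]; rfl⟩)
    | @through x a i b h1 _ ih =>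
      refine .through (h₁ := F.out (.inr (i, b))) (h₂ := F.out (.inr (i, !b)))
        ((hline _ _).2 ⟨hx, by rw [h1]⟩) (mem_subs.2 ⟨i.1, rfl⟩) (S.res_IE i)
        (hF.out_mem_legs i b) (hF.out_mem_legs i _) (hF.out_injective.ne ?_) (ih (hfix _))
      simp

theorem leads_inr (hlab : ∀ y a, ¬ G.line (F.out (.inr y)) (.inr a)) (g : G.H) (a : T.Label) :
    G.Leads F.subs g (.inr a) ↔ G.line g (.inr a) := by
  refine ⟨fun hL => ?_, .direct⟩
  generalize hz : (.inr a : G.H ⊕ T.Label) = z at hL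
  induction hL with
  | direct hl => exact hl
  | through hl hc he h1 h2 hne _ ih =>
    obtain ⟨i, b, -, rfl⟩ := hF.exists_legs hc he h1 h2 hne
    have := ih hz
    rw [← hz] at this
    exact absurd this (hlab _ _)

/-- Not all vertices belong to edge-type pieces. -/
theorem exists_vertex : ∃ w, ∀ i, (S.A i).res.isRight → ∀ v, F.φV i v ≠ w := by
  obtain ⟨v⟩ := S.hΓ.nonempty
  rcases hv : F.ψV v with w | j
  · exact ⟨w, fun i _ => (hF.ψV_inl w).1 ⟨v, hv⟩ i⟩
  · obtain ⟨u⟩ := (S.hA j).nonempty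
    refine ⟨F.φV j u, fun i hi v' he => ?_⟩
    obtain rfl := hF.disj _ _ _ _ he
    have := (hF.ψV_inr i).1 ⟨v, hv⟩
    revert hi this
    cases (S.A i).res <;> simp

/-- An edge-type piece is not attached to an external line, since otherwise its other line would
disconnect the graph. -/
theorem leg_not_label (hG : G.IsOnePI) (y : S.IE × Bool) (a : T.Label) :
    ¬ G.line (F.out (.inr y)) (.inr a) := by
  obtain ⟨i, b⟩ := y
  intro ha
  have hU' : (Set.range (F.φV i.1))ᶜ.Nonempty := by
    obtain ⟨w, hw⟩ := hF.exists_vertex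
    exact ⟨w, fun ⟨v, hv⟩ => hw i.1 i.2 v hv⟩
  have hU : (Set.range (F.φV i.1)).Nonempty := by
    obtain ⟨v⟩ := (S.hA i.1).nonempty
    exact ⟨_, v, rfl⟩
  obtain ⟨h, h', hl, hne, ⟨v, hv⟩, hv'⟩ := hG.cutCond _ hU hU'
    s(F.out (.inr (i, !b)), G.mate (F.out (.inr (i, !b))))
  obtain ⟨h, rfl⟩ := hF.star _ _ _ hv.symm
  by_cases hh : (S.A i.1).IsInt h
  · obtain ⟨h'', hl'⟩ := hh
    have := hG.isFeynman.line_right_unique hl (hF.line _ _ _ hl')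
    cases this
    exact hv' ⟨_, (hF.att _ _).symm⟩
  · obtain ⟨c, rfl⟩ := (S.exists_leg_iff i h).2 hh
    by_cases hc : c = b
    · subst hc
      cases hG.isFeynman.line_right_unique hl ha
    · obtain rfl : c = !b := by
        revert hc
        cases b <;> cases c <;> simp
      have h1 : G.mate (F.out (.inr (i, !b))) = h' := hG.isFeynman.mate_eq hl
      rw [h1] at hne
      exact hne rfl

/-- There are no closed lines, since they would be disconnected from the rest of the graph. -/
theorem reach (hG : G.IsOnePI) {lam : S.K → S.K}
    (hline : ∀ x g, G.line (F.out x) (.inl g) ↔ lam x ≠ x ∧ g = F.out (lam x))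
    (hinv : ∀ x, lam (lam x) = x) (x : S.K) : ∃ a, Follow lam x a := by
  obtain ⟨hN1, hN2⟩ := not_reach_closed (lam := lam) hinv
  by_contra hx
  have hy : ∃ y, ¬ ∃ a, Follow lam (.inr y) a := by
    rcases h : lam x with a | ⟨j, b⟩
    · exact absurd ⟨a, .direct h⟩ hx
    · exact ⟨(j, !b), fun ⟨a, ha⟩ => hx ⟨a, .through h ha⟩⟩
  obtain ⟨y, hy⟩ := hy
  let U : Set G.V := {w | ∃ y, (¬ ∃ a, Follow lam (.inr y) a) ∧ ∃ v, F.φV y.1 v = w}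
  have hU : U.Nonempty := by
    obtain ⟨v⟩ := (S.hA y.1).nonempty
    exact ⟨_, y, hy, v, rfl⟩
  have hU' : Uᶜ.Nonempty := by
    obtain ⟨w, hw⟩ := hF.exists_vertex
    exact ⟨w, fun ⟨y, _, v, hv⟩ => hw y.1 y.1.2 v hv⟩
  obtain ⟨q, -⟩ := hG.exists_isInt
  obtain ⟨h, h', hl, -, ⟨y, hy, v, hv⟩, hv'⟩ := hG.cutCond U hU hU' s(q, q)
  obtain ⟨h, rfl⟩ := hF.star _ _ _ hv.symm
  by_cases hh : (S.A y.1).IsInt h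
  · obtain ⟨h'', hl'⟩ := hh
    have := hG.isFeynman.line_right_unique hl (hF.line _ _ _ hl')
    cases this
    exact hv' ⟨y, hy, _, (hF.att _ _).symm⟩
  · obtain ⟨c, rfl⟩ := (S.exists_leg_iff y.1 h).2 hh
    have hc : ¬ ∃ a, Follow lam (.inr (y.1, c)) a := by
      by_cases hc : c = y.2
      · rw [hc]
        exact hy
      · have : c = !y.2 := by
          revert hc
          cases y.2 <;> cases c <;> simp
        rw [this]
        exact hN1 _ _ hy
    obtain ⟨⟨j, b⟩, hz, hz'⟩ := hN2 _ hc
    have h1 := ((hline (.inr (y.1, c)) h').1 hl).2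
    rw [hz] at h1
    refine hv' ⟨(j, b), hz', (S.A j.1).att (S.leg j b), ?_⟩
    rw [h1]
    exact (hF.att _ _).symm

end IsFrame

end Frame

end Feynman

namespace Feynman

/-! ### Glued graphs and decompositions -/

variable {T : Theory}

open PreGraph

namespace Gluing

variable {S : Setup T} {G : PreGraph T} (d : Gluing S) (f : Iso d.glue G)

open Classical in
/-- The decomposition of a glued graph into its constituents. -/
noncomputable def frame : Frame S G where
  φV i v := f.onV (.inr ⟨i, v⟩)
  φH i h := f.onH (.inr ⟨i, h⟩)
  ψV v := if hv : ∃ i, d.p i = v then .inr hv.choose.1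
    else .inl (f.onV (.inl ⟨v, fun i hi => hv ⟨i, hi⟩⟩))
  ψH h := f.onH (d.kap (.inl h))

theorem frame_ψV_p (i : S.IV) : (d.frame f).ψV (d.p i) = .inr i.1 := by
  have hv : ∃ j, d.p j = d.p i := ⟨i, rfl⟩
  simp only [frame]
  rw [dif_pos hv, d.p_injective hv.choose_spec]

theorem frame_ψV_out (v : S.Γ.V) (hv : ∀ i, d.p i ≠ v) :
    (d.frame f).ψV v = .inl (f.onV (.inl ⟨v, hv⟩)) := by
  simp only [frame]
  rw [dif_neg (by push Not; exact hv)]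

theorem frame_out (x : S.K) : (d.frame f).out x = f.onH (d.kap x) := by
  rcases x with h | ⟨i, b⟩ <;> rfl

theorem frame_line (x : S.K) (g : G.H) : G.line ((d.frame f).out x) (.inl g) ↔
    d.lam x ≠ x ∧ g = (d.frame f).out (d.lam x) := by
  obtain ⟨X, rfl⟩ := f.onH.surjective g
  rw [frame_out, frame_out]
  exact (f.line _ _).trans ((d.glue_line_kap_inl_iff _ _).trans
    (and_congr_right fun _ => f.onH.apply_eq_iff_eq.symm))

theorem frame_label (x : S.K) (a : T.Label) : G.line ((d.frame f).out x) (.inr a) ↔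
    ∃ h, x = .inl h ∧ S.Γ.line h (.inr a) := by
  rw [frame_out]
  refine (f.label _ _).trans ((d.glue_line_kap _ _).trans ?_)
  simp

theorem isFrame : (d.frame f).IsFrame where
  φV_inj i v v' h := by
    cases f.onV.injective h
    rfl
  φH_inj i v v' h := by
    cases f.onH.injective h
    rfl
  disj i j v w h := by
    cases f.onV.injective h
    rfl
  att i h := f.att _
  star i g v h := by
    obtain ⟨X, rfl⟩ := f.onH.surjective g
    rw [f.att] at h
    have h := f.onV.injective h
    rcases X with X | ⟨j, X⟩
    · cases h
    · cases h
      exact ⟨X, rfl⟩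
  vtype i v := f.vtype _
  htype i h := f.htype _
  line i h h' hl := (f.line _ _).2 (.inl ⟨i, h, h', rfl, rfl, hl⟩)
  ψV_inj v v' h := by
    by_cases hv : ∃ i, d.p i = v <;> by_cases hv' : ∃ i, d.p i = v'
    · obtain ⟨i, rfl⟩ := hv
      obtain ⟨j, rfl⟩ := hv'
      rw [frame_ψV_p, frame_ψV_p] at h
      rw [Subtype.ext (Sum.inr_injective h)]
    · obtain ⟨i, rfl⟩ := hv
      rw [frame_ψV_p, frame_ψV_out _ _ _ fun i hi => hv' ⟨i, hi⟩] at h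
      cases h
    · obtain ⟨i, rfl⟩ := hv'
      rw [frame_ψV_p, frame_ψV_out _ _ _ fun i hi => hv ⟨i, hi⟩] at h
      cases h
    · rw [frame_ψV_out _ _ _ fun i hi => hv ⟨i, hi⟩,
        frame_ψV_out _ _ _ fun i hi => hv' ⟨i, hi⟩] at h
      cases f.onV.injective (Sum.inl_injective h)
      rfl
  ψV_inl w := by
    obtain ⟨W, rfl⟩ := f.onV.surjective w
    constructor
    · rintro ⟨v, hv⟩ i u hu
      have hu := f.onV.injective hu
      by_cases hv' : ∃ i, d.p i = v
      · obtain ⟨j, rfl⟩ := hv'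
        rw [frame_ψV_p] at hv
        cases hv
      · rw [frame_ψV_out _ _ _ fun i hi => hv' ⟨i, hi⟩] at hv
        have := f.onV.injective (Sum.inl_injective hv)
        rw [← this] at hu
        cases hu
    · intro h
      rcases W with ⟨v, hv⟩ | ⟨i, v⟩
      · exact ⟨v, frame_ψV_out _ _ _ hv⟩
      · exact absurd rfl (h i v)
  ψV_inr i := by
    constructor
    · rintro ⟨v, hv⟩
      by_cases hv' : ∃ i, d.p i = v
      · obtain ⟨j, rfl⟩ := hv'
        rw [frame_ψV_p] at hv
        cases hv
        exact j.2
      · rw [frame_ψV_out _ _ _ fun i hi => hv' ⟨i, hi⟩] at hv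
        cases hv
    · exact fun hi => ⟨_, d.frame_ψV_p f ⟨i, hi⟩⟩
  ψH_inj h h' he := Sum.inl_injective (d.kap_injective (f.onH.injective he))
  ψH_range g := by
    obtain ⟨X, rfl⟩ := f.onH.surjective g
    constructor
    · rintro ⟨h, hh⟩
      obtain rfl := f.onH.injective hh
      refine ⟨fun i h' hh' he => d.kap_ne_int _ i h' hh' (f.onH.injective he).symm,
        fun i hi v hv => ?_⟩
      have hv := f.onV.injective (hv.trans (f.att _))
      rcases d.cases_H h with ⟨j, x, rfl⟩ | hh
      · rw [kap_Q] at hv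
        cases hv
        have hj := j.2
        have hi : (S.A j.1).res.isRight := hi
        revert hi hj
        cases (S.A j.1).res <;> simp
      · rw [kap_out _ _ hh] at hv
        cases hv
    · rintro ⟨h1, h2⟩
      rcases d.cases_GH X with ⟨i, h, hh, rfl⟩ | ⟨h | ⟨i, b⟩, rfl⟩
      · exact absurd rfl (h1 i h hh)
      · exact ⟨h, rfl⟩
      · exact absurd (f.att (d.kap (.inr (i, b)))).symm
          (h2 i.1 i.2 ((S.A i.1).att (S.leg i b)))
  attψ_inl h w hw := by
    rcases d.cases_H h with ⟨i, x, rfl⟩ | hh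
    · rw [(d.Q i x).2, frame_ψV_p] at hw
      cases hw
    · rw [frame_ψV_out _ _ _ hh] at hw
      cases hw
      refine (f.att _).trans ?_
      rw [kap_out _ _ hh]
      rfl
  attψ_inr h i hw := by
    rcases d.cases_H h with ⟨i, x, rfl⟩ | hh
    · rw [(d.Q i x).2, frame_ψV_p] at hw
      cases hw
      refine ⟨(S.A i.1).att x.1, ?_⟩
      refine Eq.trans ?_ (f.att _).symm
      rw [kap_Q]
      rfl
    · rw [frame_ψV_out _ _ _ hh] at hw
      cases hw
  vtypeψ_inl v w hw := by
    by_cases hv : ∃ i, d.p i = v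
    · obtain ⟨i, rfl⟩ := hv
      rw [frame_ψV_p] at hw
      cases hw
    · rw [frame_ψV_out _ _ _ fun i hi => hv ⟨i, hi⟩] at hw
      cases hw
      exact f.vtype _
  vtypeψ_inr v i hw := by
    by_cases hv : ∃ i, d.p i = v
    · obtain ⟨i, rfl⟩ := hv
      rw [frame_ψV_p] at hw
      cases hw
      rw [d.p_type, S.res_IV]
    · rw [frame_ψV_out _ _ _ fun i hi => hv ⟨i, hi⟩] at hw
      cases hw
  htypeψ h := (f.htype _).trans (d.glue_htype_kap _)
  res := f.res.symm

theorem isDec : (d.frame f).IsDec where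
  toIsFrame := d.isFrame f
  lineψ h h' := by
    rw [show (d.frame f).ψH h = (d.frame f).out (.inl h) from rfl,
      (d.isFrame f).leads_inl (d.frame_line f) d.ext.fixJ, lam_ne_inl]
    constructor
    · intro hl
      have := d.ext.follow h
      rw [S.hΓ.isFeynman.mate_eq hl] at this
      exact ⟨this, ⟨_, hl⟩⟩
    · rintro ⟨hf, hh⟩
      rw [hf.unique (d.ext.follow h)]
      exact IsFeynman.line_mate hh
  labelψ h a := by
    rw [(d.isFrame f).leads_inr, show (d.frame f).ψH h = (d.frame f).out (.inl h) from rfl,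
      frame_label]
    · simp
    · intro y a
      rw [frame_label]
      simp

/-- A gluing and an identification of the glued graph are determined by the decomposition. -/
theorem frame_injective :
    Function.Injective fun x : Σ d : Gluing S, Iso d.glue G => x.1.frame x.2 := by
  rintro ⟨d, f⟩ ⟨d', f'⟩ h
  have h : d.frame f = d'.frame f' := h
  have hp : d.p = d'.p := by
    funext i
    apply (d.isFrame f).ψV_inj
    rw [frame_ψV_p, h, frame_ψV_p]
  have hQ : ∀ i x, (d.Q i x).1 = (d'.Q i x).1 := by
    intro i x
    apply (d.isFrame f).ψH_inj
    have h1 : (d.frame f).ψH (d.Q i x).1 = (d.frame f).φH i.1 x.1 :=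
      congrArg f.onH (d.kap_Q i x)
    have h2 : (d'.frame f').ψH (d'.Q i x).1 = (d'.frame f').φH i.1 x.1 :=
      congrArg f'.onH (d'.kap_Q i x)
    rw [h1, h, h2]
  have hlam : d.lam = d'.lam := by
    funext x
    have h1 := d.frame_line f x
    have h2 := d'.frame_line f' x
    rw [← h] at h2
    by_cases hx : d.lam x = x
    · by_contra hc
      have := (h1 _).1 ((h2 _).2 ⟨fun h => hc (hx.trans h.symm), rfl⟩)
      exact this.1 hx
    · exact (d.isFrame f).out_injective ((h2 _).1 ((h1 _).2 ⟨hx, rfl⟩)).2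
  have hd : d = d' := by
    obtain ⟨p, p1, p2, Q, Q1, lam, e⟩ := d
    obtain ⟨p', p1', p2', Q', Q1', lam', e'⟩ := d'
    obtain rfl : p = p' := hp
    obtain rfl : lam = lam' := hlam
    obtain rfl : Q = Q' := by
      funext i
      ext x
      exact hQ i x
    rfl
  subst hd
  congr 1
  refine Iso.ext ?_ ?_
  · ext X
    rcases X with ⟨v, hv⟩ | ⟨i, v⟩
    · have h1 := d.frame_ψV_out f v hv
      rw [h, frame_ψV_out _ _ _ hv] at h1
      exact (Sum.inl_injective h1).symm
    · exact congrFun (congrFun (congrArg Frame.φV h) i) v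
  · ext X
    rcases X with ⟨h', hh⟩ | ⟨i, h'⟩
    · have h1 : f.onH (d.kap (.inl h')) = f'.onH (d.kap (.inl h')) :=
        congrFun (congrArg Frame.ψH h) h'
      rwa [kap_out _ _ hh] at h1
    · exact congrFun (congrFun (congrArg Frame.φH h) i) h'

end Gluing

namespace Frame

variable {S : Setup T} {G : PreGraph T} {F : Frame S G}

namespace IsDec

variable (hF : F.IsDec) (hG : G.IsOnePI)
include hF

/-- The position of a vertex-type piece. -/
theorem exists_pos (i : S.IV) : ∃ v, F.ψV v = .inr i.1 := (hF.ψV_inr _).2 i.2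

/-- The half-lines of `Γ` at a vertex which replaces a piece are the external half-lines of this
piece. -/
theorem exists_ident (i : S.IV) {v : S.Γ.V} (hv : F.ψV v = .inr i.1) :
    ∃ Q : {h // ¬ (S.A i.1).IsInt h} ≃ {h // S.Γ.att h = v}, ∀ x, F.ψH (Q x).1 = F.φH i.1 x.1 := by
  have hex : ∀ x : {h // ¬ (S.A i.1).IsInt h},
      ∃ h : {h // S.Γ.att h = v}, F.ψH h.1 = F.φH i.1 x.1 := by
    rintro ⟨x, hx⟩
    obtain ⟨h, hh⟩ := (hF.ψH_range (F.φH i.1 x)).2 ⟨fun j h hj he => by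
        obtain rfl := hF.φH_eq he
        exact hx (hF.φH_inj _ he ▸ hj), fun j hj w hw => by
        rw [hF.att] at hw
        obtain rfl := hF.disj _ _ _ _ hw
        have := i.2
        revert hj this
        cases (S.A i.1).res <;> simp⟩
    refine ⟨⟨h, hF.ψV_inj ?_⟩, hh⟩
    rw [hv]
    rcases hw : F.ψV (S.Γ.att h) with w | j
    · have := hF.attψ_inl _ _ hw
      rw [hh, hF.att] at this
      exact absurd this ((hF.ψV_inl w).1 ⟨_, hw⟩ _ _)
    · obtain ⟨u, hu⟩ := hF.attψ_inr _ _ hw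
      rw [hh, hF.att] at hu
      rw [hF.disj _ _ _ _ hu]
  choose Q hQ using hex
  refine ⟨Equiv.ofBijective Q ⟨fun x y h => ?_, ?_⟩, hQ⟩
  · apply Subtype.ext
    apply hF.φH_inj i.1
    rw [← hQ, ← hQ, h]
  · rintro ⟨h, rfl⟩
    obtain ⟨u, hu⟩ := hF.attψ_inr _ _ hv
    obtain ⟨x, hx⟩ := hF.star _ _ _ hu.symm
    refine ⟨⟨x, fun hx' => ((hF.ψH_range _).1 ⟨h, rfl⟩).1 _ _ hx' hx⟩, ?_⟩
    apply Subtype.ext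
    apply hF.ψH_inj
    rw [hQ, hx]

include hG

/-- The line which starts at an end outside of the pieces has its other end outside, too. -/
theorem exists_matching : ∃ lam : S.K → S.K,
    (∀ x g, G.line (F.out x) (.inl g) ↔ lam x ≠ x ∧ g = F.out (lam x)) ∧
    IsExtension S.Γ.mate S.Γ.htype S.et lam := by
  have hfey := hG.isFeynman
  have hex : ∀ x, ∃ y, G.mate (F.out x) = F.out y := by
    intro x
    rcases hF.cases_H (G.mate (F.out x)) with ⟨i, h, hh, he⟩ | ⟨y, hy⟩
    · exfalso
      have h1 := hF.line i _ _ (IsFeynman.line_mate hh)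
      have h2 := hfey.mate_eq h1
      rw [he, hfey.mate_mate] at h2
      exact hF.out_ne_int x i _ ((S.fey i).isInt_mate hh) h2.symm
    · exact ⟨y, hy.symm⟩
  choose lam hlam using hex
  have hfix : ∀ x, lam x ≠ x ↔ G.IsInt (F.out x) := by
    intro x
    rw [← hF.out_injective.ne_iff, ← hlam, Ne, hfey.mate_eq_self, not_not]
  have hline : ∀ x g, G.line (F.out x) (.inl g) ↔ lam x ≠ x ∧ g = F.out (lam x) := by
    intro x g
    rw [hfix, ← hlam]
    constructor
    · exact fun hl => ⟨⟨g, hl⟩, (hfey.mate_eq hl).symm⟩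
    · rintro ⟨hh, rfl⟩
      exact IsFeynman.line_mate hh
  have hinv : ∀ x, lam (lam x) = x := by
    intro x
    apply hF.out_injective
    rw [← hlam, ← hlam, hfey.mate_mate]
  have hfixJ : ∀ y, lam (.inr y) ≠ .inr y := by
    intro y
    rw [hfix]
    by_contra hc
    obtain ⟨a, ha⟩ := hfey.exists_label hc
    exact hF.leg_not_label hG _ _ ha
  have htype : ∀ x, G.htype (F.out x) = endType S.Γ.htype S.et x := by
    rintro (h | ⟨i, b⟩)
    · exact hF.htypeψ h
    · exact (hF.htype _ _).trans (S.htype_leg i b)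
  have hext : ∀ h, lam (.inl h) ≠ .inl h ↔ S.Γ.IsInt h := by
    intro h
    rw [hfix]
    constructor
    · intro hh
      by_contra hc
      obtain ⟨a, ha⟩ := S.hΓ.isFeynman.exists_label hc
      rw [hF.labelψ, hF.leads_inr (hF.leg_not_label hG)] at ha
      exact hfey.not_isInt ha hh
    · rintro ⟨h', hl⟩
      rw [hF.lineψ, show F.ψH h = F.out (.inl h) from rfl, hF.leads_inl hline hfixJ] at hl
      exact (hfix _).1 hl.2
  refine ⟨lam, hline, hinv, fun x => ?_, fun h => ?_, hfixJ, fun h => ?_, hF.reach hG hline hinv⟩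
  · rw [← htype, ← hlam, hfey.htype_mate, htype]
  · rw [← not_iff_not, S.hΓ.isFeynman.mate_eq_self, not_not]
    exact hext h
  · by_cases hh : S.Γ.IsInt h
    · have := (hF.lineψ _ _).1 (IsFeynman.line_mate hh)
      exact ((hF.leads_inl hline hfixJ (.inl h) _).1 this).1
    · rw [IsFeynman.mate_of_not hh]
      exact .direct (not_not.1 fun hc => hh ((hext h).1 hc))

/-- Every decomposition comes from a gluing. -/
theorem exists_gluing : ∃ (d : Gluing S) (f : Iso d.glue G), d.frame f = F := by
  have hfey := hG.isFeynman
  choose p hp using hF.exists_pos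
  choose Q hQ using fun i => hF.exists_ident i (hp i)
  obtain ⟨lam, hline, hlam⟩ := hF.exists_matching hG
  let d : Gluing S :=
    { p := p
      p_injective := fun i j h => by
        have := hp i
        rw [h, hp j] at this
        exact Subtype.ext (Sum.inr_injective this).symm
      p_type := fun i => by
        have := hF.vtypeψ_inr _ _ (hp i)
        rw [S.res_IV] at this
        exact (Sum.inl_injective this).symm
      Q := Q
      Q_type := fun i x => by rw [← hF.htypeψ, hQ, hF.htype]
      lam := lam
      ext := hlam }
  have hout : ∀ v, (∀ i, d.p i ≠ v) → ∃ w, F.ψV v = .inl w := by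
    intro v hv
    rcases hw : F.ψV v with w | i
    · exact ⟨w, rfl⟩
    · have hi := (hF.ψV_inr i).1 ⟨v, hw⟩
      refine absurd (hF.ψV_inj ?_) (hv ⟨i, hi⟩)
      rw [hw]
      exact hp _
  choose w hw using hout
  have hp' : ∀ (i : S.IV) u, F.ψV (d.p i) ≠ .inl u := by
    intro i u hu
    have := (hp i).symm.trans hu
    cases this
  let onV : d.GV → G.V := Sum.elim (fun v => w v.1 v.2) fun x => F.φV x.1 x.2
  let onH : d.GH → G.H := Sum.elim (fun h => F.ψH h.1) fun x => F.φH x.1 x.2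
  have hkap : ∀ x, onH (d.kap x) = F.out x := by
    rintro (h | ⟨i, b⟩)
    · rcases d.cases_H h with ⟨i, x, rfl⟩ | hh
      · rw [d.kap_Q]
        exact (hQ i x).symm
      · rw [d.kap_out _ hh]
        rfl
    · rfl
  have hV : Function.Bijective onV := by
    constructor
    · rintro (⟨v, hv⟩ | ⟨i, v⟩) (⟨v', hv'⟩ | ⟨i', v'⟩) h
      · have h : w v hv = w v' hv' := h
        have h1 := hw v hv
        rw [h, ← hw v' hv'] at h1
        cases hF.ψV_inj h1
        rfl
      · exact absurd h.symm ((hF.ψV_inl _).1 ⟨v, hw v hv⟩ i' v')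
      · exact absurd h ((hF.ψV_inl _).1 ⟨v', hw v' hv'⟩ i v)
      · obtain rfl := hF.disj _ _ _ _ h
        obtain rfl := hF.φV_inj i h
        rfl
    · intro u
      by_cases hu : ∃ i v, F.φV i v = u
      · obtain ⟨i, v, rfl⟩ := hu
        exact ⟨.inr ⟨i, v⟩, rfl⟩
      · push Not at hu
        obtain ⟨v, hv⟩ := (hF.ψV_inl u).2 hu
        have hv' : ∀ i, d.p i ≠ v := by
          rintro i rfl
          exact hp' i u hv
        refine ⟨.inl ⟨v, hv'⟩, ?_⟩
        exact Sum.inl_injective ((hw v hv').symm.trans hv)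
  have hH : Function.Bijective onH := by
    constructor
    · have key : ∀ h hh i h', onH (.inl ⟨h, hh⟩) ≠ onH (.inr ⟨i, h'⟩) := by
        intro h hh i h' he
        have he : F.ψH h = F.φH i h' := he
        have h1 := hF.attψ_inl _ _ (hw _ hh)
        rw [he, hF.att] at h1
        exact (hF.ψV_inl _).1 ⟨_, hw _ hh⟩ _ _ h1
      rintro (⟨v, hv⟩ | ⟨i, v⟩) (⟨v', hv'⟩ | ⟨i', v'⟩) h
      · cases hF.ψH_inj h
        rfl
      · exact absurd h (key _ _ _ _)
      · exact absurd h.symm (key _ _ _ _)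
      · obtain rfl := hF.φH_eq h
        obtain rfl := hF.φH_inj i h
        rfl
    · intro g
      rcases hF.cases_H g with ⟨i, h, hh, rfl⟩ | ⟨x, rfl⟩
      · exact ⟨.inr ⟨i, h⟩, rfl⟩
      · exact ⟨_, hkap x⟩
  let f : Iso d.glue G :=
    { onV := Equiv.ofBijective onV hV
      onH := Equiv.ofBijective onH hH
      res := hF.res.symm
      att := by
        rintro (⟨h, hh⟩ | ⟨i, h⟩)
        · exact hF.attψ_inl _ _ (hw _ hh)
        · exact hF.att _ _
      vtype := by
        rintro (⟨v, hv⟩ | ⟨i, v⟩)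
        · exact hF.vtypeψ_inl _ _ (hw v hv)
        · exact hF.vtype _ _
      htype := by
        rintro (⟨h, hh⟩ | ⟨i, h⟩)
        · exact hF.htypeψ _
        · exact hF.htype _ _
      line := by
        intro X Y
        change G.line (onH X) (.inl (onH Y)) ↔ _
        rcases d.cases_GH X with ⟨i, h, hh, rfl⟩ | ⟨x, rfl⟩
        · rw [d.glue_line_inr i h hh]
          constructor
          · intro hl
            obtain ⟨h', hl'⟩ := hh
            have := Sum.inl_injective (hfey.line_right_unique hl (hF.line i _ _ hl'))
            refine ⟨h', ?_, hl'⟩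
            rw [hH.1 (this.trans rfl : onH Y = onH (.inr ⟨i, h'⟩))]
          · rintro ⟨h', hY, hl⟩
            obtain rfl := Sum.inl_injective hY
            exact hF.line _ _ _ hl
        · rw [hkap, hline, ← hkap]
          exact (and_congr_right fun _ => hH.1.eq_iff).trans (d.glue_line_kap_inl_iff _ _).symm
      label := by
        intro X a
        change G.line (onH X) (.inr a) ↔ _
        rcases d.cases_GH X with ⟨i, h, hh, rfl⟩ | ⟨x, rfl⟩
        · rw [d.glue_line_inr i h hh]
          constructor
          · intro hl
            obtain ⟨h', hl'⟩ := hh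
            have := hfey.line_right_unique hl (hF.line i _ _ hl')
            cases this
          · rintro ⟨h', hY, hl⟩
            cases hY
        · rw [hkap, d.glue_line_kap]
          rcases x with h | y
          · rw [show F.out (.inl h) = F.ψH h from rfl, ← hF.leads_inr (hF.leg_not_label hG),
              ← hF.labelψ]
            simp
          · refine iff_of_false (hF.leg_not_label hG _ _) ?_
            simp }
  refine ⟨d, f, Frame.ext rfl rfl ?_ ?_⟩
  · funext v
    by_cases hv : ∃ i, d.p i = v
    · obtain ⟨i, rfl⟩ := hv
      rw [d.frame_ψV_p]
      exact (hp i).symm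
    · have hv : ∀ i, d.p i ≠ v := fun i hi => hv ⟨i, hi⟩
      rw [d.frame_ψV_out _ _ hv, hw v hv]
      rfl
  · funext h
    exact hkap (.inl h)

end IsDec

/-- Decompositions of a 1PI graph correspond to presentations of it as a glued graph. -/
theorem card_isDec (S : Setup T) {G : PreGraph T} (hG : G.IsOnePI) :
    Nat.card {F : Frame S G // F.IsDec} = Nat.card (Σ d : Gluing S, Iso d.glue G) := by
  refine (Nat.card_eq_of_bijective (fun x => ⟨x.1.frame x.2, x.1.isDec x.2⟩) ⟨?_, ?_⟩).symm
  · intro x y h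
    exact Gluing.frame_injective (congrArg Subtype.val h)
  · rintro ⟨F, hF⟩
    obtain ⟨d, f, rfl⟩ := hF.exists_gluing hG
    exact ⟨⟨d, f⟩, rfl⟩

end Frame

end Feynman

namespace Feynman

/-! ### Decompositions and subgraphs -/

variable {T : Theory}

open PreGraph

/-- A subgraph `s` of `G` with labelled components, together with identifications of the components
with the pieces `A i` and of the contracted graph with `Γ`. -/
structure SubDec (S : Setup T) (G : PreGraph T) where
  s : Finset G.Piece
  proper : G.IsProperSub s
  l : ∀ c : {c // c ∈ s}, G.Labelling c.1.1 c.1.2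
  σ : S.I ≃ {c // c ∈ s}
  φ : ∀ i, Iso (S.A i) (G.sub (σ i).1.1 (σ i).1.2 (l (σ i)))
  ψ : Iso (G.contract s) S.Γ

namespace PreGraph

variable {G : PreGraph T} {s : Finset G.Piece}

theorem contract_att_inl {h : (G.contract s).H} {w} (hw : (G.contract s).att h = .inl w) :
    G.att h.1 = w.1 := by
  simp only [contract] at hw
  split_ifs at hw with hc
  exact congrArg Subtype.val (Sum.inl_injective hw)

theorem contract_att_inr {h : (G.contract s).H} {c} (hc : (G.contract s).att h = .inr c) :
    G.att h.1 ∈ G.verts c.1.1 := by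
  simp only [contract] at hc
  split_ifs at hc with hc'
  rw [← Sum.inr_injective hc]
  exact hc'.choose_spec

/-- The vertices of the contracted graph, with the contracted components numbered by `I`. -/
def flatV {I : Type} (σ : I ≃ {c // c ∈ s}) : (G.contract s).V → G.V ⊕ I :=
  Sum.map Subtype.val fun c => σ.symm ⟨c.1, c.2.1⟩

theorem flatV_injective {I : Type} (σ : I ≃ {c // c ∈ s}) : Function.Injective (flatV σ) := by
  refine Function.Injective.sumMap Subtype.val_injective fun c c' h => ?_
  have := σ.symm.injective h
  exact Subtype.ext (Subtype.mk.inj this)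

theorem flatV_inl {I : Type} (σ : I ≃ {c // c ∈ s}) {X w} (h : flatV σ X = .inl w) :
    ∃ hw, X = .inl ⟨w, hw⟩ := by
  rcases X with X | X
  · obtain rfl := Sum.inl_injective h
    exact ⟨X.2, rfl⟩
  · cases h

theorem flatV_inr {I : Type} (σ : I ≃ {c // c ∈ s}) {X i} (h : flatV σ X = .inr i) :
    ∃ hi, X = .inr ⟨(σ i).1, hi⟩ := by
  rcases X with X | X
  · cases h
  · obtain rfl := Sum.inr_injective h
    rw [Equiv.apply_symm_apply]
    exact ⟨X.2, rfl⟩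

end PreGraph

namespace SubDec

variable {S : Setup T} {G : PreGraph T} (x : SubDec S G)

/-- The decomposition given by a subgraph. -/
def frame : Frame S G where
  φV i v := ((x.φ i).onV v).1
  φH i h := ((x.φ i).onH h).1
  ψV v := flatV x.σ (x.ψ.onV.symm v)
  ψH h := (x.ψ.onH.symm h).1

theorem isInt_iff (i : S.I) (h : (S.A i).H) :
    (S.A i).IsInt h ↔ ((x.φ i).onH h).1 ∈ (x.σ i).1.1 := by
  constructor
  · rintro ⟨h', hl⟩
    exact (((x.φ i).line _ _).2 hl).1
  · intro hS
    by_contra hc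
    obtain ⟨a, ha⟩ := (S.fey i).exists_label hc
    obtain ⟨hl, -⟩ := ((x.φ i).label _ _).2 ha
    exact hl.1 hS

theorem piece_eq (i : S.I) : x.frame.piece i = (x.σ i).1 := by
  refine Prod.ext ?_ (x.φ i).res
  ext g
  constructor
  · rintro ⟨h, hh, rfl⟩
    exact (x.isInt_iff i h).1 hh
  · intro hg
    obtain ⟨h, hh⟩ := (x.φ i).onH.surjective ⟨g, g, hg, rfl⟩
    have hh' : ((x.φ i).onH h).1 = g := by rw [hh]
    refine ⟨h, (x.isInt_iff i h).2 ?_, hh'⟩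
    rwa [hh']

theorem subs_eq : x.frame.subs = x.s := by
  ext c
  rw [Frame.IsFrame.mem_subs]
  constructor
  · rintro ⟨i, rfl⟩
    rw [piece_eq]
    exact (x.σ i).2
  · intro hc
    exact ⟨x.σ.symm ⟨c, hc⟩, by rw [piece_eq, Equiv.apply_symm_apply]⟩

theorem mem_verts (i : S.I) (w : G.V) : w ∈ G.verts (x.σ i).1.1 ↔ ∃ v, x.frame.φV i v = w := by
  constructor
  · intro hw
    obtain ⟨v, hv⟩ := (x.φ i).onV.surjective ⟨w, hw⟩
    exact ⟨v, congrArg Subtype.val hv⟩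
  · rintro ⟨v, rfl⟩
    exact ((x.φ i).onV v).2

theorem onV_symm_att (h : S.Γ.H) :
    x.ψ.onV.symm (S.Γ.att h) = (G.contract x.s).att (x.ψ.onH.symm h) := by
  rw [Equiv.symm_apply_eq, ← x.ψ.att, Equiv.apply_symm_apply]

theorem res_σ (i : S.I) : (x.σ i).1.2 = (S.A i).res := (x.φ i).res.symm

theorem isFrame : x.frame.IsFrame where
  φV_inj i := Subtype.val_injective.comp (x.φ i).onV.injective
  φH_inj i := Subtype.val_injective.comp (x.φ i).onH.injective
  disj i j v w h := by
    by_contra hij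
    have h1 := (x.mem_verts i _).2 ⟨v, rfl⟩
    have h2 := (x.mem_verts j _).2 ⟨w, rfl⟩
    rw [← h] at h2
    have h3 := x.proper.disjoint _ (x.σ i).2 _ (x.σ j).2
      fun he => hij (x.σ.injective (Subtype.ext he))
    exact Set.disjoint_left.1 h3 h1 h2
  att i h := congrArg Subtype.val ((x.φ i).att h)
  star i g v h := by
    have hg : G.att g ∈ G.verts (x.σ i).1.1 := (x.mem_verts i _).2 ⟨v, h.symm⟩
    obtain ⟨h', hh⟩ := (x.φ i).onH.surjective ⟨g, hg⟩
    exact ⟨h', congrArg Subtype.val hh⟩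
  vtype i v := (x.φ i).vtype v
  htype i h := (x.φ i).htype h
  line i h h' hl := (((x.φ i).line h h').2 hl).2.2
  ψV_inj := (flatV_injective x.σ).comp x.ψ.onV.symm.injective
  ψV_inl w := by
    constructor
    · rintro ⟨v, hv⟩ i u hu
      obtain ⟨hw, -⟩ := flatV_inl _ hv
      exact hw _ (x.σ i).2 ((x.mem_verts i w).2 ⟨u, hu⟩)
    · intro hw
      have hw' : ∀ c ∈ x.s, w ∉ G.verts c.1 := by
        intro c hc hcw
        obtain ⟨i, hi⟩ := x.σ.surjective ⟨c, hc⟩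
        have hi : (x.σ i).1 = c := congrArg Subtype.val hi
        rw [← hi] at hcw
        obtain ⟨u, hu⟩ := (x.mem_verts i w).1 hcw
        exact hw i u hu
      exact ⟨x.ψ.onV (.inl ⟨w, hw'⟩), congrArg (flatV x.σ) (x.ψ.onV.symm_apply_apply _)⟩
  ψV_inr i := by
    constructor
    · rintro ⟨v, hv⟩
      obtain ⟨hi, -⟩ := flatV_inr _ hv
      rw [← x.res_σ]
      exact hi.2
    · intro hi
      rw [← x.res_σ] at hi
      exact ⟨x.ψ.onV (.inr ⟨(x.σ i).1, (x.σ i).2, hi⟩),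
        (congrArg (flatV x.σ) (x.ψ.onV.symm_apply_apply _)).trans
          (congrArg Sum.inr (x.σ.symm_apply_apply i))⟩
  ψH_inj := Subtype.val_injective.comp x.ψ.onH.symm.injective
  ψH_range g := by
    constructor
    · rintro ⟨h, rfl⟩
      have h1 := (x.ψ.onH.symm h).2
      refine ⟨fun i h' hh' he => h1.1 _ (x.σ i).2 ?_, fun i hi v hv => ?_⟩
      · have h2 := (x.isInt_iff i h').1 hh'
        rwa [show ((x.φ i).onH h').1 = (x.ψ.onH.symm h).1 from he] at h2
      · exact h1.2 _ (x.σ i).2 (by rwa [x.res_σ]) ((x.mem_verts i _).2 ⟨v, hv⟩)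
    · rintro ⟨h1, h2⟩
      have hg : (∀ c ∈ x.s, g ∉ c.1) ∧ ∀ c ∈ x.s, c.2.isRight → G.att g ∉ G.verts c.1 := by
        refine ⟨fun c hc hg => ?_, fun c hc hr hg => ?_⟩ <;>
        obtain ⟨i, hi⟩ := x.σ.surjective ⟨c, hc⟩ <;>
        obtain rfl : (x.σ i).1 = c := congrArg Subtype.val hi
        · rw [← x.piece_eq] at hg
          obtain ⟨h, hh, he⟩ := hg
          exact h1 i h hh he
        · obtain ⟨v, hv⟩ := (x.mem_verts i _).1 hg
          rw [x.res_σ] at hr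
          exact h2 i hr v hv
      exact ⟨x.ψ.onH ⟨g, hg⟩, congrArg Subtype.val (x.ψ.onH.symm_apply_apply _)⟩
  attψ_inl h w hw := by
    obtain ⟨hw', he⟩ := flatV_inl _ hw
    rw [x.onV_symm_att] at he
    exact contract_att_inl he
  attψ_inr h i hi := by
    obtain ⟨hi', he⟩ := flatV_inr _ hi
    rw [x.onV_symm_att] at he
    exact (x.mem_verts i _).1 (contract_att_inr he)
  vtypeψ_inl v w hw := by
    obtain ⟨hw', he⟩ := flatV_inl _ hw
    exact ((congrArg S.Γ.vtype (x.ψ.onV.symm_apply_eq.1 he)).trans (x.ψ.vtype _)).symm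
  vtypeψ_inr v i hi := by
    obtain ⟨hi', he⟩ := flatV_inr _ hi
    have h := (congrArg S.Γ.vtype (x.ψ.onV.symm_apply_eq.1 he)).trans (x.ψ.vtype _)
    rw [← x.res_σ]
    exact (Sum.inl_getLeft _ hi'.2).symm.trans (congrArg Sum.inl h.symm)
  htypeψ h := by
    conv_rhs => rw [← x.ψ.onH.apply_symm_apply h, x.ψ.htype]
    rfl
  res := x.ψ.res

theorem isDec : x.frame.IsDec where
  toIsFrame := x.isFrame
  lineψ h h' := by
    rw [x.subs_eq]
    have := x.ψ.line (x.ψ.onH.symm h) (x.ψ.onH.symm h')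
    rw [Equiv.apply_symm_apply, Equiv.apply_symm_apply] at this
    exact this
  labelψ h a := by
    rw [x.subs_eq]
    have := x.ψ.label (x.ψ.onH.symm h) a
    rw [Equiv.apply_symm_apply] at this
    exact this

theorem frame_injective : Function.Injective (frame : SubDec S G → Frame S G) := by
  intro x y h
  have hs : x.s = y.s := by rw [← x.subs_eq, h, y.subs_eq]
  have hσ : ∀ i, (x.σ i).1 = (y.σ i).1 := fun i => by rw [← x.piece_eq, h, y.piece_eq]
  have hφV : ∀ i v, ((x.φ i).onV v).1 = ((y.φ i).onV v).1 := fun i v =>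
    congrFun (congrFun (congrArg Frame.φV h) i) v
  have hφH : ∀ i v, ((x.φ i).onH v).1 = ((y.φ i).onH v).1 := fun i v =>
    congrFun (congrFun (congrArg Frame.φH h) i) v
  have hψV : ∀ v, flatV x.σ (x.ψ.onV.symm v) = flatV y.σ (y.ψ.onV.symm v) := fun v =>
    congrFun (congrArg Frame.ψV h) v
  have hψH : ∀ v, (x.ψ.onH.symm v).1 = (y.ψ.onH.symm v).1 := fun v =>
    congrFun (congrArg Frame.ψH h) v
  clear h
  obtain ⟨s, hs1, l, σ, φ, ψ⟩ := x
  obtain ⟨s', hs1', l', σ', φ', ψ'⟩ := y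
  obtain rfl : s = s' := hs
  obtain rfl : σ = σ' := by
    ext i : 2
    exact hσ i
  obtain rfl : l = l' := by
    funext c
    obtain ⟨i, rfl⟩ := σ.surjective c
    apply Subtype.ext
    ext g : 1
    -- a leg of the component is an external half-line of `A i`, whose label it carries
    obtain ⟨k, hk⟩ := (φ i).onH.surjective ⟨g.1, g.2.2⟩
    have hk1 : ((φ i).onH k).1 = g.1 := by rw [hk]
    have hk2 : ((φ' i).onH k).1 = g.1 := by rw [← hφH, hk1]
    have hk' : (φ' i).onH k = ⟨g.1, g.2.2⟩ := Subtype.ext hk2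
    have h1 : (S.A i).line k (.inr ((l (σ i)).1 g).1) := by
      rw [← (φ i).label, hk]
      exact ⟨g.2, rfl⟩
    rw [← (φ' i).label, hk'] at h1
    obtain ⟨_, h2⟩ := h1
    exact Subtype.ext h2.symm
  obtain rfl : φ = φ' := by
    funext i
    refine Iso.ext ?_ ?_
    · ext v : 1
      exact Subtype.ext (hφV i v)
    · ext v : 1
      exact Subtype.ext (hφH i v)
  obtain rfl : ψ = ψ' := by
    refine Iso.ext ?_ ?_
    · rw [← Equiv.symm_bijective.injective.eq_iff]
      ext v : 1
      exact flatV_injective σ (hψV v)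
    · rw [← Equiv.symm_bijective.injective.eq_iff]
      ext v : 1
      exact Subtype.ext (hψH v)
  rfl

end SubDec

namespace Frame

variable {S : Setup T} {G : PreGraph T} {F : Frame S G}

/-- The image of a piece, with the labels of its external lines, is isomorphic to the piece. -/
theorem IsFrame.exists_sub_iso (hF : F.IsFrame) (hG : G.IsFeynman) (i : S.I) :
    ∃ (l : G.Labelling (F.piece i).1 (F.piece i).2)
      (f : Iso (S.A i) (G.sub (F.piece i).1 (F.piece i).2 l)),
      (∀ v, (f.onV v).1 = F.φV i v) ∧ ∀ h, (f.onH h).1 = F.φH i h := by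
  obtain ⟨q, hq⟩ := (S.fey i).nonempty_labelling
  let m : {h // ¬ (S.A i).IsInt h} → {g // g ∈ G.legs (F.piece i).1} :=
    fun h => ⟨F.φH i h.1, hF.mem_legs.2 ⟨h.1, h.2, rfl⟩⟩
  have hm : Function.Bijective m := by
    constructor
    · intro h h' he
      exact Subtype.ext (hF.φH_inj i (congrArg Subtype.val he))
    · rintro ⟨g, hg⟩
      obtain ⟨h, hh, rfl⟩ := hF.mem_legs.1 hg
      exact ⟨⟨h, hh⟩, rfl⟩
  let m' := Equiv.ofBijective m hm
  have hm' : ∀ h, m'.symm (m h) = h := fun h => m'.symm_apply_apply h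
  have hvert : ∀ v, F.φV i v ∈ G.verts (F.piece i).1 := fun v => by
    rw [hF.verts_piece]
    exact ⟨v, rfl⟩
  let l : G.Labelling (F.piece i).1 (F.piece i).2 := ⟨m'.symm.trans q.1, fun g => by
    obtain ⟨h, rfl⟩ := hm.2 g
    change (q.1 (m'.symm (m h))).1.1 = _
    rw [hm']
    exact (q.2 h).trans (hF.htype i h.1).symm⟩
  have hl : ∀ h, l.1 (m h) = q.1 h := fun h => congrArg q.1 (hm' h)
  refine ⟨l, ⟨Equiv.ofBijective (fun v => ⟨F.φV i v, hvert v⟩) ⟨?_, ?_⟩,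
    Equiv.ofBijective (fun h => ⟨F.φH i h, by rw [hF.att]; exact hvert _⟩) ⟨?_, ?_⟩, rfl, ?_, ?_,
    ?_, ?_, ?_⟩, fun v => rfl, fun h => rfl⟩
  · exact fun v v' h => hF.φV_inj i (congrArg Subtype.val h)
  · rintro ⟨w, hw⟩
    have hw' := hw
    rw [hF.verts_piece] at hw'
    obtain ⟨v, rfl⟩ := hw'
    exact ⟨v, rfl⟩
  · exact fun v v' h => hF.φH_inj i (congrArg Subtype.val h)
  · rintro ⟨g, hg⟩
    have hg' := hg
    rw [hF.verts_piece] at hg'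
    obtain ⟨v, hv⟩ := hg'
    obtain ⟨h, rfl⟩ := hF.star i g v hv.symm
    exact ⟨h, rfl⟩
  · exact fun h => Subtype.ext (hF.att i h)
  · exact fun v => hF.vtype i v
  · exact fun h => hF.htype i h
  · intro h h'
    constructor
    · rintro ⟨⟨k, ⟨k', hk⟩, he⟩, -, hl⟩
      obtain rfl := hF.φH_inj i he
      have := Sum.inl_injective (hG.line_right_unique hl (hF.line i _ _ hk))
      rwa [hF.φH_inj i this]
    · intro hl
      exact ⟨⟨h, ⟨h', hl⟩, rfl⟩, ⟨h', ⟨h, (S.fey i).line_symm _ _ hl⟩, rfl⟩, hF.line i _ _ hl⟩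
  · intro h a
    constructor
    · rintro ⟨hleg, he⟩
      obtain ⟨k, hk, hk'⟩ := hF.mem_legs.1 hleg
      obtain rfl := hF.φH_inj i hk'
      refine (hq ⟨k, hk⟩ a).2 ?_
      rw [← hl]
      exact he
    · intro hla
      have hh := (S.fey i).not_isInt hla
      refine ⟨hF.mem_legs.2 ⟨h, hh, rfl⟩, ?_⟩
      have h1 := (hq ⟨h, hh⟩ a).1 hla
      rw [← hl] at h1
      exact h1

/-- The contraction of the pieces is isomorphic to `Γ`. -/
theorem IsDec.exists_contract_iso (hF : F.IsDec) (σ : S.I ≃ {c // c ∈ F.subs})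
    (hσ : ∀ i, (σ i).1 = F.piece i) :
    ∃ f : Iso S.Γ (G.contract F.subs), (∀ v, flatV σ (f.onV v) = F.ψV v) ∧
      ∀ h, (f.onH h).1 = F.ψH h := by
  have hV : ∀ v, ∃ X : (G.contract F.subs).V, flatV σ X = F.ψV v := by
    intro v
    rcases hv : F.ψV v with w | i
    · refine ⟨.inl ⟨w, fun c hc => ?_⟩, rfl⟩
      obtain ⟨i, rfl⟩ := IsFrame.mem_subs.1 hc
      rw [hF.verts_piece]
      rintro ⟨u, hu⟩
      exact (hF.ψV_inl w).1 ⟨v, hv⟩ i u hu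
    · refine ⟨.inr ⟨(σ i).1, (σ i).2, ?_⟩, by simp [flatV]⟩
      rw [hσ]
      exact (hF.ψV_inr i).1 ⟨v, hv⟩
  choose onV hV using hV
  have hH : ∀ h, (∀ c ∈ F.subs, F.ψH h ∉ c.1) ∧
      ∀ c ∈ F.subs, c.2.isRight → G.att (F.ψH h) ∉ G.verts c.1 := by
    intro h
    obtain ⟨h1, h2⟩ := (hF.ψH_range _).1 ⟨h, rfl⟩
    refine ⟨fun c hc => ?_, fun c hc hr => ?_⟩ <;> obtain ⟨i, rfl⟩ := IsFrame.mem_subs.1 hc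
    · rintro ⟨k, hk, he⟩
      exact h1 i k hk he
    · rw [hF.verts_piece]
      rintro ⟨v, hv⟩
      exact h2 i hr v hv
  let onH : S.Γ.H → (G.contract F.subs).H := fun h => ⟨F.ψH h, hH h⟩
  have hVb : Function.Bijective onV := by
    constructor
    · intro v v' h
      apply hF.ψV_inj
      rw [← hV, h, hV]
    · rintro (⟨w, hw⟩ | ⟨c, hc, hc'⟩)
      · obtain ⟨v, hv⟩ := (hF.ψV_inl w).2 fun i u hu =>
          hw _ (IsFrame.mem_subs.2 ⟨i, rfl⟩) (by rw [hF.verts_piece]; exact ⟨u, hu⟩)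
        refine ⟨v, flatV_injective σ ?_⟩
        rw [hV, hv]
        rfl
      · obtain ⟨i, rfl⟩ := IsFrame.mem_subs.1 hc
        obtain ⟨v, hv⟩ := (hF.ψV_inr i).2 hc'
        refine ⟨v, flatV_injective σ ?_⟩
        rw [hV, hv]
        have : σ i = ⟨F.piece i, hc⟩ := Subtype.ext (hσ i)
        simp [flatV, ← this]
  have hHb : Function.Bijective onH := by
    constructor
    · exact fun h h' he => hF.ψH_inj (congrArg Subtype.val he)
    · rintro ⟨g, hg1, hg2⟩
      obtain ⟨h, rfl⟩ := (hF.ψH_range g).2 ⟨fun i h hh he =>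
          hg1 _ (IsFrame.mem_subs.2 ⟨i, rfl⟩) ⟨h, hh, he⟩, fun i hi v hv =>
          hg2 _ (IsFrame.mem_subs.2 ⟨i, rfl⟩) hi (by rw [hF.verts_piece]; exact ⟨v, hv⟩)⟩
      exact ⟨h, rfl⟩
  refine ⟨⟨Equiv.ofBijective onV hVb, Equiv.ofBijective onH hHb, hF.res.symm, ?_, ?_, ?_, ?_, ?_⟩,
    hV, fun h => rfl⟩
  · intro h
    change (G.contract F.subs).att (onH h) = onV (S.Γ.att h)
    apply flatV_injective σ
    rw [hV]
    rcases hw : F.ψV (S.Γ.att h) with w | i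
    · have h1 := hF.attψ_inl _ _ hw
      rcases hX : (G.contract F.subs).att (onH h) with X | c
      · have h2 := contract_att_inl hX
        rw [← h1]
        exact congrArg Sum.inl h2.symm
      · exfalso
        have h2 : G.att (F.ψH h) ∈ G.verts c.1.1 := contract_att_inr hX
        obtain ⟨c, hc, hc'⟩ := c
        obtain ⟨i, rfl⟩ := IsFrame.mem_subs.1 hc
        rw [hF.verts_piece, h1] at h2
        obtain ⟨u, hu⟩ := h2
        exact (hF.ψV_inl w).1 ⟨_, hw⟩ i u hu
    · obtain ⟨u, hu⟩ := hF.attψ_inr _ _ hw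
      rcases hX : (G.contract F.subs).att (onH h) with X | c
      · exfalso
        have h2 : G.att (F.ψH h) = X.1 := contract_att_inl hX
        refine X.2 _ (IsFrame.mem_subs.2 ⟨i, rfl⟩) ?_
        rw [hF.verts_piece, ← h2]
        exact ⟨u, hu⟩
      · have h2 : G.att (F.ψH h) ∈ G.verts c.1.1 := contract_att_inr hX
        obtain ⟨c, hc, hc'⟩ := c
        obtain ⟨j, rfl⟩ := IsFrame.mem_subs.1 hc
        rw [hF.verts_piece] at h2
        obtain ⟨u', hu'⟩ := h2
        obtain rfl := hF.disj _ _ _ _ (hu.trans hu'.symm)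
        have : σ i = ⟨F.piece i, hc⟩ := Subtype.ext (hσ i)
        simp [flatV, ← this]
  · intro v
    change (G.contract F.subs).vtype (onV v) = _
    rcases hX : onV v with w | c
    · have h1 := hV v
      rw [hX] at h1
      exact hF.vtypeψ_inl v w.1 h1.symm
    · have h1 := hV v
      rw [hX] at h1
      obtain ⟨c, hc, hc'⟩ := c
      have h2 := hF.vtypeψ_inr v _ h1.symm
      obtain ⟨i, rfl⟩ := IsFrame.mem_subs.1 hc
      have : σ i = ⟨F.piece i, hc⟩ := Subtype.ext (hσ i)
      have h3 : (S.A (σ.symm ⟨F.piece i, hc⟩)).res = .inl (S.Γ.vtype v) := h2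
      rw [← this, Equiv.symm_apply_apply] at h3
      have h3 : (F.piece i).2 = .inl (S.Γ.vtype v) := h3
      apply Sum.inl_injective (β := T.EType)
      rw [← h3]
      exact Sum.inl_getLeft _ _
  · exact fun h => hF.htypeψ h
  · exact fun h h' => (hF.lineψ h h').symm
  · exact fun h a => (hF.labelψ h a).symm

/-- Every decomposition comes from a subgraph. -/
theorem IsDec.exists_subDec [Nonempty S.I] (hF : F.IsDec) (hG : G.IsFeynman) :
    ∃ x : SubDec S G, x.frame = F := by
  have hσb : Function.Bijective
      fun i => (⟨F.piece i, IsFrame.mem_subs.2 ⟨i, rfl⟩⟩ : {c // c ∈ F.subs}) :=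
    ⟨fun i j h => hF.piece_injective (congrArg Subtype.val h), fun ⟨c, hc⟩ => by
      obtain ⟨i, rfl⟩ := IsFrame.mem_subs.1 hc
      exact ⟨i, rfl⟩⟩
  let σ : S.I ≃ {c // c ∈ F.subs} := Equiv.ofBijective _ hσb
  have hσ : ∀ i, (σ i).1 = F.piece i := fun i => rfl
  have hproper : G.IsProperSub F.subs := by
    refine ⟨?_, ?_, ?_, ?_⟩
    · obtain ⟨i⟩ := ‹Nonempty S.I›
      exact ⟨_, IsFrame.mem_subs.2 ⟨i, rfl⟩⟩
    · intro c hc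
      obtain ⟨i, rfl⟩ := IsFrame.mem_subs.1 hc
      obtain ⟨l, f, -⟩ := hF.exists_sub_iso hG i
      exact ⟨l, f.isOnePI (S.hA i)⟩
    · intro c hc c' hc' hne
      obtain ⟨i, rfl⟩ := IsFrame.mem_subs.1 hc
      obtain ⟨j, rfl⟩ := IsFrame.mem_subs.1 hc'
      rw [hF.verts_piece, hF.verts_piece, Set.disjoint_left]
      rintro _ ⟨v, rfl⟩ ⟨w, hw⟩
      exact hne (by rw [hF.disj _ _ _ _ hw])
    · obtain ⟨h, h', hl⟩ := S.hΓ.exists_isInt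
      have hnot : ∀ c ∈ F.subs, F.ψH h ∉ c.1 := by
        intro c hc hh
        obtain ⟨i, rfl⟩ := IsFrame.mem_subs.1 hc
        obtain ⟨k, hk, he⟩ := hh
        exact ((hF.ψH_range _).1 ⟨h, rfl⟩).1 i k hk he
      rw [hF.lineψ] at hl
      cases hl with
      | direct hl => exact ⟨_, _, hl, hnot⟩
      | through hl _ _ _ _ _ _ => exact ⟨_, _, hl, hnot⟩
  have hl : ∀ c : {c // c ∈ F.subs}, ∃ l : G.Labelling c.1.1 c.1.2, ∀ i, σ i = c →
      ∃ f : Iso (S.A i) (G.sub c.1.1 c.1.2 l),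
        (∀ v, (f.onV v).1 = F.φV i v) ∧ ∀ h, (f.onH h).1 = F.φH i h := by
    intro c
    obtain ⟨i, rfl⟩ := σ.surjective c
    obtain ⟨l, f, hf⟩ := hF.exists_sub_iso hG i
    refine ⟨l, fun j hj => ?_⟩
    obtain rfl := σ.injective hj
    exact ⟨f, hf⟩
  choose l hl using hl
  choose f hf using fun i => hl (σ i) i rfl
  obtain ⟨ψ, hψ1, hψ2⟩ := hF.exists_contract_iso σ hσ
  refine ⟨⟨F.subs, hproper, l, σ, f, ψ.symm⟩, Frame.ext ?_ ?_ ?_ ?_⟩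
  · funext i v
    exact (hf i).1 v
  · funext i h
    exact (hf i).2 h
  · funext v
    exact hψ1 v
  · funext h
    exact hψ2 h

/-- Subgraphs with identifications of the components and the contracted graph correspond to
decompositions. -/
theorem card_subDec (S : Setup T) [Nonempty S.I] {G : PreGraph T} (hG : G.IsFeynman) :
    Nat.card (SubDec S G) = Nat.card {F : Frame S G // F.IsDec} := by
  refine Nat.card_eq_of_bijective (fun x => ⟨x.frame, x.isDec⟩) ⟨?_, ?_⟩
  · exact fun x y h => SubDec.frame_injective (congrArg Subtype.val h)
  · rintro ⟨F, hF⟩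
    obtain ⟨x, rfl⟩ := hF.exists_subDec hG
    exact ⟨x, rfl⟩

end Frame

end Feynman

namespace Feynman

/-! ### Coefficients of the coproduct -/

variable {T : Theory}

open PreGraph MvPolynomial

section Setup

/-- A graph whose residue is an edge type has two external half-lines. -/
theorem PreGraph.IsFeynman.exists_leg {G : PreGraph T} (hG : G.IsFeynman) (hr : G.res.isRight) :
    ∃ leg : Bool → G.H, Function.Injective leg ∧ ∀ h, (∃ b, leg b = h) ↔ ¬ G.IsInt h := by
  obtain ⟨q, -⟩ := hG.nonempty_labelling
  have hc : Nat.card Bool = Nat.card {h // ¬ G.IsInt h} := by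
    rw [Nat.card_congr q.1, Nat.card_congr (Equiv.sigmaFiberEquiv (T.labelType G.res)).symm,
      Nat.card_sigma]
    simp only [Theory.card_labelType]
    rw [← Sum.inr_getRight _ hr, Nat.card_eq_fintype_card, Fintype.card_bool]
    simp only [Theory.N]
    rw [Finset.sum_eq_single (G.res.getRight hr), if_pos rfl]
    · exact fun e _ he => if_neg he.symm
    · exact fun h => absurd (Finset.mem_univ _) h
  obtain ⟨f⟩ := Finite.card_eq.1 hc
  refine ⟨fun b => (f b).1, Subtype.val_injective.comp f.injective, fun h => ?_⟩
  constructor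
  · rintro ⟨b, rfl⟩
    exact (f b).2
  · intro hh
    obtain ⟨b, hb⟩ := f.surjective ⟨h, hh⟩
    exact ⟨b, congrArg Subtype.val hb⟩

/-- The setup for the insertion of the 1PI graphs `a i` into `Γ`. -/
noncomputable def mkSetup (Γ : OnePI T) {I : Type} [Fintype I] (a : I → OnePI T) : Setup T where
  Γ := Γ.graph
  hΓ := Γ.isOnePI
  I := I
  A i := (a i).graph
  hA i := (a i).isOnePI
  leg i := ((a i.1).isOnePI.isFeynman.exists_leg i.2).choose
  leg_injective i := ((a i.1).isOnePI.isFeynman.exists_leg i.2).choose_spec.1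
  exists_leg_iff i := ((a i.1).isOnePI.isFeynman.exists_leg i.2).choose_spec.2

end Setup

section Coeff

variable (k : Type*) [Field k]

theorem tensorCoeff_tmul (μ ν : OnePI T →₀ ℕ) (p q : GraphAlg k T) :
    tensorCoeff k μ ν (p ⊗ₜ q) = coeff μ p * coeff ν q := by
  simp only [tensorCoeff, Module.Basis.coord_apply, Module.Basis.tensorProduct_repr_tmul_apply]
  rw [smul_eq_mul, mul_comm]
  rfl

theorem gen_of_isOnePI {G : PreGraph T} (hG : G.IsOnePI) : gen k G = X (OnePI.mk G hG) :=
  dif_pos hG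

theorem gen_of_not {G : PreGraph T} (hG : ¬ G.IsOnePI) : gen k G = 0 := dif_neg hG

/-- The coefficients of a generator count isomorphisms, up to the symmetry factor. -/
theorem coeff_gen (G : PreGraph T) (Γ : OnePI T) :
    coeff (Finsupp.single Γ 1) (gen k G) * Γ.symFactor = Nat.card (G.Iso Γ.graph) := by
  classical
  by_cases hG : G.IsOnePI
  · rw [gen_of_isOnePI k hG, coeff_X]
    by_cases h : OnePI.mk G hG = Γ
    · subst h
      obtain ⟨f⟩ := OnePI.eq_mk_iff.1 (rfl : OnePI.mk G hG = OnePI.mk G hG)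
      rw [if_pos rfl, one_mul, ← Nat.card_congr (Iso.symmEquiv (G := (OnePI.mk G hG).graph)),
        OnePI.card_iso f]
    · have : IsEmpty (G.Iso Γ.graph) := ⟨fun f => h (OnePI.eq_mk_iff.2 ⟨f.symm⟩).symm⟩
      rw [if_neg fun he => h (Finsupp.single_left_injective one_ne_zero he), zero_mul,
        Nat.card_of_isEmpty, Nat.cast_zero]
  · have : IsEmpty (G.Iso Γ.graph) := ⟨fun f => hG (f.symm.isOnePI Γ.isOnePI)⟩
    rw [gen_of_not k hG, coeff_zero, zero_mul, Nat.card_of_isEmpty, Nat.cast_zero]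

theorem coeff_gen_eq_zero (G : PreGraph T) {ν : OnePI T →₀ ℕ}
    (hν : ∀ Γ, ν ≠ Finsupp.single Γ 1) : coeff ν (gen k G) = 0 := by
  classical
  by_cases hG : G.IsOnePI
  · rw [gen_of_isOnePI k hG, coeff_X, if_neg fun h => hν _ h.symm]
  · rw [gen_of_not k hG, coeff_zero]

/-- A product of generators contains the monomial given by the family `a` if and only if its
factors can be matched with the graphs `a i`; the number of ways to match them, isomorphisms
included, is the order of the automorphism group of the family. -/
theorem coeff_prod_gen {I J : Type*} [Fintype I] [Fintype J] (a : I → OnePI T)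
    (B : J → PreGraph T) :
    coeff (∑ i, Finsupp.single (a i) 1) (∏ j, gen k (B j)) *
      (Nat.card (Σ π : Equiv.Perm I, ∀ i, (a i).graph.Iso (a (π i)).graph) : k) =
      Nat.card (Σ σ : I ≃ J, ∀ i, (a i).graph.Iso (B (σ i))) := by
  classical
  by_cases hB : ∀ j, (B j).IsOnePI
  · have hprod : ∏ j, gen k (B j) =
        monomial (∑ j, Finsupp.single (OnePI.mk (B j) (hB j)) 1) 1 := by
      rw [Finset.prod_congr rfl fun j _ => gen_of_isOnePI k (hB j), monomial_sum_one]
      rfl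
    rw [hprod, coeff_monomial]
    by_cases hσ : ∃ σ : I ≃ J, ∀ i, a i = OnePI.mk (B (σ i)) (hB (σ i))
    · obtain ⟨σ₀, hσ₀⟩ := hσ
      have g := fun i => (OnePI.eq_mk_iff.1 (hσ₀ i)).some
      rw [if_pos, one_mul]
      · congr 1
        exact Nat.card_congr (Equiv.sigmaCongr (Equiv.equivCongr (Equiv.refl I) σ₀)
          fun π => Equiv.piCongrRight fun i => Iso.congrRight (g (π i)))
      · rw [← Equiv.sum_comp σ₀]
        exact Finset.sum_congr rfl fun i _ => by rw [hσ₀]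
    · have hem : IsEmpty (Σ σ : I ≃ J, ∀ i, (a i).graph.Iso (B (σ i))) :=
        ⟨fun x => hσ ⟨x.1, fun i => OnePI.eq_mk_iff.2 ⟨x.2 i⟩⟩⟩
      rw [if_neg, zero_mul, Nat.card_of_isEmpty, Nat.cast_zero]
      intro he
      apply hσ
      obtain ⟨σ, h⟩ : Nonempty (TypedEquiv a fun j => OnePI.mk (B j) (hB j)) := by
        refine nonempty_typedEquiv fun e => ?_
        have := DFunLike.congr_fun he e
        simp only [Finsupp.coe_finsetSum, Finset.sum_apply, Finsupp.single_apply] at this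
        rw [Nat.card_eq_fintype_card, Nat.card_eq_fintype_card, Fintype.card_subtype,
          Fintype.card_subtype, Finset.card_filter, Finset.card_filter, this]
      exact ⟨σ, fun i => (h i).symm⟩
  · push Not at hB
    obtain ⟨j, hj⟩ := hB
    have hem : IsEmpty (Σ σ : I ≃ J, ∀ i, (a i).graph.Iso (B (σ i))) := by
      refine ⟨fun x => hj ?_⟩
      have := (x.2 (x.1.symm j)).isOnePI (a _).isOnePI
      rwa [Equiv.apply_symm_apply] at this
    rw [Finset.prod_eq_zero (Finset.mem_univ j) (gen_of_not k hj), coeff_zero, zero_mul,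
      Nat.card_of_isEmpty, Nat.cast_zero]

/-- The order of the automorphism group of a family of 1PI graphs. -/
noncomputable def familySym {I : Type*} (a : I → OnePI T) : ℕ :=
  Nat.card (Σ π : Equiv.Perm I, ∀ i, (a i).graph.Iso (a (π i)).graph)

theorem familySym_pos {I : Type*} [Finite I] (a : I → OnePI T) : 0 < familySym a := by
  have : Nonempty (Σ π : Equiv.Perm I, ∀ i, (a i).graph.Iso (a (π i)).graph) :=
    ⟨⟨1, fun i => Iso.refl _⟩⟩
  exact Nat.card_pos

variable [CharZero k]

/-- The coefficient of the product of the components of a subgraph. -/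
theorem coeff_prod_pieceElt {I : Type*} [Fintype I] (a : I → OnePI T) (G : PreGraph T)
    (s : Finset G.Piece) :
    coeff (∑ i, Finsupp.single (a i) 1) (∏ c ∈ s, pieceElt k G c) *
      (familySym a * ∏ i, (T.permCount (a i).res : k)) =
      Nat.card (Σ l : ∀ c : {c // c ∈ s}, G.Labelling c.1.1 c.1.2, Σ σ : I ≃ {c // c ∈ s},
        ∀ i, (a i).graph.Iso (G.sub (σ i).1.1 (σ i).1.2 (l (σ i)))) := by
  classical
  have hfin : ∀ c : {c // c ∈ s}, Fintype (G.Labelling c.1.1 c.1.2) := fun c => Fintype.ofFinite _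
  rw [Nat.card_sigma, ← Finset.prod_coe_sort]
  simp only [pieceElt, finsum_eq_sum_of_fintype]
  rw [Finset.prod_smul, Finset.prod_univ_sum, Fintype.piFinset_univ, coeff_smul, smul_eq_mul,
    coeff_sum, mul_assoc, Finset.sum_mul, Finset.mul_sum, Nat.cast_sum]
  refine Finset.sum_congr rfl fun l _ => ?_
  rw [← mul_assoc (coeff _ _), familySym, coeff_prod_gen]
  by_cases hem : IsEmpty (Σ σ : I ≃ {c // c ∈ s},
      ∀ i, (a i).graph.Iso (G.sub (σ i).1.1 (σ i).1.2 (l (σ i))))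
  · rw [Nat.card_of_isEmpty]
    simp
  · rw [not_isEmpty_iff] at hem
    obtain ⟨σ, φ⟩ := hem
    have h1 : ∏ i, (T.permCount (a i).res : k) =
        ∏ c : {c // c ∈ s}, (Nat.card (G.Labelling c.1.1 c.1.2) : k) := by
      rw [← Equiv.prod_comp σ]
      refine Finset.prod_congr rfl fun i _ => ?_
      rw [card_labelling (l (σ i))]
      congr 2
      exact (φ i).res
    have h2 : ∏ c : {c // c ∈ s}, (Nat.card (G.Labelling c.1.1 c.1.2) : k) ≠ 0 := by
      refine Finset.prod_ne_zero_iff.2 fun c _ => ?_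
      rw [card_labelling (l c)]
      exact Nat.cast_ne_zero.2 (Theory.permCount_pos _).ne'
    rw [h1, Finset.prod_inv_distrib]
    field_simp

/-- The part of the coefficients of the coproduct which comes from the proper subgraphs. -/
noncomputable def subCoeff (μ ν : OnePI T →₀ ℕ) (G : PreGraph T) : k :=
  ∑ᶠ s ∈ {s : Finset G.Piece | G.IsProperSub s},
    coeff μ (∏ c ∈ s, pieceElt k G c) * coeff ν (gen k (G.contract s))

omit [CharZero k] in
theorem tensorCoeff_coproductGen (μ ν : OnePI T →₀ ℕ) (Γ : OnePI T) :
    tensorCoeff k μ ν (coproductGen k Γ) =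
      coeff μ (X Γ : GraphAlg k T) * coeff ν (1 : GraphAlg k T) +
      coeff μ (1 : GraphAlg k T) * coeff ν (X Γ : GraphAlg k T) + subCoeff k μ ν Γ.graph := by
  rw [coproductGen, map_add, map_add, tensorCoeff_tmul, tensorCoeff_tmul, subCoeff,
    ← LinearMap.toAddMonoidHom_coe, AddMonoidHom.map_finsum_mem _ _ (Set.toFinite _)]
  simp only [LinearMap.toAddMonoidHom_coe, tensorCoeff_tmul]

/-- After removal of the denominators, a coefficient of the coproduct counts subgraphs together with
identifications of the components and of the contracted graph. -/
theorem subCoeff_mul {I : Type} [Fintype I] (a : I → OnePI T) (Γ : OnePI T) (G : PreGraph T) :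
    subCoeff k (∑ i, Finsupp.single (a i) 1) (Finsupp.single Γ 1) G *
      (familySym a * Γ.symFactor * ∏ i, (T.permCount (a i).res : k)) =
      Nat.card (SubDec (mkSetup Γ a) G) := by
  classical
  have e : SubDec (mkSetup Γ a) G ≃ Σ s : {s : Finset G.Piece | G.IsProperSub s},
      (Σ l : ∀ c : {c // c ∈ s.1}, G.Labelling c.1.1 c.1.2, Σ σ : I ≃ {c // c ∈ s.1},
        ∀ i, (a i).graph.Iso (G.sub (σ i).1.1 (σ i).1.2 (l (σ i)))) ×
      (G.contract s.1).Iso Γ.graph :=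
    { toFun := fun x => ⟨⟨x.s, x.proper⟩, ⟨x.l, x.σ, x.φ⟩, x.ψ⟩
      invFun := fun y => ⟨y.1.1, y.1.2, y.2.1.1, y.2.1.2.1, y.2.1.2.2, y.2.2⟩
      left_inv := fun _ => rfl
      right_inv := fun _ => rfl }
  have : Fintype {s : Finset G.Piece | G.IsProperSub s} := Fintype.ofFinite _
  rw [Nat.card_congr e, Nat.card_sigma, subCoeff,
    ← finsum_set_coe_eq_finsum_mem, finsum_eq_sum_of_fintype, Finset.sum_mul, Nat.cast_sum]
  refine Finset.sum_congr rfl fun s _ => ?_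
  rw [Nat.card_prod, Nat.cast_mul, ← coeff_prod_pieceElt, ← coeff_gen]
  ring

end Coeff

end Feynman

namespace Feynman

/-! ### Summation over all graphs -/

variable {T : Theory}

open PreGraph MvPolynomial

section Family

open Classical in
/-- The components of a disjoint union, numbered. -/
noncomputable def components (γ : Multiset (OnePI T)) (i : Fin (Fintype.card γ.ToType)) : OnePI T :=
  ((Fintype.equivFin γ.ToType).symm i).1

theorem sum_components {M : Type*} [AddCommMonoid M] (γ : Multiset (OnePI T)) (f : OnePI T → M) :
    ∑ i, f (components γ i) = (γ.map f).sum := by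
  classical
  rw [← Multiset.map_univ γ f]
  exact Equiv.sum_comp (Fintype.equivFin γ.ToType).symm fun x => f x.1

theorem sum_single_components [DecidableEq (OnePI T)] (γ : Multiset (OnePI T)) :
    ∑ i, Finsupp.single (components γ i) 1 = Multiset.toFinsupp γ := by
  rw [sum_components γ fun Γ => Finsupp.single Γ 1]
  induction γ using Multiset.induction_on with
  | empty => simp
  | cons Γ γ ih =>
    rw [Multiset.map_cons, Multiset.sum_cons, ih, ← Multiset.singleton_add, map_add,
      Multiset.toFinsupp_singleton]

/-- Renumbering a family. -/
theorem familySym_comp {I I' : Type*} (ε : I ≃ I') (a : I' → OnePI T) :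
    familySym (fun i => a (ε i)) = familySym a := by
  refine (Nat.card_congr (Equiv.sigmaCongr (Equiv.equivCongr ε.symm ε.symm) fun π => ?_)).symm
  refine (Equiv.piCongrLeft' (fun i' => (a i').graph.Iso (a (π i')).graph) ε.symm).trans
    (Equiv.piCongrRight fun i => ?_)
  have : ε (Equiv.equivCongr ε.symm ε.symm π i) = π (ε i) := by simp [Equiv.equivCongr]
  exact Equiv.cast (congrArg (fun i' => (a (ε i)).graph.Iso (a i').graph) this.symm)

theorem familySym_components (γ : Multiset (OnePI T)) :
    familySym (components γ) = unionSymFactor γ := by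
  classical
  exact familySym_comp (Fintype.equivFin γ.ToType).symm fun i => i.1

theorem num_components (Γ : OnePI T) (γ : Multiset (OnePI T)) (r : T.Residue) :
    (mkSetup Γ (components γ)).num r = unionMult γ r := by
  classical
  have h := sum_components γ fun c => if c.res = r then 1 else 0
  rw [Setup.num]
  change Nat.card {i // (components γ i).res = r} = _
  rw [Nat.card_eq_fintype_card, Fintype.card_subtype, Finset.card_filter, h, unionMult]
  clear h
  induction γ using Multiset.induction_on with
  | empty => simp
  | cons c γ ih =>
    rw [Multiset.map_cons, Multiset.sum_cons, ih, Multiset.countP_cons, add_comm]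

/-- The number of gluings in terms of the number of insertion places. -/
theorem card_gluing_components (Γ : OnePI T) (γ : Multiset (OnePI T)) (r : T.Residue) :
    Nat.card (Gluing (mkSetup Γ (components γ))) =
      ins r (some Γ) γ * ∏ i, T.permCount (components γ i).res := by
  rw [Setup.card_gluing]
  simp only [num_components]
  rfl

theorem unionSymFactor_pos (γ : Multiset (OnePI T)) : 0 < unionSymFactor γ := by
  rw [← familySym_components]
  exact familySym_pos _

theorem unionSymFactor_zero : unionSymFactor (0 : Multiset (OnePI T)) = 1 := by
  classical
  rw [← familySym_components, familySym, Nat.card_eq_one_iff_unique]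
  have : IsEmpty (Fin (Fintype.card (0 : Multiset (OnePI T)).ToType)) := by
    rw [Multiset.card_coe]
    exact Fin.isEmpty
  exact ⟨⟨fun x y => by
    obtain ⟨π, f⟩ := x
    obtain ⟨π', f'⟩ := y
    obtain rfl : π = π' := Subsingleton.elim _ _
    obtain rfl : f = f' := Subsingleton.elim _ _
    rfl⟩, ⟨⟨1, isEmptyElim⟩⟩⟩

theorem unionSymFactor_singleton (Γ : OnePI T) : unionSymFactor {Γ} = Γ.symFactor := by
  classical
  have hc : Fintype.card ({Γ} : Multiset (OnePI T)).ToType = 1 := by simp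
  have hΓ : ∀ i, components {Γ} i = Γ := by
    intro i
    have hi := ((Fintype.equivFin ({Γ} : Multiset (OnePI T)).ToType).symm i).2
    exact Multiset.mem_singleton.1 (Multiset.count_pos.1 (hi.pos))
  rw [← familySym_components, ← familySym_comp (finCongr hc).symm]
  simp only [hΓ]
  rw [familySym, OnePI.symFactor]
  refine Nat.card_congr ⟨fun x => x.2 0, fun f => ⟨1, fun _ => f⟩, fun x => ?_, fun f => rfl⟩
  obtain ⟨π, f⟩ := x
  obtain rfl : 1 = π := Subsingleton.elim _ _
  refine congrArg (Sigma.mk 1) (funext fun i => ?_)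
  rw [Subsingleton.elim i 0]

end Family

section Glue

/-- The isomorphism class of a glued graph. -/
noncomputable def Gluing.cls {S : Setup T} (d : Gluing S) : OnePI T :=
  OnePI.mk d.glue d.glue_isOnePI

theorem Gluing.res_cls {S : Setup T} (d : Gluing S) : d.cls.res = S.Γ.res := by
  obtain ⟨f⟩ := OnePI.eq_mk_iff.1 (rfl : d.cls = OnePI.mk d.glue d.glue_isOnePI)
  exact f.res

theorem Gluing.loops_cls {S : Setup T} (d : Gluing S) :
    d.cls.loops = S.Γ.loops + ∑ i, (S.A i).loops := by
  obtain ⟨f⟩ := OnePI.eq_mk_iff.1 (rfl : d.cls = OnePI.mk d.glue d.glue_isOnePI)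
  rw [← d.glue_loops, ← f.symm.loops_eq d.glue_isFeynman]
  rfl

open Classical in
/-- The subgraphs of `Γ'` with the given components and the given contraction, together with the
identifications, are counted by the gluings which result in `Γ'`. -/
theorem card_subDec_eq_sum (S : Setup T) [Nonempty S.I] [Fintype (Gluing S)] (Γ' : OnePI T) :
    Nat.card (SubDec S Γ'.graph) =
      (∑ d : Gluing S, if Γ' = d.cls then 1 else 0) * Γ'.symFactor := by
  rw [Frame.card_subDec S Γ'.isOnePI.isFeynman, Frame.card_isDec S Γ'.isOnePI, Nat.card_sigma,
    Finset.sum_mul]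
  refine Finset.sum_congr rfl fun d _ => ?_
  split_ifs with h
  · obtain ⟨f⟩ := OnePI.eq_mk_iff.1 (show Γ' = OnePI.mk d.glue d.glue_isOnePI from h)
    rw [one_mul, ← OnePI.card_iso f]
    exact Nat.card_congr (Iso.symmEquiv)
  · rw [zero_mul, Nat.card_eq_zero]
    exact .inl ⟨fun f => h (OnePI.eq_mk_iff.2 ⟨f.symm⟩)⟩

end Glue

section Coeff

variable (k : Type*) [Field k] [CharZero k]

open Classical in
/-- The coefficients which come from proper subgraphs count gluings. There is no contribution of the
empty union, since the subgraphs are nonempty. -/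
theorem subCoeff_eq (Γ Γ' : OnePI T) (γ : Multiset (OnePI T))
    [Fintype (Gluing (mkSetup Γ (components γ)))] :
    subCoeff k (Multiset.toFinsupp γ) (Finsupp.single Γ 1) Γ'.graph =
      (if γ = 0 then 0 else ∑ d : Gluing (mkSetup Γ (components γ)), if Γ' = d.cls then 1 else 0) *
        Γ'.symFactor /
        (unionSymFactor γ * Γ.symFactor * ∏ i, (T.permCount (components γ i).res : k)) := by
  have hne :
      (unionSymFactor γ * Γ.symFactor * ∏ i, (T.permCount (components γ i).res : k)) ≠ 0 := by
    refine mul_ne_zero (mul_ne_zero ?_ ?_) (Finset.prod_ne_zero_iff.2 fun i _ => ?_)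
    · exact Nat.cast_ne_zero.2 (unionSymFactor_pos γ).ne'
    · exact Nat.cast_ne_zero.2 Γ.symFactor_pos.ne'
    · exact Nat.cast_ne_zero.2 (Theory.permCount_pos _).ne'
  rw [eq_div_iff hne, ← familySym_components, ← sum_single_components, subCoeff_mul]
  split_ifs with hγ
  · subst hγ
    have hem : IsEmpty (Fin (Fintype.card (0 : Multiset (OnePI T)).ToType)) := by
      rw [Multiset.card_coe]
      exact Fin.isEmpty
    rw [zero_mul, Nat.cast_eq_zero, Nat.card_eq_zero]
    refine .inl ⟨fun x => ?_⟩
    obtain ⟨c, hc⟩ := x.proper.nonempty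
    exact hem.elim (x.σ.symm ⟨c, hc⟩)
  · have : Nonempty (mkSetup Γ (components γ)).I := by
      obtain ⟨c, hc⟩ := Multiset.exists_mem_of_ne_zero hγ
      exact ⟨Fintype.equivFin _ ⟨c, ⟨0, Multiset.count_pos.2 hc⟩⟩⟩
    rw [card_subDec_eq_sum]
    push_cast
    rfl

omit [CharZero k] in
theorem subCoeff_eq_zero {μ ν : OnePI T →₀ ℕ} (hν : ∀ Γ, ν ≠ Finsupp.single Γ 1) (G : PreGraph T) :
    subCoeff k μ ν G = 0 := by
  simp only [subCoeff, coeff_gen_eq_zero k _ hν, mul_zero, finsum_zero]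

open Classical in
omit [CharZero k] in
theorem unionElt_eq (γ : Multiset (OnePI T)) :
    unionElt k γ = monomial (Multiset.toFinsupp γ) 1 := by
  rw [unionElt]
  induction γ using Multiset.induction_on with
  | empty => simp
  | cons Γ γ ih =>
    rw [Multiset.map_cons, Multiset.prod_cons, ih, ← Multiset.singleton_add Γ γ, map_add,
      Multiset.toFinsupp_singleton, X, monomial_mul, one_mul]

/-- The exponent of a 1PI graph or of the empty graph. -/
noncomputable def graphExp : Option (OnePI T) → OnePI T →₀ ℕ
  | none => 0
  | some Γ => Finsupp.single Γ 1

theorem graphExp_injective : Function.Injective (graphExp : Option (OnePI T) → _) := by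
  rintro (_ | Γ) (_ | Γ') h
  · rfl
  · exact absurd h.symm (by simp [graphExp])
  · exact absurd h (by simp [graphExp])
  · rw [Finsupp.single_left_injective one_ne_zero h]

omit [CharZero k] in
theorem graphElt_eq (x : Option (OnePI T)) : graphElt k x = monomial (graphExp x) 1 := by
  rcases x with _ | Γ <;> rfl

open Classical in
omit [CharZero k] in
theorem tensorCoeff_rhs (μ ν : OnePI T →₀ ℕ) (p : Multiset (OnePI T) × Option (OnePI T)) :
    tensorCoeff k μ ν (unionElt k p.1 ⊗ₜ[k] graphElt k p.2) =
      if p.1 = Finsupp.toMultiset μ ∧ graphExp p.2 = ν then 1 else 0 := by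
  rw [tensorCoeff_tmul, unionElt_eq, graphElt_eq, coeff_monomial, coeff_monomial]
  have : Multiset.toFinsupp p.1 = μ ↔ p.1 = Finsupp.toMultiset μ :=
    Multiset.toFinsupp.toEquiv.eq_symm_apply.symm
  simp only [this, ite_and, ite_mul, one_mul, zero_mul]

open Classical in
omit [CharZero k] in
theorem tensorCoeff_lhs_some (μ ν : OnePI T →₀ ℕ) (Γ : OnePI T) :
    tensorCoeff k μ ν (coproduct k T (graphElt k (some Γ))) =
      (if Finsupp.single Γ 1 = μ ∧ ν = 0 then 1 else 0) +
      (if μ = 0 ∧ Finsupp.single Γ 1 = ν then 1 else 0) + subCoeff k μ ν Γ.graph := by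
  have h : coproduct k T (graphElt k (some Γ)) = coproductGen k Γ := by
    rw [coproduct, graphElt, aeval_X]
  rw [h, tensorCoeff_coproductGen, coeff_X, coeff_X, coeff_one, coeff_one]
  simp only [ite_and, ite_mul, one_mul, zero_mul, eq_comm (a := (0 : OnePI T →₀ ℕ))]

open Classical in
omit [CharZero k] in
theorem tensorCoeff_lhs_none (μ ν : OnePI T →₀ ℕ) :
    tensorCoeff k μ ν (coproduct k T (graphElt k none)) = if μ = 0 ∧ ν = 0 then 1 else 0 := by
  rw [graphElt, map_one, Algebra.TensorProduct.one_def, tensorCoeff_tmul, coeff_one, coeff_one]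
  simp only [ite_and, ite_mul, one_mul, zero_mul, eq_comm (a := (0 : OnePI T →₀ ℕ))]

end Coeff

end Feynman

namespace Feynman

/-! ### The identity of coefficients -/

section Finsum

open Classical in
theorem finsum_mem_mul_ite_eq {α R : Type*} [DecidableEq α] [NonAssocSemiring R]
    (S : Set α) (c : α → R) (q : α) :
    ∑ᶠ p ∈ S, c p * (if p = q then 1 else 0) = if q ∈ S then c q else 0 := by
  rw [finsum_mem_def, finsum_eq_single _ q fun p hp => ?_]
  · simp [Set.indicator_apply]
  · simp [Set.indicator_apply, hp]

open Classical in
theorem finsum_mem_sum_ite_eq {α D R : Type*} [DecidableEq α] [AddCommMonoid R] [Fintype D]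
    (S : Set α) (c : R)
    (m : D → α) :
    ∑ᶠ x ∈ S, ∑ d, (if x = m d then c else 0) = ∑ d, if m d ∈ S then c else 0 := by
  have h : ∀ x, S.indicator (fun x => ∑ d, if x = m d then c else 0) x =
      ∑ d, if x = m d ∧ m d ∈ S then c else 0 := by
    intro x
    by_cases hx : x ∈ S
    · rw [Set.indicator_of_mem hx]
      refine Finset.sum_congr rfl fun d _ => ?_
      by_cases hd : x = m d
      · subst hd
        simp [hx]
      · simp [hd]
    · rw [Set.indicator_of_notMem hx]
      refine (Finset.sum_eq_zero fun d _ => if_neg ?_).symm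
      rintro ⟨rfl, hd⟩
      exact hx hd
  rw [finsum_mem_def]
  simp only [h]
  rw [finsum_sum_comm]
  · refine Finset.sum_congr rfl fun d _ => ?_
    rw [finsum_eq_single _ (m d) fun x hx => if_neg fun h => hx h.1]
    simp
  · refine fun d _ => (Set.finite_singleton (m d)).subset fun x hx => ?_
    by_contra hne
    exact hx (if_neg fun h => hne h.1)

end Finsum

variable {T : Theory}

theorem some_mem_graphsAt {r : T.Residue} {L : ℕ} {Γ : OnePI T} :
    some Γ ∈ graphsAt T r L ↔ Γ.res = r ∧ Γ.loops = L := by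
  simp [graphsAt]

theorem none_mem_graphsAt {r : T.Residue} {L : ℕ} : none ∈ graphsAt T r L ↔ L = 0 := by
  simp [graphsAt]

section Coeff

variable (k : Type*) [Field k]

open Classical in
/-- Among the insertions at most one term contributes to a given coefficient. -/
theorem sum_insertions_eq (r : T.Residue) (L : ℕ) (μ ν : OnePI T →₀ ℕ) {y : Option (OnePI T)}
    (hy : graphExp y = ν) :
    ∑ K ∈ Finset.range (L + 1), ∑ᶠ p ∈ unionsAt T K ×ˢ graphsAt T r (L - K),
          ((ins r p.2 p.1 : k) / (unionSymFactor p.1 * symFactor p.2)) *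
            tensorCoeff k μ ν (unionElt k p.1 ⊗ₜ[k] graphElt k p.2) =
      if unionLoops (Finsupp.toMultiset μ) ≤ L ∧
          y ∈ graphsAt T r (L - unionLoops (Finsupp.toMultiset μ)) then
        (ins r y (Finsupp.toMultiset μ) : k) /
          (unionSymFactor (Finsupp.toMultiset μ) * symFactor y) else 0 := by
  have h : ∀ p : Multiset (OnePI T) × Option (OnePI T),
      tensorCoeff k μ ν (unionElt k p.1 ⊗ₜ[k] graphElt k p.2) =
        if p = (Finsupp.toMultiset μ, y) then 1 else 0 := by
    intro p
    rw [tensorCoeff_rhs]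
    refine if_congr ?_ rfl rfl
    rw [← hy, Prod.ext_iff, graphExp_injective.eq_iff]
  simp only [h]
  have h' : ∀ K, ∑ᶠ p ∈ unionsAt T K ×ˢ graphsAt T r (L - K),
      ((ins r p.2 p.1 : k) / (unionSymFactor p.1 * symFactor p.2)) *
        (if p = (Finsupp.toMultiset μ, y) then 1 else 0) =
      if K = unionLoops (Finsupp.toMultiset μ) then
        (if y ∈ graphsAt T r (L - unionLoops (Finsupp.toMultiset μ)) then
        (ins r y (Finsupp.toMultiset μ) : k) /
          (unionSymFactor (Finsupp.toMultiset μ) * symFactor y) else 0) else 0 := by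
    intro K
    rw [finsum_mem_mul_ite_eq _
      fun p : Multiset (OnePI T) × Option (OnePI T) =>
        ((ins r p.2 p.1 : k) / (unionSymFactor p.1 * symFactor p.2))]
    by_cases hK : K = unionLoops (Finsupp.toMultiset μ)
    · subst hK
      simp [unionsAt]
    · rw [if_neg hK, if_neg]
      rintro ⟨h1, -⟩
      exact hK h1.symm
  simp only [h']
  rw [Finset.sum_ite_eq']
  simp only [Finset.mem_range, Nat.lt_succ_iff, ite_and]

theorem sum_insertions_eq_zero (r : T.Residue) (L : ℕ) (μ ν : OnePI T →₀ ℕ)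
    (hν : ∀ y, graphExp y ≠ ν) :
    ∑ K ∈ Finset.range (L + 1), ∑ᶠ p ∈ unionsAt T K ×ˢ graphsAt T r (L - K),
          ((ins r p.2 p.1 : k) / (unionSymFactor p.1 * symFactor p.2)) *
            tensorCoeff k μ ν (unionElt k p.1 ⊗ₜ[k] graphElt k p.2) = 0 := by
  classical
  refine Finset.sum_eq_zero fun K _ => finsum_mem_eq_zero_of_forall_eq_zero fun p _ => ?_
  rw [tensorCoeff_rhs, if_neg fun h => hν _ h.2, mul_zero]

variable [CharZero k]

/-- The coefficients at `μ ⊗ 1`: they come from the terms `Γ ⊗ 1` and from the empty graph. -/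
theorem coeff_identity_zero (r : T.Residue) (L : ℕ) (μ : OnePI T →₀ ℕ) :
    ∑ᶠ Γ ∈ graphsAt T r L,
        (symFactor Γ : k)⁻¹ * tensorCoeff k μ 0 (coproduct k T (graphElt k Γ)) =
      ∑ K ∈ Finset.range (L + 1), ∑ᶠ p ∈ unionsAt T K ×ˢ graphsAt T r (L - K),
          ((ins r p.2 p.1 : k) / (unionSymFactor p.1 * symFactor p.2)) *
            tensorCoeff k μ 0 (unionElt k p.1 ⊗ₜ[k] graphElt k p.2) := by
  classical
  have h : ∀ x : Option (OnePI T), tensorCoeff k μ 0 (coproduct k T (graphElt k x)) =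
      if graphExp x = μ then 1 else 0 := by
    rintro (_ | Γ)
    · rw [tensorCoeff_lhs_none]
      simp [graphExp, eq_comm]
    · rw [tensorCoeff_lhs_some, subCoeff_eq_zero k fun Γ' h => by simpa using h.symm,
        if_neg (c := μ = 0 ∧ _) fun h => by simp at h, add_zero, add_zero]
      exact if_congr (and_iff_left rfl) rfl rfl
  rw [sum_insertions_eq k r L μ 0 (y := none) rfl]
  simp only [h]
  by_cases hμ : ∃ x, graphExp x = μ
  · obtain ⟨x, rfl⟩ := hμ
    have h' : ∀ y : Option (OnePI T), (if graphExp y = graphExp x then 1 else 0 : k) =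
        if y = x then 1 else 0 := fun y => if_congr graphExp_injective.eq_iff rfl rfl
    simp only [h']
    rw [finsum_mem_mul_ite_eq _ fun x => (symFactor x : k)⁻¹]
    rcases x with _ | Γ
    · simp [graphExp, none_mem_graphsAt, unionLoops, unionSymFactor_zero, ins, symFactor]
    · have : Finsupp.toMultiset (graphExp (some Γ)) = {Γ} := by simp [graphExp]
      rw [this, some_mem_graphsAt, none_mem_graphsAt]
      simp [unionLoops, unionSymFactor_singleton, ins, symFactor]
      have hL : Γ.loops ≤ L ∧ L - Γ.loops = 0 ↔ Γ.loops = L := by omega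
      simp only [hL]
      split_ifs <;> simp_all
  · rw [not_exists] at hμ
    rw [finsum_mem_eq_zero_of_forall_eq_zero fun x _ => by rw [if_neg (hμ x), mul_zero]]
    symm
    have h0 : ins r none (Finsupp.toMultiset μ) = 0 := if_neg ?_
    · rw [h0, Nat.cast_zero, zero_div, ite_self]
    rintro (h0 | ⟨c, hc, -⟩)
    · rw [Finsupp.toMultiset_eq_iff, map_zero] at h0
      exact hμ none h0.symm
    · rw [Finsupp.toMultiset_eq_iff, Multiset.toFinsupp_singleton] at hc
      exact hμ (some c) hc.symm

/-- The coefficients at `μ ⊗ Γ`: after summation over all graphs, the left-hand side counts the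
gluings which insert the components of `μ` into `Γ`. -/
theorem coeff_identity_single (r : T.Residue) (L : ℕ) (μ : OnePI T →₀ ℕ) (Γ : OnePI T) :
    ∑ᶠ x ∈ graphsAt T r L, (symFactor x : k)⁻¹ *
        tensorCoeff k μ (Finsupp.single Γ 1) (coproduct k T (graphElt k x)) =
      ∑ K ∈ Finset.range (L + 1), ∑ᶠ p ∈ unionsAt T K ×ˢ graphsAt T r (L - K),
          ((ins r p.2 p.1 : k) / (unionSymFactor p.1 * symFactor p.2)) *
            tensorCoeff k μ (Finsupp.single Γ 1) (unionElt k p.1 ⊗ₜ[k] graphElt k p.2) := by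
  classical
  refine Eq.trans ?_ (sum_insertions_eq k r L μ _ (y := some Γ) rfl).symm
  obtain ⟨γ, rfl⟩ := Multiset.toFinsupp.surjective μ
  rw [Multiset.toFinsupp_toMultiset]
  have := Fintype.ofFinite (Gluing (mkSetup Γ (components γ)))
  rw [some_mem_graphsAt, symFactor]
  by_cases hγ : γ = 0
  · subst hγ
    have h : ∀ x : Option (OnePI T), tensorCoeff k (Multiset.toFinsupp 0) (Finsupp.single Γ 1)
        (coproduct k T (graphElt k x)) = if x = some Γ then 1 else 0 := by
      rintro (_ | Γ')
      · rw [tensorCoeff_lhs_none]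
        simp
      · rw [tensorCoeff_lhs_some, subCoeff_eq]
        simp [Finsupp.single_left_inj]
    simp only [h]
    rw [finsum_mem_mul_ite_eq _ fun x => (symFactor x : k)⁻¹, some_mem_graphsAt]
    simp [unionLoops, unionSymFactor_zero, symFactor, ins, unionMult]
  · set P : k := ∏ i, (T.permCount (components γ i).res : k) with hP
    have hP0 : P ≠ 0 := Finset.prod_ne_zero_iff.2 fun i _ =>
      Nat.cast_ne_zero.2 (Theory.permCount_pos _).ne'
    have h : ∀ x : Option (OnePI T), (symFactor x : k)⁻¹ * tensorCoeff k (Multiset.toFinsupp γ)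
        (Finsupp.single Γ 1) (coproduct k T (graphElt k x)) =
        ∑ d : Gluing (mkSetup Γ (components γ)), if x = some d.cls then
          (unionSymFactor γ * Γ.symFactor * P)⁻¹ else 0 := by
      rintro (_ | Γ')
      · rw [tensorCoeff_lhs_none]
        simp
      · have hs : (Γ'.symFactor : k) ≠ 0 := Nat.cast_ne_zero.2 Γ'.symFactor_pos.ne'
        rw [tensorCoeff_lhs_some, subCoeff_eq, if_neg hγ, ← hP, if_neg fun h => by simp at h,
          if_neg fun h => hγ (by simpa using h.1), symFactor, add_zero, zero_add]
        simp only [Option.some_inj]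
        rw [mul_div_assoc, mul_left_comm, ← mul_div_assoc, inv_mul_cancel₀ hs, one_div,
          Finset.sum_mul]
        simp only [ite_mul, one_mul, zero_mul]
    simp only [h]
    rw [finsum_mem_sum_ite_eq]
    simp only [some_mem_graphsAt, Gluing.res_cls, Gluing.loops_cls]
    have hl : ∑ i, (components γ i).loops = unionLoops γ := sum_components γ OnePI.loops
    change ∑ d : Gluing (mkSetup Γ (components γ)),
      (if Γ.res = r ∧ Γ.loops + ∑ i, (components γ i).loops = L then _ else _) = _
    rw [hl, Finset.sum_const, Finset.card_univ, ← Nat.card_eq_fintype_card,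
      card_gluing_components Γ γ r]
    have hiff : (Γ.res = r ∧ Γ.loops + unionLoops γ = L) ↔
        (unionLoops γ ≤ L ∧ Γ.res = r ∧ Γ.loops = L - unionLoops γ) := by
      constructor <;> rintro ⟨h1, h2⟩ <;> refine ⟨?_, ?_⟩ <;> grind
    simp only [hiff]
    split_ifs
    · rw [nsmul_eq_mul, Nat.cast_mul, Nat.cast_prod, ← hP]
      field_simp
    · rw [nsmul_zero]

theorem coeff_identity (r : T.Residue) (L : ℕ) (μ ν : OnePI T →₀ ℕ) :
    ∑ᶠ Γ ∈ graphsAt T r L,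
        (symFactor Γ : k)⁻¹ * tensorCoeff k μ ν (coproduct k T (graphElt k Γ)) =
      ∑ K ∈ Finset.range (L + 1), ∑ᶠ p ∈ unionsAt T K ×ˢ graphsAt T r (L - K),
          ((ins r p.2 p.1 : k) / (unionSymFactor p.1 * symFactor p.2)) *
            tensorCoeff k μ ν (unionElt k p.1 ⊗ₜ[k] graphElt k p.2) := by
  classical
  by_cases hν : ∃ y, graphExp y = ν
  · obtain ⟨_ | Γ, rfl⟩ := hν
    · exact coeff_identity_zero k r L μ
    · exact coeff_identity_single k r L μ Γ
  · rw [not_exists] at hν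
    rw [sum_insertions_eq_zero k r L μ ν hν]
    refine finsum_mem_eq_zero_of_forall_eq_zero fun x _ => ?_
    have h0 : ν ≠ 0 := fun h => hν none h.symm
    rcases x with _ | Γ
    · rw [tensorCoeff_lhs_none, if_neg fun h => h0 h.2, mul_zero]
    · rw [tensorCoeff_lhs_some, if_neg fun h => h0 h.2, if_neg fun h => hν (some Γ) h.2,
        subCoeff_eq_zero k fun Γ h => hν (some Γ) h.symm, add_zero, add_zero, mul_zero]

theorem finite_coproduct_coeff (μ ν : OnePI T →₀ ℕ) :
    {x | tensorCoeff k μ ν (coproduct k T (graphElt k x)) ≠ 0}.Finite := by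
  classical
  have hs : {Γ : OnePI T | subCoeff k μ ν Γ.graph ≠ 0}.Finite := by
    by_cases hν : ∃ Γ, ν = Finsupp.single Γ 1
    · obtain ⟨Γ, rfl⟩ := hν
      obtain ⟨γ, rfl⟩ := Multiset.toFinsupp.surjective μ
      have := Fintype.ofFinite (Gluing (mkSetup Γ (components γ)))
      refine (Set.finite_range (Gluing.cls (S := mkSetup Γ (components γ)))).subset fun Γ' h => ?_
      by_contra hne
      refine h ?_
      rw [subCoeff_eq, Finset.sum_eq_zero fun d _ => if_neg fun h' => hne ⟨d, h'.symm⟩]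
      simp
    · rw [not_exists] at hν
      simp [subCoeff_eq_zero k hν]
  have hg : ∀ ρ : OnePI T →₀ ℕ, {x | graphExp x = ρ}.Finite := fun ρ =>
    Set.Subsingleton.finite fun x hx y hy => graphExp_injective (hx.trans hy.symm)
  refine ((Set.finite_singleton none).union
    (((hg μ).union (hg ν)).union (hs.image some))).subset fun x hx => ?_
  rcases x with _ | Γ
  · exact .inl rfl
  · right
    by_contra hne
    simp only [Set.mem_union, not_or] at hne
    refine hx ?_
    rw [tensorCoeff_lhs_some, if_neg fun h => hne.1.1 h.1, if_neg fun h => hne.1.2 h.2, zero_add,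
      zero_add]
    by_contra h
    exact hne.2 ⟨Γ, h, rfl⟩

omit [CharZero k] in
theorem finite_tmul_coeff (μ ν : OnePI T →₀ ℕ) :
    {p : Multiset (OnePI T) × Option (OnePI T) |
      tensorCoeff k μ ν (unionElt k p.1 ⊗ₜ[k] graphElt k p.2) ≠ 0}.Finite := by
  classical
  refine Set.Subsingleton.finite fun p hp q hq => ?_
  have h : ∀ p : Multiset (OnePI T) × Option (OnePI T),
      tensorCoeff k μ ν (unionElt k p.1 ⊗ₜ[k] graphElt k p.2) ≠ 0 →
      p.1 = Finsupp.toMultiset μ ∧ graphExp p.2 = ν := by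
    intro p hp
    rw [tensorCoeff_rhs] at hp
    by_contra hne
    exact hp (if_neg hne)
  exact Prod.ext ((h p hp).1.trans (h q hq).1.symm)
    (graphExp_injective ((h p hp).2.trans (h q hq).2.symm))

end Coeff

end Feynman

namespace Feynman

/-! ### Theories in which all vertices have valence at least three -/

variable {T : Theory}

open PreGraph

section Finite

theorem PreGraph.IsFeynman.card_H_le {G : PreGraph T} (hG : G.IsFeynman) :
    Nat.card G.H ≤ G.lines.ncard * 2 + Nat.card (T.LabelsOf G.res) := by
  classical
  rw [hG.lines_ncard, ← Nat.card_congr (Equiv.sumCompl G.IsInt), Nat.card_sum]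
  choose a ha using fun h : {h // ¬ G.IsInt h} => hG.exists_label h.2
  let b (h : {h // ¬ G.IsInt h}) : T.LabelsOf G.res := ⟨a h, (hG.label_type _ _ (ha h)).1⟩
  refine Nat.add_le_add_left (Nat.card_le_card_of_injective b fun h h' hh => ?_) _
  have haa : a h = a h' := congrArg Subtype.val hh
  exact Subtype.ext ((hG.label_unique (a h) (hG.label_type _ _ (ha h)).1).unique (ha h)
    (haa ▸ ha h'))

theorem PreGraph.IsFeynman.three_mul_card_V_le {G : PreGraph T} (hG : G.IsFeynman)
    (hT : ∀ v : T.VType, 3 ≤ ∑ e : T.EType, T.val v e) : 3 * Nat.card G.V ≤ Nat.card G.H := by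
  classical
  have := Fintype.ofFinite G.V
  have := Fintype.ofFinite G.H
  have h : Nat.card G.H = ∑ v : G.V, ∑ e, T.val (G.vtype v) e := by
    rw [Nat.card_eq_fintype_card, ← Finset.card_univ,
      Finset.card_eq_sum_card_fiberwise (f := G.att) (t := Finset.univ) fun _ _ => by simp]
    refine Finset.sum_congr rfl fun v _ => ?_
    rw [Finset.card_eq_sum_card_fiberwise (f := G.htype) (t := Finset.univ) fun _ _ => by simp]
    refine Finset.sum_congr rfl fun e _ => ?_
    rw [← hG.valence v e, Nat.card_eq_fintype_card, Fintype.card_subtype, Finset.filter_filter]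
  rw [h, Nat.card_eq_fintype_card, ← Finset.card_univ, mul_comm, ← smul_eq_mul,
    ← Finset.sum_const]
  exact Finset.sum_le_sum fun v _ => hT _

/-- There are finitely many 1PI graphs with given numbers of vertices and half-lines: after
numbering these, a graph is a collection of maps and relations between finite sets. -/
theorem finite_card_eq (r : T.Residue) (n m : ℕ) :
    {Γ : OnePI T | Γ.res = r ∧ Nat.card Γ.graph.V = n ∧ Nat.card Γ.graph.H = m}.Finite := by
  let S := {Γ : OnePI T | Γ.res = r ∧ Nat.card Γ.graph.V = n ∧ Nat.card Γ.graph.H = m}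
  let a (Γ : S) : Γ.1.graph.V ≃ Fin n := Finite.equivFinOfCardEq Γ.2.2.1
  let b (Γ : S) : Γ.1.graph.H ≃ Fin m := Finite.equivFinOfCardEq Γ.2.2.2
  let code (Γ : S) : (Fin m → Fin n) × (Fin n → T.VType) × (Fin m → T.EType) ×
      (Fin m → Fin m → Prop) × (Fin m → T.LabelsOf r → Prop) :=
    (fun h => a Γ (Γ.1.graph.att ((b Γ).symm h)), fun v => Γ.1.graph.vtype ((a Γ).symm v),
      fun h => Γ.1.graph.htype ((b Γ).symm h),
      fun h h' => Γ.1.graph.line ((b Γ).symm h) (.inl ((b Γ).symm h')),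
      fun h l => Γ.1.graph.line ((b Γ).symm h) (.inr l.1))
  suffices hcode : Function.Injective code from
    Set.finite_coe_iff.1 (Finite.of_injective code hcode)
  intro Γ Γ' h
  simp only [code, Prod.mk.injEq] at h
  obtain ⟨h1, h2, h3, h4, h5⟩ := h
  have hres : Γ.1.graph.res = Γ'.1.graph.res := Γ.2.1.trans Γ'.2.1.symm
  refine Subtype.ext ?_
  rw [← Γ'.1.mk_graph, OnePI.eq_mk_iff]
  refine ⟨⟨(a Γ).trans (a Γ').symm, (b Γ).trans (b Γ').symm, hres, fun h => ?_, fun v => ?_,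
    fun h => ?_, fun h h' => ?_, fun h l => ?_⟩⟩
  · simpa [Equiv.eq_symm_apply] using (congrFun h1 (b Γ h)).symm
  · simpa using (congrFun h2 (a Γ v)).symm
  · simpa using (congrFun h3 (b Γ h)).symm
  · simpa using (congrFun (congrFun h4 (b Γ h)) (b Γ h')).symm
  · by_cases hl : l.2 < T.N r l.1
    · simpa using (congrFun (congrFun h5 (b Γ h)) ⟨l, hl⟩).symm
    · refine iff_of_false (fun hh => hl ?_) fun hh => hl ?_
      · rw [← Γ'.2.1]
        exact (Γ'.1.isOnePI.isFeynman.label_type _ _ hh).1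
      · rw [← Γ.2.1]
        exact (Γ.1.isOnePI.isFeynman.label_type _ _ hh).1

theorem finite_loops_eq (hT : ∀ v : T.VType, 3 ≤ ∑ e : T.EType, T.val v e) (r : T.Residue)
    (L : ℕ) : {Γ : OnePI T | Γ.res = r ∧ Γ.loops = L}.Finite := by
  -- `3 V ≤ 2 I + N` and `I = L + V - 1` give `V ≤ 2 L + N - 2` and hence bounds for `I` and `H`
  set B := 2 * (3 * L + Nat.card (T.LabelsOf r)) + Nat.card (T.LabelsOf r)
  refine (((Set.finite_Iic B).prod (Set.finite_Iic B)).biUnion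
    fun p _ => finite_card_eq r p.1 p.2).subset ?_
  rintro Γ ⟨rfl, rfl⟩
  have h1 := Γ.isOnePI.isFeynman.card_H_le
  have h2 := Γ.isOnePI.isFeynman.three_mul_card_V_le hT
  have h3 := Γ.isOnePI.loops_eq
  simp only [Set.mem_iUnion]
  refine ⟨(Nat.card Γ.graph.V, Nat.card Γ.graph.H), ⟨?_, ?_⟩, rfl, rfl, rfl⟩ <;>
    simp only [Set.mem_Iic, B, OnePI.loops, OnePI.res] <;> omega

theorem finite_graphsAt (hT : ∀ v : T.VType, 3 ≤ ∑ e : T.EType, T.val v e) (r : T.Residue)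
    (L : ℕ) : (graphsAt T r L).Finite := by
  refine ((Set.finite_singleton none).union ((finite_loops_eq hT r L).image some)).subset ?_
  rintro x (⟨rfl, -⟩ | ⟨Γ, rfl, h⟩)
  · exact .inl rfl
  · exact .inr ⟨Γ, h, rfl⟩

/-- Every 1PI graph has a positive loop number, so that a union has at most as many components as
loops. -/
theorem finite_unionsAt (hT : ∀ v : T.VType, 3 ≤ ∑ e : T.EType, T.val v e) (K : ℕ) :
    (unionsAt T K).Finite := by
  classical
  have hF : (⋃ r, ⋃ L ∈ Set.Iic K, {Γ : OnePI T | Γ.res = r ∧ Γ.loops = L}).Finite :=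
    Set.finite_iUnion fun r => (Set.finite_Iic K).biUnion fun L _ => finite_loops_eq hT r L
  refine (Set.finite_Iic (K • hF.toFinset.val)).subset fun γ hγ => ?_
  have hγ' : (γ.map OnePI.loops).sum = K := hγ
  have hcard : γ.card ≤ K := by
    rw [← hγ', ← Multiset.card_map OnePI.loops γ]
    have := Multiset.card_nsmul_le_sum (s := γ.map OnePI.loops) (a := 1) fun x hx => by
      obtain ⟨Γ, -, rfl⟩ := Multiset.mem_map.1 hx
      exact Nat.one_le_iff_ne_zero.2 Γ.isOnePI.not_tree
    simpa using this
  refine Multiset.le_iff_count.2 fun Γ => ?_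
  by_cases hΓ : Γ ∈ γ
  · have hmem : Γ ∈ hF.toFinset.val := by
      have : Γ.loops ≤ K := by
        rw [← hγ']
        exact Multiset.single_le_sum (fun _ _ => Nat.zero_le _) _ (Multiset.mem_map_of_mem _ hΓ)
      simpa using this
    rw [Multiset.count_nsmul, Multiset.count_eq_one_of_mem hF.toFinset.nodup hmem, mul_one]
    exact (Multiset.count_le_card _ _).trans hcard
  · rw [Multiset.count_eq_zero_of_notMem hΓ]
    exact Nat.zero_le _

end Finite

section Tensor

variable (k : Type*) [Field k]

/-- Tensors are determined by their coefficients. -/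
theorem tensor_ext {x y : GraphAlg k T ⊗[k] GraphAlg k T}
    (h : ∀ μ ν, tensorCoeff k μ ν x = tensorCoeff k μ ν y) : x = y :=
  Module.Basis.ext_elem ((MvPolynomial.basisMonomials (OnePI T) k).tensorProduct
    (MvPolynomial.basisMonomials (OnePI T) k)) fun p => h p.1 p.2

theorem tensorCoeff_finsum_mem {α : Type*} {S : Set α} (hS : S.Finite) (μ ν : OnePI T →₀ ℕ)
    (c : α → k) (f : α → GraphAlg k T ⊗[k] GraphAlg k T) :
    tensorCoeff k μ ν (∑ᶠ x ∈ S, c x • f x) = ∑ᶠ x ∈ S, c x * tensorCoeff k μ ν (f x) := by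
  rw [← LinearMap.toAddMonoidHom_coe, AddMonoidHom.map_finsum_mem _ _ hS]
  simp only [LinearMap.toAddMonoidHom_coe, map_smul, smul_eq_mul]

end Tensor

end Feynman

theorem mainTheorem2 (k : Type*) [Field k] [CharZero k] (T : Theory) (r : T.Residue) (L : ℕ) :
    -- the identity of formal sums, coefficient by coefficient
    (∀ μ ν : OnePI T →₀ ℕ,
      {Γ | Γ ∈ graphsAt T r L ∧
        tensorCoeff k μ ν (coproduct k T (graphElt k Γ)) ≠ 0}.Finite ∧
      (∀ K ≤ L, {p : Multiset (OnePI T) × Option (OnePI T) |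
        p ∈ unionsAt T K ×ˢ graphsAt T r (L - K) ∧
        tensorCoeff k μ ν (unionElt k p.1 ⊗ₜ[k] graphElt k p.2) ≠ 0}.Finite) ∧
      ∑ᶠ Γ ∈ graphsAt T r L,
          (symFactor Γ : k)⁻¹ * tensorCoeff k μ ν (coproduct k T (graphElt k Γ)) =
        ∑ K ∈ Finset.range (L + 1), ∑ᶠ p ∈ unionsAt T K ×ˢ graphsAt T r (L - K),
          ((ins r p.2 p.1 : k) / (unionSymFactor p.1 * symFactor p.2)) *
            tensorCoeff k μ ν (unionElt k p.1 ⊗ₜ[k] graphElt k p.2)) ∧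
    -- if all vertices have valence at least three, the sums are finite sums of tensors
    ((∀ v : T.VType, 3 ≤ ∑ e : T.EType, T.val v e) →
      (graphsAt T r L).Finite ∧
      (∀ K ≤ L, (unionsAt T K ×ˢ graphsAt T r (L - K)).Finite) ∧
      ∑ᶠ Γ ∈ graphsAt T r L, (symFactor Γ : k)⁻¹ • coproduct k T (graphElt k Γ) =
        ∑ K ∈ Finset.range (L + 1), ∑ᶠ p ∈ unionsAt T K ×ˢ graphsAt T r (L - K),
          ((ins r p.2 p.1 : k) / (unionSymFactor p.1 * symFactor p.2)) •
            (unionElt k p.1 ⊗ₜ[k] graphElt k p.2)) := by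
  refine ⟨fun μ ν => ⟨(finite_coproduct_coeff k μ ν).subset fun x hx => hx.2,
    fun K _ => (finite_tmul_coeff k μ ν).subset fun p hp => hp.2, coeff_identity k r L μ ν⟩,
    fun hT => ?_⟩
  have h1 := finite_graphsAt hT r
  have h2 : ∀ K, (unionsAt T K ×ˢ graphsAt T r (L - K)).Finite := fun K =>
    (finite_unionsAt hT K).prod (h1 (L - K))
  refine ⟨h1 L, fun K _ => h2 K, tensor_ext k fun μ ν => ?_⟩
  rw [tensorCoeff_finsum_mem k (h1 L), map_sum, coeff_identity k r L μ ν]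
  exact Finset.sum_congr rfl fun K _ => (tensorCoeff_finsum_mem k (h2 K) μ ν
    (fun p => ((ins r p.2 p.1 : k) / (unionSymFactor p.1 * symFactor p.2))) _).symm
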